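/- **Theorem (decomposition theorem for cyclic $A_\infty$-algebras).** Let $k$ be a field of characteristic zero (for example $k=\mathbb{C}$). *Definitions.* An $A_\infty$-algebra $(\mathcal H,\mathfrak m)$ is a $\mathbb Z$-graded $k$-vector space $\mathcal H=\bigoplus_{i\in\mathbb Z}\mathcal H^i$ with multilinear maps $m_n:\mathcal H^{\otimes n}\to\mathcal H$ ($n\ge 1$; $m_0=0$) of degree $+1$ such that for all $n\ge1$ and homogeneous $o_1,\dots,o_n$ $$\sum_{\substack{r+l=n+1\\ r,l\ge1}}\ \sum_{j=0}^{r-1}(-1)^{\deg o_1+\cdots+\deg o_j}\,m_r(o_1,\dots,o_j,m_l(o_{j+1},\dots,o_{j+l}),o_{j+l+1},\dots,o_n)=0 .$$ It is *cyclic* with respect to a bilinear form $\omega:\mathcal H\otimes\mathcal H\to k$ if $\omega$ is nondegenerate (for each $o\neq0$ there is $o'$ with $\omega(o,o')\ne0$), skew-symmetric, of degree $-1$ ($\omega(o,o')=0$ for homogeneous $o,o'$ unless $\deg o+\deg o'=1$), and for all $n\ge1$ and homogeneous $o_1,\dots,o_{n+1}$ $$\omega(o_1,m_n(o_2,\dots,o_{n+1}))=(-1)^{\deg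 o_2}\,\omega(o_2,m_n(o_3,\dots,o_{n+1},o_1)).$$ It is *minimal* if $m_1=0$, and *linear contractible* if $m_n=0$ for $n\ge2$ and $m_1$ has trivial cohomology. The direct sum of two cyclic $A_\infty$-algebras has the componentwise operations and the orthogonal direct sum of the two forms. An *$A_\infty$-morphism* $\mathcal F:(\mathcal H,\mathfrak m)\to(\mathcal H',\mathfrak m')$ is a family of multilinear maps $f_n:\mathcal H^{\otimes n}\to\mathcal H'$ ($n\ge1$) of degree $0$ such that for all $n\ge 1$ and homogeneous $o_1,\dots,o_n$ $$\sum_{i\ge1}\ \sum_{0=n_0<n_1<\cdots<n_i=n} m'_i\big(f_{n_1}(o_1,\dots,o_{n_1}),\dots,f_{n-n_{i-1}}(o_{n_{i-1}+1},\dots,o_n)\big)=\sum_{\substack{r+l=n+1\\ r,l\ge1}}\ \sum_{j=0}^{r-1}(-1)^{\deg o_1+\cdots+\deg o_j}f_r(o_1,\dots,o_j,m_l(o_{j+1},\dots,o_{j+l}),o_{j+l+1},\dots,o_n).$$ It is *cyclic* if $\omega'(f_1(o),f_1(o'))=\omega(o,o')$ for all $o,o'$, and $\sum_{r+l=n,\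 r,l\ge1}\omega'(f_r(o_1,\dots,o_r),f_l(o_{r+1},\dots,o_n))=0$ for all $n\ge3$ and all $o_1,\dots,o_n$. A *cyclic $A_\infty$-isomorphism* is a cyclic $A_\infty$-morphism with $f_1$ bijective. A *homotopy operator of $Q=m_1$ compatible with $\omega$* is a linear map $Q^+:\mathcal H\to\mathcal H$ of degree $-1$ such that $P:=1-QQ^+-Q^+Q$ satisfies $P^2=P$ and $QP=0$, and such that $\omega(P\mathcal H,Q^+Q\mathcal H)=\omega(Q^+Q\mathcal H,Q^+Q\mathcal H)=0$. *Statement.* Let $(\mathcal H,\omega,\mathfrak m)$ be a cyclic $A_\infty$-algebra over $k$. Assume that every $\mathcal H^i$ is finite-dimensional or that (with no restriction on dimensions) there is a homotopy operator of $m_1$ compatible with $\omega$. Then $(\mathcal H,\omega,\mathfrak m)$ is cyclic $A_\infty$-isomorphic to the direct sum of a minimal cyclic $A_\infty$-algebra and a linear contractible cyclic $A_\infty$-algebra. In particular the symplectic form is carried to the orthogonal direct sum of the symplectic forms of the two summands. -/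

import Mathlib

open scoped BigOperators

universe u v

section Families

variable {K : Type u} [Field K] {V : Type v} [AddCommGroup V] [Module K V]
variable {W : Type v} [AddCommGroup W] [Module K W]

/-- A family `(g_n)_{n ≥ 0}` of `K`-multilinear maps `g_n : V^{⊗ n} → W`. -/
abbrev MultFamily (K : Type u) [Field K] (V : Type v) [AddCommGroup V] [Module K V]
    (W : Type v) [AddCommGroup W] [Module K W] : Type v :=
  ∀ n : ℕ, MultilinearMap K (fun _ : Fin n => V) W

/-- The family `g` has degree `e`: `g_n(o_1, …, o_n)` is homogeneous of degree
`deg o_1 + ⋯ + deg o_n + e` for homogeneous `o_1, …, o_n`. -/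
def MultFamily.HasDegree (g : MultFamily K V W) (𝒱 : ℤ → Submodule K V)
    (𝒲 : ℤ → Submodule K W) (e : ℤ) : Prop :=
  ∀ (n : ℕ) (d : Fin n → ℤ) (o : Fin n → V), (∀ i, o i ∈ 𝒱 (d i)) →
    g n o ∈ 𝒲 ((∑ i, d i) + e)

/-- For a sequence `o_0, o_1, …` (only the first `n` entries matter) with degrees `d_0, d_1, …`,
the signed sum
`∑_{k + l = n + 1, l ≥ 1} ∑_{0 ≤ j ≤ k - 1} (-1)^{d_0 + ⋯ + d_{j-1}}
  g_k(o_0, …, o_{j-1}, m_l(o_j, …, o_{j+l-1}), o_{j+l}, …, o_{n-1})`. -/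
def insertionSum (g : MultFamily K V W) (m : MultFamily K V V) (n : ℕ)
    (d : ℕ → ℤ) (o : ℕ → V) : W :=
  ∑ l ∈ Finset.Icc 1 n, ∑ j ∈ Finset.range (n + 1 - l),
    ((-1 : K) ^ (∑ i ∈ Finset.range j, d i)) •
      g (n + 1 - l) (fun i : Fin (n + 1 - l) =>
        if (i : ℕ) < j then o i
        else if (i : ℕ) = j then m l (fun t : Fin l => o (j + t))
        else o (i + l - 1))

/-- The sum over all ways of cutting `o_0, …, o_{n-1}` into `i ≥ 1` consecutive nonempty blocks,
`∑ m'_i(f(block_1), …, f(block_i))`. -/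
def compositionSum (m' : MultFamily K W W) (f : MultFamily K V W) (n : ℕ) (o : ℕ → V) : W :=
  ∑ c : Composition n, m' c.length (fun i =>
    f (c.blocksFun i) (fun t => o (c.embedding i t : ℕ)))

end Families

/-- A (non-curved) `A_∞`-algebra over `K`, in the convention in which all `m_k` have degree `+1`. -/
structure AInftyAlgebra (K : Type u) [Field K] where
  carrier : Type v
  [addCommGroup : AddCommGroup carrier]
  [module : Module K carrier]
  /-- the homogeneous components `H^k`, `k ∈ ℤ` -/
  grading : ℤ → Submodule K carrier
  isInternal : DirectSum.IsInternal grading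
  m : MultFamily K carrier carrier
  m_zero : m 0 = 0
  m_degree : m.HasDegree grading grading 1
  relation : ∀ n : ℕ, 1 ≤ n → ∀ (d : ℕ → ℤ) (o : ℕ → carrier), (∀ i, o i ∈ grading (d i)) →
    insertionSum m m n d o = 0

attribute [instance] AInftyAlgebra.addCommGroup AInftyAlgebra.module

namespace AInftyAlgebra

variable {K : Type u} [Field K]

/-- The differential `Q = m_1` as a linear map. -/
def Q (A : AInftyAlgebra.{u, v} K) : A.carrier →ₗ[K] A.carrier where
  toFun o := A.m 1 (fun _ => o)
  map_add' x y := by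
    have h := (A.m 1).map_update_add (fun _ => 0) 0 x y
    have e : ∀ z : A.carrier, Function.update (fun _ : Fin 1 => (0 : A.carrier)) 0 z
        = fun _ => z := fun z => by
      funext i; rw [Subsingleton.elim i 0]; simp
    simpa only [e] using h
  map_smul' c x := by
    have h := (A.m 1).map_update_smul (fun _ => 0) 0 c x
    have e : ∀ z : A.carrier, Function.update (fun _ : Fin 1 => (0 : A.carrier)) 0 z
        = fun _ => z := fun z => by
      funext i; rw [Subsingleton.elim i 0]; simp
    simpa only [e, RingHom.id_apply] using h

/-- Minimal: `m_1 = 0`. -/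
def IsMinimal (A : AInftyAlgebra.{u, v} K) : Prop := A.m 1 = 0

/-- Linear contractible: `m_k = 0` for `k ≥ 2`, and `Q = m_1` has trivial cohomology. -/
def IsLinearContractible (A : AInftyAlgebra.{u, v} K) : Prop :=
  (∀ k, 2 ≤ k → A.m k = 0) ∧ ∀ o, A.Q o = 0 → ∃ o', A.Q o' = o

/-- An `A_∞`-morphism: a family of maps `f_k` of degree `0` with `f_0 = 0`, compatible with the
`A_∞`-structures. -/
structure Hom (A B : AInftyAlgebra.{u, v} K) where
  f : MultFamily K A.carrier B.carrier
  f_zero : f 0 = 0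
  f_degree : f.HasDegree A.grading B.grading 0
  relation : ∀ n : ℕ, 1 ≤ n → ∀ (d : ℕ → ℤ) (o : ℕ → A.carrier),
    (∀ i, o i ∈ A.grading (d i)) →
      compositionSum B.m f n o = insertionSum f A.m n d o

/-- An `A_∞`-morphism is an `A_∞`-isomorphism if its linear part `f_1` is bijective. -/
def Hom.IsIso {A B : AInftyAlgebra.{u, v} K} (F : Hom A B) : Prop :=
  Function.Bijective (fun o : A.carrier => F.f 1 (fun _ => o))

end AInftyAlgebra

/-- A cyclic `A_∞`-algebra: an `A_∞`-algebra with an odd constant symplectic structure `ω`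
(a nondegenerate skew-symmetric bilinear form of degree `-1`) for which all `m_k` are cyclic. -/
structure CyclicAInftyAlgebra (K : Type u) [Field K] extends AInftyAlgebra.{u, v} K where
  ω : carrier →ₗ[K] carrier →ₗ[K] K
  ω_degree : ∀ (a b : ℤ) (x y : carrier), x ∈ grading a → y ∈ grading b → a + b ≠ 1 → ω x y = 0
  ω_skew : ∀ x y : carrier, ω y x = - ω x y
  ω_nondegenerate : ∀ x : carrier, x ≠ 0 → ∃ y, ω x y ≠ 0
  /-- `ω(o_0, m_k(o_1, …, o_k)) = (-1)^{deg o_1} ω(o_1, m_k(o_2, …, o_k, o_0))` -/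
  cyclic : ∀ k : ℕ, 1 ≤ k → ∀ (d : ℕ → ℤ) (o : ℕ → carrier), (∀ i, o i ∈ grading (d i)) →
    ω (o 0) (m k (fun i => o (i + 1))) =
      (-1 : K) ^ (d 1) *
        ω (o 1) (m k (fun i => if (i : ℕ) + 1 = k then o 0 else o (i + 2)))

/-- A cyclic `A_∞`-morphism: an `A_∞`-morphism with `ω'(f_1 x, f_1 y) = ω(x, y)` and
`∑_{k + l = n, k, l ≥ 1} ω'(f_k(o_0, …, o_{k-1}), f_l(o_k, …, o_{n-1})) = 0` for `n ≥ 3`. -/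
structure CyclicAInftyAlgebra.Hom {K : Type u} [Field K] (A B : CyclicAInftyAlgebra.{u, v} K)
    extends AInftyAlgebra.Hom A.toAInftyAlgebra B.toAInftyAlgebra where
  map_ω : ∀ x y : A.carrier, B.ω (f 1 (fun _ => x)) (f 1 (fun _ => y)) = A.ω x y
  map_ω_higher : ∀ n : ℕ, 3 ≤ n → ∀ o : ℕ → A.carrier,
    ∑ k ∈ Finset.Ico 1 n,
      B.ω (f k (fun i => o i)) (f (n - k) (fun i => o (k + i))) = 0

section Product

variable {K : Type u} [Field K] {V : Type v} [AddCommGroup V] [Module K V]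
variable {W : Type v} [AddCommGroup W] [Module K W]

/-- The componentwise direct sum of two families of multilinear operations. -/
def MultFamily.prodFamily (m : MultFamily K V V) (m' : MultFamily K W W) :
    MultFamily K (V × W) (V × W) := fun n =>
  ((m n).compLinearMap (fun _ => LinearMap.fst K V W)).prod
    ((m' n).compLinearMap (fun _ => LinearMap.snd K V W))

theorem MultFamily.prodFamily_apply (m : MultFamily K V V) (m' : MultFamily K W W) (n : ℕ)
    (o : Fin n → V × W) :
    m.prodFamily m' n o = (m n (fun i => (o i).1), m' n (fun i => (o i).2)) := rfl

theorem insertionSum_prodFamily (m : MultFamily K V V) (m' : MultFamily K W W) (n : ℕ)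
    (d : ℕ → ℤ) (o : ℕ → V × W) :
    insertionSum (m.prodFamily m') (m.prodFamily m') n d o =
      (insertionSum m m n d (fun i => (o i).1), insertionSum m' m' n d (fun i => (o i).2)) := by
  unfold insertionSum
  ext
  · simp only [Prod.fst_sum, Prod.smul_fst, MultFamily.prodFamily_apply, apply_ite Prod.fst]
  · simp only [Prod.snd_sum, Prod.smul_snd, MultFamily.prodFamily_apply, apply_ite Prod.snd]

theorem isInternal_prod {𝒱 : ℤ → Submodule K V} {𝒲 : ℤ → Submodule K W}
    (hV : DirectSum.IsInternal 𝒱) (hW : DirectSum.IsInternal 𝒲) :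
    DirectSum.IsInternal (fun i => (𝒱 i).prod (𝒲 i)) := by
  rw [DirectSum.isInternal_submodule_iff_iSupIndep_and_iSup_eq_top] at hV hW ⊢
  refine ⟨fun i => ?_, ?_⟩
  · rw [Submodule.disjoint_def]
    rintro ⟨x, y⟩ ⟨hx, hy⟩ h
    have hle : (⨆ j, ⨆ (_ : j ≠ i), (𝒱 j).prod (𝒲 j)) ≤
        (⨆ j, ⨆ (_ : j ≠ i), 𝒱 j).prod (⨆ j, ⨆ (_ : j ≠ i), 𝒲 j) :=
      iSup₂_le fun j hj => Submodule.prod_mono (le_iSup₂_of_le j hj le_rfl)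
        (le_iSup₂_of_le j hj le_rfl)
    obtain ⟨h1, h2⟩ := hle h
    have e1 := Submodule.disjoint_def.1 (hV.1 i) x hx h1
    have e2 := Submodule.disjoint_def.1 (hW.1 i) y hy h2
    simp [e1, e2]
  · rw [eq_top_iff]
    rintro ⟨x, y⟩ -
    have hl : (⨆ i, 𝒱 i) ≤ (⨆ i, (𝒱 i).prod (𝒲 i)).comap (LinearMap.inl K V W) :=
      iSup_le fun i z hz => (le_iSup (fun i => (𝒱 i).prod (𝒲 i)) i) ⟨hz, (𝒲 i).zero_mem⟩
    have hr : (⨆ i, 𝒲 i) ≤ (⨆ i, (𝒱 i).prod (𝒲 i)).comap (LinearMap.inr K V W) :=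
      iSup_le fun i z hz => (le_iSup (fun i => (𝒱 i).prod (𝒲 i)) i) ⟨(𝒱 i).zero_mem, hz⟩
    have h1 := hl (x := x) (by rw [hV.2]; trivial)
    have h2 := hr (x := y) (by rw [hW.2]; trivial)
    simpa using Submodule.add_mem (⨆ i, (𝒱 i).prod (𝒲 i)) h1 h2

end Product

namespace CyclicAInftyAlgebra

variable {K : Type u} [Field K]

/-- The direct sum of two cyclic `A_∞`-algebras: underlying space `A × B`, operations componentwise,
and `ω` the orthogonal direct sum of the two symplectic forms. -/
def directSum (A B : CyclicAInftyAlgebra.{u, v} K) : CyclicAInftyAlgebra.{u, v} K where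
  carrier := A.carrier × B.carrier
  grading i := (A.grading i).prod (B.grading i)
  isInternal := isInternal_prod A.isInternal B.isInternal
  m := A.m.prodFamily B.m
  m_zero := by
    ext o
    · simp [MultFamily.prodFamily_apply, A.m_zero]
    · simp [MultFamily.prodFamily_apply, B.m_zero]
  m_degree n d o ho := ⟨A.m_degree n d _ fun i => (ho i).1, B.m_degree n d _ fun i => (ho i).2⟩
  relation n hn d o ho := by
    rw [insertionSum_prodFamily, A.relation n hn d _ fun i => (ho i).1,
      B.relation n hn d _ fun i => (ho i).2]
    rfl
  ω := A.ω.compl₁₂ (LinearMap.fst K _ _) (LinearMap.fst K _ _) +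
    B.ω.compl₁₂ (LinearMap.snd K _ _) (LinearMap.snd K _ _)
  ω_degree a b x y hx hy h := by
    simp [A.ω_degree a b _ _ hx.1 hy.1 h, B.ω_degree a b _ _ hx.2 hy.2 h]
  ω_skew x y := by
    simp [A.ω_skew x.1 y.1, B.ω_skew x.2 y.2, add_comm]
  ω_nondegenerate x hx := by
    by_cases h : x.1 = 0
    · have h2 : x.2 ≠ 0 := fun h2 => hx (Prod.ext h h2)
      obtain ⟨y, hy⟩ := B.ω_nondegenerate _ h2
      exact ⟨(0, y), by simpa using hy⟩
    · obtain ⟨y, hy⟩ := A.ω_nondegenerate _ h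
      exact ⟨(y, 0), by simpa using hy⟩
  cyclic k hk d o ho := by
    have hA := A.cyclic k hk d _ fun i => (ho i).1
    have hB := B.cyclic k hk d _ fun i => (ho i).2
    simp only [LinearMap.add_apply, LinearMap.compl₁₂_apply, LinearMap.fst_apply,
      LinearMap.snd_apply, MultFamily.prodFamily_apply, apply_ite Prod.fst, apply_ite Prod.snd,
      mul_add]
    rw [hA, hB]

/-- `Qp` is a homotopy operator of `Q = m_1` compatible with `ω`: it is linear of degree `-1`,
`P := 1 - Q Qp - Qp Q` satisfies `P² = P` and `Q P = 0`, and, with `H^p` the image of `P` and `H^u`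
the image of `Qp Q`, one has `ω(H^p, H^u) = ω(H^u, H^u) = 0`. -/
def IsCompatibleHomotopy (A : CyclicAInftyAlgebra.{u, v} K)
    (Qp : A.carrier →ₗ[K] A.carrier) : Prop :=
  (∀ i, ∀ x ∈ A.grading i, Qp x ∈ A.grading (i - 1)) ∧
  ∃ P : A.carrier →ₗ[K] A.carrier,
    A.Q ∘ₗ Qp + Qp ∘ₗ A.Q + P = LinearMap.id ∧ P ∘ₗ P = P ∧ A.Q ∘ₗ P = 0 ∧
    (∀ x y, A.ω (P x) (Qp (A.Q y)) = 0) ∧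
    (∀ x y, A.ω (Qp (A.Q x)) (Qp (A.Q y)) = 0)

end CyclicAInftyAlgebra

/-! The tensor algebra of `V` with the deconcatenation coproduct is the cofree setting for the
problem. An `A_∞`-structure is an odd coderivation `D` with `D² = 0`. It is cyclic exactly when
`pairing ω ∘ D = 0`, where `pairing ω` evaluates the form on words of length two and vanishes on all
other words. A cyclic morphism is a coalgebra map that intertwines the differentials and preserves
the pairing. So the task is to conjugate `D` by a pairing-preserving automorphism until its higher
operations live on a complement of the contractible part.

The complement comes from a Hodge decomposition (`IsHodge`): a homotopy `h` of degree `-1`,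
self-adjoint for `ω` up to the parity sign, with `QhQ = Q`, `hQh = h` and `h² = 0`. Then `N = Qh +
hQ` (`numOp`) and `P = 1 - N` (`harm`) are complementary self-adjoint projections, `Q` vanishes on
the image of `P` and is contractible on the image of `N`. A compatible homotopy `R` gives `h = RQR`.
In finite dimensions one averages a generalized inverse of `Q` with its adjoint and then corrects it
until its square vanishes.

The splitting is an induction on arity (`IsHodge.exists_gauge`). If the operations of arity `2, …,
n` already factor through `P` on inputs and output, the Maurer–Cartan equation says that the
differential of `m_{n+1}` is a composite of such operations, hence is annihilated by `h` on either
side. The homotopy formula then shows that `h m_{n+1} - m_{n+1} ĥ`, with `ĥ` the coderivation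
extending `h`, has differential `𝒩 m_{n+1}`. Here `𝒩` counts the letters (inputs and output) in the
image of `N`. Its eigenvalues in arity `n + 1` are `0, …, n + 2`, so over a field of characteristic
zero a polynomial in `𝒩` inverts it off its kernel. This gives a `g` of arity `n + 1` with `d g =
m_{n+1} - P m_{n+1} P`. All operators involved respect `ω`, so `g` is Hamiltonian and the
exponential of its coderivation preserves the pairing. Conjugation by this exponential fixes the
operations of arity at most `n` and replaces `m_{n+1}` by its harmonic part.

Stage `n` of the construction changes nothing on words of length at most `n`, so the infinite
product converges word by word (`IsHodge.exists_gauge_split`). Afterwards `P` and `N` commute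
strictly with all operations, and their images are the minimal and the linear contractible summand.

Degrees and signs are carried by scaling operators that act by `c ^ i` in degree `i`. The value `c =
-1` gives the Koszul signs, and `c = 2` detects the degree. -/

namespace BarCoalgebra

/-! ### The deconcatenation coalgebra, convolutions, and cofreeness of coderivations. -/

section Deconcatenation

open TensorAlgebra TensorProduct

variable {K : Type u} [Field K] {V : Type v} [AddCommGroup V] [Module K V]

/-- A subspace-like property of tensors holds everywhere if it holds for `1` and is stable under
multiplication by a letter on the left. -/
theorem induction_left {C : TensorAlgebra K V → Prop} (one : C 1)
    (mul : ∀ x w, C w → C (ι K x * w)) (add : ∀ a b, C a → C b → C (a + b))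
    (smul : ∀ (c : K) a, C a → C (c • a)) (w : TensorAlgebra K V) : C w := by
  have key : ∀ a : TensorAlgebra K V, ∀ w, C w → C (a * w) := by
    intro a
    induction a using TensorAlgebra.induction with
    | algebraMap r => intro w hw; rw [← Algebra.smul_def]; exact smul r w hw
    | ι x => exact mul x
    | mul a b ha hb => intro w hw; rw [mul_assoc]; exact ha _ (hb _ hw)
    | add a b ha hb => intro w hw; rw [add_mul]; exact add _ _ (ha w hw) (hb w hw)
  simpa using key w 1 one

theorem linearMap_ext_left {M : Type*} [AddCommGroup M] [Module K M]
    {A B : TensorAlgebra K V →ₗ[K] M} (one : A 1 = B 1)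
    (mul : ∀ x w, A w = B w → A (ι K x * w) = B (ι K x * w)) : A = B := by
  ext w
  induction w using induction_left with
  | one => exact one
  | mul x w h => exact mul x w h
  | add a b ha hb => simp [ha, hb]
  | smul c a h => simp [h]

/-- The linear map out of the tensor algebra determined by left recursion on words. -/
noncomputable def leftRec {M : Type*} [AddCommGroup M] [Module K M] (s : M)
    (act : V →ₗ[K] Module.End K M) : TensorAlgebra K V →ₗ[K] M :=
  LinearMap.applyₗ s ∘ₗ (TensorAlgebra.lift K act).toLinearMap

theorem leftRec_one {M : Type*} [AddCommGroup M] [Module K M] (s : M)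
    (act : V →ₗ[K] Module.End K M) : leftRec s act 1 = s := by
  simp [leftRec]

theorem leftRec_mul {M : Type*} [AddCommGroup M] [Module K M] (s : M)
    (act : V →ₗ[K] Module.End K M) (x : V) (w : TensorAlgebra K V) :
    leftRec s act (ι K x * w) = act x (leftRec s act w) := by
  simp [leftRec]

/-- Left multiplication by a letter. -/
noncomputable def lmul (x : V) : TensorAlgebra K V →ₗ[K] TensorAlgebra K V :=
  LinearMap.mulLeft K (ι K x)

@[simp] theorem lmul_apply (x : V) (w : TensorAlgebra K V) : lmul x w = ι K x * w := rfl

/-- The left recursion step computing a word together with its deconcatenation. -/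
noncomputable def comulAct : V →ₗ[K] Module.End K
    (TensorAlgebra K V × (TensorAlgebra K V ⊗[K] TensorAlgebra K V)) :=
  LinearMap.mk₂ K (fun x p => (ι K x * p.1,
      (ι K x ⊗ₜ[K] (1 : TensorAlgebra K V)) * p.2 + (1 : TensorAlgebra K V) ⊗ₜ[K] (ι K x * p.1)))
    (fun x y p => by
      ext <;> simp [add_mul, TensorProduct.add_tmul, TensorProduct.tmul_add]; abel)
    (fun c x p => by
      ext
      · simp
      · simp only [map_smul, ← TensorProduct.smul_tmul', smul_mul_assoc, Prod.smul_snd,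
          TensorProduct.tmul_smul, smul_add])
    (fun x p q => by
      ext <;> simp [mul_add, TensorProduct.tmul_add]; abel)
    (fun c x p => by
      ext <;> simp)

theorem comulAct_apply (x : V)
    (p : TensorAlgebra K V × (TensorAlgebra K V ⊗[K] TensorAlgebra K V)) :
    comulAct x p = (ι K x * p.1, (ι K x ⊗ₜ[K] (1 : TensorAlgebra K V)) * p.2 +
      (1 : TensorAlgebra K V) ⊗ₜ[K] (ι K x * p.1)) := rfl

/-- The recursion has to carry the word along because the new term `1 ⊗ x w` of the coproduct needs
it. -/
theorem leftRec_comulAct_fst (w : TensorAlgebra K V) :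
    (leftRec (1, 1 ⊗ₜ 1) comulAct w).1 = w := by
  have h : LinearMap.fst K _ _ ∘ₗ leftRec (1, 1 ⊗ₜ 1) (comulAct (K := K) (V := V)) =
      LinearMap.id := by
    apply linearMap_ext_left
    · simp [leftRec_one]
    · intro x w h
      simp only [LinearMap.comp_apply, LinearMap.fst_apply, LinearMap.id_apply] at h ⊢
      rw [leftRec_mul, comulAct_apply, h]
  exact LinearMap.congr_fun h w

/-- The deconcatenation coproduct. -/
noncomputable def comul :
    TensorAlgebra K V →ₗ[K] TensorAlgebra K V ⊗[K] TensorAlgebra K V :=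
  LinearMap.snd K _ _ ∘ₗ leftRec (1, 1 ⊗ₜ 1) comulAct

theorem comul_one : comul (1 : TensorAlgebra K V) = 1 ⊗ₜ 1 := by
  simp [comul, leftRec_one]

theorem comul_mul (x : V) (w : TensorAlgebra K V) :
    comul (ι K x * w) =
      (ι K x ⊗ₜ[K] (1 : TensorAlgebra K V)) * comul w + 1 ⊗ₜ[K] (ι K x * w) := by
  simp only [comul, LinearMap.comp_apply, LinearMap.snd_apply, leftRec_mul, comulAct_apply,
    leftRec_comulAct_fst]

variable {X Y Z X' Y' U : Type*} [AddCommGroup X] [Module K X] [AddCommGroup Y] [Module K Y]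
  [AddCommGroup Z] [Module K Z] [AddCommGroup X'] [Module K X'] [AddCommGroup Y'] [Module K Y']
  [AddCommGroup U] [Module K U]

/-- The convolution `w ↦ ∑ β (A w') (B w'')` over all deconcatenations `w = w' w''`. -/
noncomputable def conv (β : X →ₗ[K] Y →ₗ[K] Z) (A : TensorAlgebra K V →ₗ[K] X)
    (B : TensorAlgebra K V →ₗ[K] Y) : TensorAlgebra K V →ₗ[K] Z :=
  TensorProduct.lift (β.compl₁₂ A B) ∘ₗ comul

theorem conv_one (β : X →ₗ[K] Y →ₗ[K] Z) (A : TensorAlgebra K V →ₗ[K] X)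
    (B : TensorAlgebra K V →ₗ[K] Y) : conv β A B 1 = β (A 1) (B 1) := by
  simp [conv, comul_one]

theorem conv_congr {β : X →ₗ[K] Y →ₗ[K] Z} {A : TensorAlgebra K V →ₗ[K] X}
    {B : TensorAlgebra K V →ₗ[K] Y} {β' : X' →ₗ[K] Y' →ₗ[K] Z}
    {A' : TensorAlgebra K V →ₗ[K] X'} {B' : TensorAlgebra K V →ₗ[K] Y'}
    (h : ∀ u v, β (A u) (B v) = β' (A' u) (B' v)) : conv β A B = conv β' A' B' := by
  have : β.compl₁₂ A B = β'.compl₁₂ A' B' := by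
    ext u v; simpa using h u v
  simp [conv, this]

theorem comp_conv (φ : Z →ₗ[K] U) (β : X →ₗ[K] Y →ₗ[K] Z) (A : TensorAlgebra K V →ₗ[K] X)
    (B : TensorAlgebra K V →ₗ[K] Y) : φ ∘ₗ conv β A B = conv (β.compr₂ φ) A B := by
  rw [conv, conv, ← LinearMap.comp_assoc]
  congr 1
  ext u v
  simp

theorem conv_add_left (β : X →ₗ[K] Y →ₗ[K] Z) (A A' : TensorAlgebra K V →ₗ[K] X)
    (B : TensorAlgebra K V →ₗ[K] Y) : conv β (A + A') B = conv β A B + conv β A' B := by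
  rw [conv, conv, conv, ← LinearMap.add_comp]
  congr 1
  ext u v
  simp

theorem conv_add_right (β : X →ₗ[K] Y →ₗ[K] Z) (A : TensorAlgebra K V →ₗ[K] X)
    (B B' : TensorAlgebra K V →ₗ[K] Y) : conv β A (B + B') = conv β A B + conv β A B' := by
  rw [conv, conv, conv, ← LinearMap.add_comp]
  congr 1
  ext u v
  simp

theorem conv_smul_left (c : K) (β : X →ₗ[K] Y →ₗ[K] Z) (A : TensorAlgebra K V →ₗ[K] X)
    (B : TensorAlgebra K V →ₗ[K] Y) : conv β (c • A) B = c • conv β A B := by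
  rw [conv, conv, ← LinearMap.smul_comp]
  congr 1
  ext u v
  simp

theorem conv_smul_right (c : K) (β : X →ₗ[K] Y →ₗ[K] Z) (A : TensorAlgebra K V →ₗ[K] X)
    (B : TensorAlgebra K V →ₗ[K] Y) : conv β A (c • B) = c • conv β A B := by
  rw [conv, conv, ← LinearMap.smul_comp]
  congr 1
  ext u v
  simp

theorem conv_neg_left (β : X →ₗ[K] Y →ₗ[K] Z) (A : TensorAlgebra K V →ₗ[K] X)
    (B : TensorAlgebra K V →ₗ[K] Y) : conv β (-A) B = -conv β A B := by
  simpa using conv_smul_left (-1) β A B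

theorem conv_neg_right (β : X →ₗ[K] Y →ₗ[K] Z) (A : TensorAlgebra K V →ₗ[K] X)
    (B : TensorAlgebra K V →ₗ[K] Y) : conv β A (-B) = -conv β A B := by
  simpa using conv_smul_right (-1) β A B

theorem conv_zero_left (β : X →ₗ[K] Y →ₗ[K] Z) (B : TensorAlgebra K V →ₗ[K] Y) :
    conv β 0 B = 0 := by
  simpa using conv_smul_left 0 β 0 B

theorem conv_zero_right (β : X →ₗ[K] Y →ₗ[K] Z) (A : TensorAlgebra K V →ₗ[K] X) :
    conv β A 0 = 0 := by
  simpa using conv_smul_right 0 β A 0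

/-- A cut of `x w` either leaves `x` in the left piece and cuts `w`, or comes before `x`. -/
theorem conv_mul (β : X →ₗ[K] Y →ₗ[K] Z) (A : TensorAlgebra K V →ₗ[K] X)
    (B : TensorAlgebra K V →ₗ[K] Y) (x : V) (w : TensorAlgebra K V) :
    conv β A B (ι K x * w) = conv β (A ∘ₗ lmul x) B w + β (A 1) (B (ι K x * w)) := by
  simp only [conv, LinearMap.comp_apply, comul_mul, map_add, TensorProduct.lift.tmul,
    LinearMap.compl₁₂_apply]
  congr 1
  generalize comul w = s
  induction s using TensorProduct.induction_on with
  | zero => simp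
  | tmul a b => simp
  | add a b ha hb => rw [mul_add, map_add, map_add, ha, hb]

theorem conv_comp_lmul (β : X →ₗ[K] Y →ₗ[K] Z) (A : TensorAlgebra K V →ₗ[K] X)
    (B : TensorAlgebra K V →ₗ[K] Y) (x : V) :
    conv β A B ∘ₗ lmul x = conv β (A ∘ₗ lmul x) B + β (A 1) ∘ₗ B ∘ₗ lmul x := by
  ext w
  simp [conv_mul]

/-- Coassociativity of deconcatenation. -/
theorem conv_assoc {W₁ W₂ : Type*} [AddCommGroup W₁] [Module K W₁] [AddCommGroup W₂] [Module K W₂]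
    {β : W₁ →ₗ[K] Z →ₗ[K] U} {γ : X →ₗ[K] Y →ₗ[K] W₁}
    {β' : X →ₗ[K] W₂ →ₗ[K] U} {γ' : Y →ₗ[K] Z →ₗ[K] W₂}
    (h : ∀ a b c, β (γ a b) c = β' a (γ' b c))
    (A : TensorAlgebra K V →ₗ[K] X) (B : TensorAlgebra K V →ₗ[K] Y)
    (C : TensorAlgebra K V →ₗ[K] Z) :
    conv β (conv γ A B) C = conv β' A (conv γ' B C) := by
  ext w
  induction w using induction_left generalizing A with
  | one => simp [conv_one, h]
  | mul x w ih =>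
    -- The cut before `x` contributes the constant `a = A 1`, which passes through the remaining
    -- convolution.
    have h₁ : ∀ a, conv β (γ a ∘ₗ B ∘ₗ lmul x) C w = β' a (conv γ' (B ∘ₗ lmul x) C w) := by
      intro a
      rw [← LinearMap.comp_apply, comp_conv]
      refine LinearMap.congr_fun (conv_congr fun u v => ?_) w
      simp [h]
    rw [conv_mul, conv_mul, conv_comp_lmul, conv_add_left, LinearMap.add_apply, ih, h₁, conv_one, h,
      conv_mul, map_add, add_assoc]
  | add a b ha hb => simp only [map_add] at *; rw [ha, hb]
  | smul c a ha => simp only [map_smul] at *; rw [ha]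

/-- The empty-word coefficient. -/
noncomputable def counit : TensorAlgebra K V →ₗ[K] K :=
  (TensorAlgebra.algebraMapInv (R := K) (M := V)).toLinearMap

@[simp] theorem counit_one : counit (1 : TensorAlgebra K V) = 1 := by simp [counit]

@[simp] theorem counit_mul (x : V) (w : TensorAlgebra K V) : counit (ι K x * w) = 0 := by
  simp [counit, TensorAlgebra.algebraMapInv]

theorem counit_mul' (a b : TensorAlgebra K V) : counit (a * b) = counit a * counit b := by
  simp [counit]

/-- The left recursion step computing the one-letter part of a word. -/
noncomputable def letterAct : V →ₗ[K] Module.End K (K × V) :=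
  LinearMap.mk₂ K (fun x p => (0, p.1 • x))
    (fun x y p => by simp) (fun c x p => by simp [smul_comm p.1 c x])
    (fun x p q => by simp [add_smul]) (fun c x p => by simp [mul_smul])

/-- The one-letter part of a tensor. -/
noncomputable def letter : TensorAlgebra K V →ₗ[K] V :=
  LinearMap.snd K _ _ ∘ₗ leftRec ((1, 0) : K × V) letterAct

@[simp] theorem letter_one : letter (1 : TensorAlgebra K V) = 0 := by
  simp [letter, leftRec_one]

@[simp] theorem letter_mul (x : V) (w : TensorAlgebra K V) :
    letter (ι K x * w) = counit w • x := by
  have h : LinearMap.fst K _ _ ∘ₗ leftRec (1, 0) (letterAct (K := K) (V := V)) = counit := by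
    apply linearMap_ext_left
    · simp [leftRec_one]
    · intro x w h
      simp [leftRec_mul, letterAct]
  have h' := LinearMap.congr_fun h w
  simp only [LinearMap.comp_apply, LinearMap.fst_apply] at h'
  rw [← h']
  simp only [letter, LinearMap.comp_apply, leftRec_mul]
  rfl

@[simp] theorem letter_ι (x : V) : letter (ι K x) = x := by
  simpa using letter_mul (K := K) x 1

theorem letter_comp_lmul (x : V) :
    letter ∘ₗ lmul x = LinearMap.toSpanSingleton K V x ∘ₗ counit := by
  ext w; simp

/-- The concatenation product as a bilinear map. -/
noncomputable abbrev mulT : TensorAlgebra K V →ₗ[K] TensorAlgebra K V →ₗ[K] TensorAlgebra K V :=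
  LinearMap.mul K (TensorAlgebra K V)

theorem counit_conv (B : TensorAlgebra K V →ₗ[K] Y) :
    conv (LinearMap.lsmul K Y) counit B = B := by
  apply linearMap_ext_left
  · simp [conv_one]
  · intro x w h
    have h0 : counit ∘ₗ lmul x = (0 : TensorAlgebra K V →ₗ[K] K) := by ext w; simp
    rw [conv_mul, h0, conv_zero_left]
    simp

/-- Only the cut after the first letter survives, since `letter` vanishes on every other initial
piece. -/
theorem conv_letter_mul (β : X →ₗ[K] Y →ₗ[K] Z) (φ : V →ₗ[K] X)
    (B : TensorAlgebra K V →ₗ[K] Y) (x : V) (w : TensorAlgebra K V) :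
    conv β (φ ∘ₗ letter) B (ι K x * w) = β (φ x) (B w) := by
  rw [conv_mul, LinearMap.comp_assoc, letter_comp_lmul]
  simp only [LinearMap.comp_apply, letter_one, map_zero, LinearMap.zero_apply, add_zero]
  conv_rhs => rw [← counit_conv B, ← LinearMap.comp_apply, comp_conv]
  refine LinearMap.congr_fun (conv_congr fun u v => ?_) w
  simp

/-- A word is empty or a letter followed by a word. Applied to the value of a coalgebra map or
coderivation, this identity reconstructs that value from its one-letter part. -/
theorem id_eq_conv_letter (w : TensorAlgebra K V) :
    w = counit w • 1 + conv mulT (ι K ∘ₗ letter) LinearMap.id w := by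
  have h : LinearMap.id = LinearMap.toSpanSingleton K _ (1 : TensorAlgebra K V) ∘ₗ counit +
      conv mulT (ι K ∘ₗ letter) LinearMap.id := by
    apply linearMap_ext_left
    · simp [conv_one]
    · intro x w _
      simp only [LinearMap.add_apply, conv_letter_mul]
      simp
  simpa using LinearMap.congr_fun h w

/-- The endomorphism of the tensor algebra induced by a linear map. -/
noncomputable def tmap (ρ : V →ₗ[K] V) : TensorAlgebra K V →ₐ[K] TensorAlgebra K V :=
  TensorAlgebra.lift K (ι K ∘ₗ ρ)

@[simp] theorem tmap_ι (ρ : V →ₗ[K] V) (x : V) : tmap ρ (ι K x) = ι K (ρ x) := by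
  simp [tmap]

theorem tmap_id : tmap (LinearMap.id : V →ₗ[K] V) = AlgHom.id K _ := by
  ext x; simp

theorem tmap_comp (ρ ρ' : V →ₗ[K] V) : tmap (ρ ∘ₗ ρ') = (tmap ρ).comp (tmap ρ') := by
  ext x; simp

/-- A counital coalgebra endomorphism of the bar coalgebra preserving the empty word. -/
structure IsCoalgMap (F : TensorAlgebra K V →ₗ[K] TensorAlgebra K V) : Prop where
  map_one : F 1 = 1
  counit_comp : counit ∘ₗ F = counit
  comul_comp : comul ∘ₗ F = TensorProduct.map F F ∘ₗ comul

/-- A coderivation relative to `ρ`. -/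
structure IsCoder (ρ D : TensorAlgebra K V →ₗ[K] TensorAlgebra K V) : Prop where
  map_one : D 1 = 0
  counit_comp : counit ∘ₗ D = 0
  comul_comp : comul ∘ₗ D =
    (TensorProduct.map D LinearMap.id + TensorProduct.map ρ D) ∘ₗ comul

theorem IsCoalgMap.conv_comp {F : TensorAlgebra K V →ₗ[K] TensorAlgebra K V} (hF : IsCoalgMap F)
    (β : X →ₗ[K] Y →ₗ[K] Z) (A : TensorAlgebra K V →ₗ[K] X) (B : TensorAlgebra K V →ₗ[K] Y) :
    conv β A B ∘ₗ F = conv β (A ∘ₗ F) (B ∘ₗ F) := by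
  rw [conv, conv, LinearMap.comp_assoc, hF.comul_comp, ← LinearMap.comp_assoc]
  congr 1
  ext u v
  simp

theorem IsCoder.conv_comp {ρ D : TensorAlgebra K V →ₗ[K] TensorAlgebra K V} (hD : IsCoder ρ D)
    (β : X →ₗ[K] Y →ₗ[K] Z) (A : TensorAlgebra K V →ₗ[K] X) (B : TensorAlgebra K V →ₗ[K] Y) :
    conv β A B ∘ₗ D = conv β (A ∘ₗ D) B + conv β (A ∘ₗ ρ) (B ∘ₗ D) := by
  rw [conv, conv, conv, LinearMap.comp_assoc, hD.comul_comp, ← LinearMap.comp_assoc,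
    ← LinearMap.add_comp]
  congr 1
  ext u v
  simp

theorem comul_eq_conv : (comul : TensorAlgebra K V →ₗ[K] _) =
    conv (TensorProduct.mk K _ _) LinearMap.id LinearMap.id := by
  rw [conv]
  have : TensorProduct.lift ((TensorProduct.mk K (TensorAlgebra K V) (TensorAlgebra K V)).compl₁₂
      LinearMap.id LinearMap.id) = LinearMap.id := by
    ext; simp
  rw [this, LinearMap.id_comp]

theorem map_comp_comul (A : TensorAlgebra K V →ₗ[K] X) (B : TensorAlgebra K V →ₗ[K] Y) :
    TensorProduct.map A B ∘ₗ comul = conv (TensorProduct.mk K X Y) A B := by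
  rw [comul_eq_conv, comp_conv]
  exact conv_congr fun u v => by simp

theorem isCoalgMap_of_conv {F : TensorAlgebra K V →ₗ[K] TensorAlgebra K V} (h1 : F 1 = 1)
    (h2 : counit ∘ₗ F = counit)
    (h3 : comul ∘ₗ F = conv (TensorProduct.mk K _ _) F F) : IsCoalgMap F :=
  ⟨h1, h2, by rw [h3, map_comp_comul]⟩

theorem isCoder_of_conv {ρ D : TensorAlgebra K V →ₗ[K] TensorAlgebra K V} (h1 : D 1 = 0)
    (h2 : counit ∘ₗ D = 0)
    (h3 : comul ∘ₗ D = conv (TensorProduct.mk K _ _) D LinearMap.id +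
      conv (TensorProduct.mk K _ _) ρ D) : IsCoder ρ D :=
  ⟨h1, h2, by rw [h3, LinearMap.add_comp, map_comp_comul, map_comp_comul]⟩

theorem isCoalgMap_id : IsCoalgMap (LinearMap.id : TensorAlgebra K V →ₗ[K] _) :=
  ⟨rfl, by ext; simp, by simp⟩

theorem IsCoalgMap.comp {F G : TensorAlgebra K V →ₗ[K] TensorAlgebra K V} (hF : IsCoalgMap F)
    (hG : IsCoalgMap G) : IsCoalgMap (F ∘ₗ G) :=
  ⟨by simp [hG.map_one, hF.map_one],
    by rw [← LinearMap.comp_assoc, hF.counit_comp, hG.counit_comp],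
    by rw [← LinearMap.comp_assoc, hF.comul_comp, LinearMap.comp_assoc, hG.comul_comp,
      ← LinearMap.comp_assoc, TensorProduct.map_comp]⟩

theorem isCoalgMap_tmap (ρ : V →ₗ[K] V) : IsCoalgMap (tmap ρ).toLinearMap := by
  refine isCoalgMap_of_conv (by simp) ?_ ?_
  · apply linearMap_ext_left
    · simp
    · intro x w _
      simp
  · apply linearMap_ext_left
    · simp [comul_one, conv_one]
    · intro x w h
      simp only [LinearMap.comp_apply, AlgHom.toLinearMap_apply, map_mul, tmap_ι] at h ⊢
      rw [comul_mul, h, conv_mul]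
      simp only [AlgHom.toLinearMap_apply, map_one, map_mul, tmap_ι, TensorProduct.mk_apply]
      congr 1
      rw [← LinearMap.mulLeft_apply (R := K), ← LinearMap.comp_apply, comp_conv]
      refine LinearMap.congr_fun (conv_congr fun u v => ?_) w
      simp

/-- Conjugating a coderivation by a coalgebra automorphism. -/
theorem IsCoder.conj {ρ D F G : TensorAlgebra K V →ₗ[K] TensorAlgebra K V} (hD : IsCoder ρ D)
    (hF : IsCoalgMap F) (hG : IsCoalgMap G) (hFG : F ∘ₗ G = LinearMap.id)
    (hρ : F ∘ₗ ρ = ρ ∘ₗ F) : IsCoder ρ (F ∘ₗ D ∘ₗ G) := by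
  refine isCoder_of_conv ?_ ?_ ?_
  · simp [hG.map_one, hD.map_one]
  · rw [← LinearMap.comp_assoc, hF.counit_comp, ← LinearMap.comp_assoc, hD.counit_comp,
      LinearMap.zero_comp]
  · rw [← LinearMap.comp_assoc, hF.comul_comp, map_comp_comul, ← LinearMap.comp_assoc,
      hD.conv_comp, LinearMap.add_comp, hG.conv_comp, hG.conv_comp, hFG]
    rw [hρ, LinearMap.comp_assoc G F ρ, hFG, LinearMap.comp_id]
    simp only [LinearMap.comp_assoc]

/-- The coderivation relative to `tmap ρ` with given corestriction `g`. -/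
noncomputable def coder (ρ : V →ₗ[K] V) (g : TensorAlgebra K V →ₗ[K] V) :
    TensorAlgebra K V →ₗ[K] TensorAlgebra K V :=
  conv mulT (tmap ρ).toLinearMap (conv mulT (ι K ∘ₗ g) LinearMap.id)

theorem coder_one (ρ : V →ₗ[K] V) {g : TensorAlgebra K V →ₗ[K] V} (hg : g 1 = 0) :
    coder ρ g 1 = 0 := by
  simp [coder, conv_one, hg]

theorem coder_mul (ρ : V →ₗ[K] V) (g : TensorAlgebra K V →ₗ[K] V) (x : V)
    (w : TensorAlgebra K V) :
    coder ρ g (ι K x * w) =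
      ι K (ρ x) * coder ρ g w + conv mulT (ι K ∘ₗ g) LinearMap.id (ι K x * w) := by
  rw [coder, conv_mul]
  congr 1
  · rw [← LinearMap.mulLeft_apply (R := K), ← LinearMap.comp_apply, comp_conv]
    refine LinearMap.congr_fun (conv_congr fun u v => ?_) w
    simp [mul_assoc]
  · simp

/-- A word that begins with the letter `g u` is cut either after that letter or in front of it. -/
theorem comul_comp_conv_ι (g : TensorAlgebra K V →ₗ[K] V)
    (B : TensorAlgebra K V →ₗ[K] TensorAlgebra K V) :
    comul ∘ₗ conv mulT (ι K ∘ₗ g) B =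
      conv (LinearMap.mul K (TensorAlgebra K V ⊗[K] TensorAlgebra K V))
        ((TensorProduct.mk K _ _).flip 1 ∘ₗ ι K ∘ₗ g) (comul ∘ₗ B) +
      TensorProduct.mk K _ _ 1 ∘ₗ conv mulT (ι K ∘ₗ g) B := by
  rw [comp_conv, comp_conv, conv, conv, conv, ← LinearMap.add_comp]
  congr 1
  ext u v
  simp [comul_mul]

/-- Induction on the first letter. The inserted letter either lies behind `x` or absorbs an initial
segment containing `x`; in the second case coassociativity moves the cut past the insertion. -/
theorem isCoder_coder (ρ : V →ₗ[K] V) {g : TensorAlgebra K V →ₗ[K] V} (hg : g 1 = 0) :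
    IsCoder (tmap ρ).toLinearMap (coder ρ g) := by
  refine isCoder_of_conv (coder_one ρ hg) ?_ ?_
  · rw [coder, comp_conv]
    rw [show (0 : TensorAlgebra K V →ₗ[K] K) = conv (mulT.compr₂ counit) (tmap ρ).toLinearMap
      (0 : TensorAlgebra K V →ₗ[K] TensorAlgebra K V) by rw [conv_zero_right]]
    refine conv_congr fun u v => ?_
    have : counit (conv mulT (ι K ∘ₗ g) LinearMap.id v) = 0 := by
      rw [← LinearMap.comp_apply, comp_conv]
      rw [show conv (mulT.compr₂ counit) (ι K ∘ₗ g) LinearMap.id =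
        conv (mulT.compr₂ counit) (0 : TensorAlgebra K V →ₗ[K] TensorAlgebra K V)
          LinearMap.id from conv_congr fun u v => by simp]
      rw [conv_zero_left]; rfl
    simp [counit_mul', this]
  · apply linearMap_ext_left
    · simp [conv_one, coder_one ρ hg]
    · intro x w h
      have hassoc := LinearMap.congr_fun (conv_assoc (K := K) (V := V)
        (β := TensorProduct.mk K (TensorAlgebra K V) (TensorAlgebra K V))
        (γ := mulT) (β' := LinearMap.mul K (TensorAlgebra K V ⊗[K] TensorAlgebra K V) ∘ₗ
          (TensorProduct.mk K _ _).flip 1) (γ' := TensorProduct.mk K _ _)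
        (fun a b c => by simp) (ι K ∘ₗ g) LinearMap.id LinearMap.id) (ι K x * w)
      have hg' : conv mulT (ι K ∘ₗ g) LinearMap.id 1 = 0 := by simp [conv_one, hg]
      have h1 : conv (LinearMap.mul K (TensorAlgebra K V ⊗[K] TensorAlgebra K V))
          ((TensorProduct.mk K _ _).flip 1 ∘ₗ ι K ∘ₗ g) (comul ∘ₗ LinearMap.id) (ι K x * w) =
          conv (TensorProduct.mk K _ _) (conv mulT (ι K ∘ₗ g) LinearMap.id ∘ₗ lmul x)
            LinearMap.id w := by
        rw [conv_mul, hg', map_zero, LinearMap.zero_apply, add_zero, ← comul_eq_conv] at hassoc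
        rw [hassoc, LinearMap.comp_id]
        exact LinearMap.congr_fun (conv_congr fun u v => by simp) _
      simp only [LinearMap.comp_apply, LinearMap.add_apply] at h ⊢
      rw [coder_mul, map_add, ← LinearMap.comp_apply comul, comul_comp_conv_ι,
        LinearMap.add_apply, h1, comul_mul, h, conv_mul, conv_mul, coder_one ρ hg]
      have h2 : coder ρ g ∘ₗ lmul x = LinearMap.mulLeft K (ι K (ρ x)) ∘ₗ coder ρ g +
          conv mulT (ι K ∘ₗ g) LinearMap.id ∘ₗ lmul x := by
        ext w; simp [coder_mul]
      have h3 : ∀ A B : TensorAlgebra K V →ₗ[K] TensorAlgebra K V,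
          (ι K (ρ x) ⊗ₜ[K] (1 : TensorAlgebra K V)) * conv (TensorProduct.mk K _ _) A B w =
          conv (TensorProduct.mk K _ _) (LinearMap.mulLeft K (ι K (ρ x)) ∘ₗ A) B w := by
        intro A B
        rw [← LinearMap.mulLeft_apply (R := K), ← LinearMap.comp_apply, comp_conv]
        refine LinearMap.congr_fun (conv_congr fun u v => ?_) w
        simp
      have h4 : (tmap ρ).toLinearMap ∘ₗ lmul x =
          LinearMap.mulLeft K (ι K (ρ x)) ∘ₗ (tmap ρ).toLinearMap := by
        ext w; simp
      rw [h2, h4, conv_add_left, mul_add, h3, h3, coder_mul]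
      simp [TensorProduct.tmul_add]
      abel

/-- Cofreeness: `D` and `coder` satisfy the same left recursion, obtained by splitting the first
letter off `D w` and using the coderivation rule. -/
theorem IsCoder.eq_coder {ρ : V →ₗ[K] V} {D : TensorAlgebra K V →ₗ[K] TensorAlgebra K V}
    (hD : IsCoder (tmap ρ).toLinearMap D) : D = coder ρ (letter ∘ₗ D) := by
  have hg : (letter ∘ₗ D) 1 = 0 := by simp [hD.map_one]
  have key : ∀ w, D w = conv mulT (ι K ∘ₗ letter ∘ₗ D) LinearMap.id w +
      conv mulT (ι K ∘ₗ ρ ∘ₗ letter) D w := by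
    intro w
    have h1 := id_eq_conv_letter (D w)
    rw [show counit (D w) = 0 from LinearMap.congr_fun hD.counit_comp w, zero_smul, zero_add,
      ← LinearMap.comp_apply, hD.conv_comp] at h1
    rw [h1, LinearMap.add_apply, LinearMap.comp_assoc, LinearMap.id_comp]
    congr 2
    congr 1
    apply linearMap_ext_left
    · simp
    · intro x w _
      have := LinearMap.congr_fun (isCoalgMap_tmap ρ).counit_comp w
      simp at this
      simp [this]
  apply linearMap_ext_left
  · rw [hD.map_one, coder_one _ hg]
  · intro x w h
    rw [coder_mul, key, ← LinearMap.comp_assoc (g := ρ), conv_letter_mul, ← h, add_comm]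
    rfl

theorem IsCoalgMap.apply_mul {F : TensorAlgebra K V →ₗ[K] TensorAlgebra K V} (hF : IsCoalgMap F)
    (x : V) (w : TensorAlgebra K V) :
    F (ι K x * w) = conv mulT (ι K ∘ₗ letter ∘ₗ F) F (ι K x * w) := by
  have h1 := id_eq_conv_letter (F (ι K x * w))
  rw [show counit (F (ι K x * w)) = counit (ι K x * w) from
    LinearMap.congr_fun hF.counit_comp _, counit_mul, zero_smul, zero_add,
    ← LinearMap.comp_apply, hF.conv_comp] at h1
  exact h1

theorem letter_conv_ι (g : TensorAlgebra K V →ₗ[K] V)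
    (B : TensorAlgebra K V →ₗ[K] TensorAlgebra K V) :
    letter ∘ₗ conv mulT (ι K ∘ₗ g) B = conv (LinearMap.lsmul K V).flip g (counit ∘ₗ B) := by
  rw [comp_conv]
  exact conv_congr fun u v => by simp

end Deconcatenation

/-! ### Explicit formulas on words: cuts, insertions and compositions. -/

section Words

open TensorAlgebra TensorProduct

variable {K : Type u} [Field K] {V : Type v} [AddCommGroup V] [Module K V]

/-- The word `o_0 ⋯ o_{n-1}`. -/
noncomputable def word (K : Type u) [Field K] {V : Type v} [AddCommGroup V] [Module K V]
    (n : ℕ) (o : ℕ → V) : TensorAlgebra K V :=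
  tprod K V n fun i => o i

@[simp] theorem word_zero (o : ℕ → V) : word K 0 o = 1 := by
  simp [word]

theorem word_succ (n : ℕ) (o : ℕ → V) :
    word K (n + 1) o = ι K (o 0) * word K n (fun i => o (i + 1)) := by
  simp [word, tprod_apply, List.ofFn_succ]

theorem word_congr {n : ℕ} {o o' : ℕ → V} (h : ∀ i < n, o i = o' i) :
    word K n o = word K n o' := by
  unfold word
  congr 1
  ext i
  exact h i i.2

theorem word_one (o : ℕ → V) : word K 1 o = ι K (o 0) := by
  simp [word_succ]

theorem exists_word_of_tprod (n : ℕ) (x : Fin n → V) : ∃ o, tprod K V n x = word K n o := by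
  refine ⟨fun i => if h : i < n then x ⟨i, h⟩ else 0, ?_⟩
  unfold word
  congr 1
  ext i
  simp

theorem tmap_word (ρ : V →ₗ[K] V) (n : ℕ) (o : ℕ → V) :
    tmap ρ (word K n o) = word K n (fun i => ρ (o i)) := by
  induction n generalizing o with
  | zero => simp
  | succ n ih => rw [word_succ, map_mul, ih, tmap_ι, word_succ]

/-- Words with letters in a spanning set span the tensor algebra. -/
theorem span_words {s : Set V} (h0 : (0 : V) ∈ s) (hs : Submodule.span K s = ⊤) :
    Submodule.span K {w | ∃ n, ∃ o : ℕ → V, (∀ i, o i ∈ s) ∧ w = word K n o} = ⊤ := by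
  rw [eq_top_iff]
  rintro w -
  set p := Submodule.span K {w | ∃ n, ∃ o : ℕ → V, (∀ i, o i ∈ s) ∧ w = word K n o} with hp
  induction w using induction_left with
  -- Words are read off infinite sequences, so even the empty word needs a letter in `s`; this is
  -- the role of `0 ∈ s`.
  | one => exact Submodule.subset_span ⟨0, fun _ => 0, fun _ => h0, by simp⟩
  | mul x w ih =>
    have hx : x ∈ Submodule.span K s := by rw [hs]; trivial
    induction hx using Submodule.span_induction with
    | mem x hx =>
      have : p ≤ p.comap (lmul x) := by
        conv_lhs => rw [hp]
        rw [Submodule.span_le]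
        rintro _ ⟨n, o, ho, rfl⟩
        refine Submodule.subset_span ⟨n + 1, fun i => Nat.casesOn i x o, ?_, ?_⟩
        · rintro (_ | i)
          · exact hx
          · exact ho i
        · rw [word_succ]; rfl
      exact this ih
    | zero => simp
    | add a b _ _ ha hb => rw [map_add, add_mul]; exact p.add_mem ha hb
    | smul c a _ ha => rw [map_smul, smul_mul_assoc]; exact p.smul_mem c ha
  | add a b ha hb => exact p.add_mem ha hb
  | smul c a ha => exact p.smul_mem c ha

theorem ext_words_of_span {M : Type*} [AddCommGroup M] [Module K M]
    {A B : TensorAlgebra K V →ₗ[K] M} {s : Set V} (h0 : (0 : V) ∈ s)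
    (hs : Submodule.span K s = ⊤)
    (h : ∀ n (o : ℕ → V), (∀ i, o i ∈ s) → A (word K n o) = B (word K n o)) : A = B := by
  apply LinearMap.ext_on (span_words h0 hs)
  rintro _ ⟨n, o, ho, rfl⟩
  exact h n o ho

theorem ext_words {M : Type*} [AddCommGroup M] [Module K M]
    {A B : TensorAlgebra K V →ₗ[K] M}
    (h : ∀ n (o : ℕ → V), A (word K n o) = B (word K n o)) : A = B :=
  ext_words_of_span (Set.mem_univ 0) Submodule.span_univ fun n o _ => h n o

/-- The linear map on the tensor algebra assembled from multilinear maps in all arities. -/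
noncomputable def ofFamily {W : Type*} [AddCommGroup W] [Module K W]
    (g : ∀ n : ℕ, MultilinearMap K (fun _ : Fin n => V) W) : TensorAlgebra K V →ₗ[K] W :=
  DirectSum.toModule K ℕ W (fun n => PiTensorProduct.lift (g n)) ∘ₗ
    (TensorAlgebra.toDirectSum (R := K) (M := V)).toLinearMap

theorem ofFamily_tprod {W : Type*} [AddCommGroup W] [Module K W]
    (g : ∀ n : ℕ, MultilinearMap K (fun _ : Fin n => V) W) (n : ℕ) (x : Fin n → V) :
    ofFamily g (tprod K V n x) = g n x := by
  simp only [ofFamily, LinearMap.comp_apply, AlgHom.toLinearMap_apply,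
    toDirectSum_tensorPower_tprod]
  rw [← DirectSum.lof_eq_of K, DirectSum.toModule_lof, PiTensorProduct.lift.tprod]

theorem ofFamily_word {W : Type*} [AddCommGroup W] [Module K W]
    (g : ∀ n : ℕ, MultilinearMap K (fun _ : Fin n => V) W) (n : ℕ) (o : ℕ → V) :
    ofFamily g (word K n o) = g n (fun i => o i) :=
  ofFamily_tprod g n _

/-- The projection to words of length `n`. -/
noncomputable def proj (n : ℕ) : TensorAlgebra K V →ₗ[K] TensorAlgebra K V :=
  ofFamily fun k => if k = n then tprod K V k else 0

theorem proj_word (n k : ℕ) (o : ℕ → V) :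
    proj n (word K k o) = if k = n then word K k o else 0 := by
  rw [proj, ofFamily_word]
  split_ifs <;> rfl

theorem proj_word_self (n : ℕ) (o : ℕ → V) : proj n (word K n o) = word K n o := by
  simp [proj_word]

variable {X Y Z : Type*} [AddCommGroup X] [Module K X] [AddCommGroup Y] [Module K Y]
  [AddCommGroup Z] [Module K Z]

theorem conv_word (β : X →ₗ[K] Y →ₗ[K] Z) (A : TensorAlgebra K V →ₗ[K] X)
    (B : TensorAlgebra K V →ₗ[K] Y) (n : ℕ) (o : ℕ → V) :
    conv β A B (word K n o) = ∑ k ∈ Finset.range (n + 1),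
      β (A (word K k o)) (B (word K (n - k) fun i => o (k + i))) := by
  induction n generalizing A o with
  | zero => simp [conv_one]
  | succ n ih =>
    rw [word_succ n o, conv_mul, ih, Finset.sum_range_succ' _ (n + 1), ← word_succ n o]
    congr 1
    · refine Finset.sum_congr rfl fun k _ => ?_
      rw [LinearMap.comp_apply, lmul_apply, word_succ k o, Nat.add_sub_add_right,
        word_congr (o := fun i => o (k + i + 1)) (o' := fun i => o (k + 1 + i))
          fun i _ => by congr 1; omega]
    · simp

/-- The inserted block has `l + 1` letters, because `g 1 = 0` excludes the empty block. The letters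
in front of it are hit by `ρ`, the source of the Koszul sign. -/
theorem coder_word (ρ : V →ₗ[K] V) {g : TensorAlgebra K V →ₗ[K] V} (hg : g 1 = 0) (n : ℕ)
    (o : ℕ → V) :
    coder ρ g (word K n o) = ∑ l ∈ Finset.range n, ∑ j ∈ Finset.range (n - l),
      word K (n - l) (fun i => if i < j then ρ (o i)
        else if i = j then g (word K (l + 1) fun t => o (j + t)) else o (i + l)) := by
  induction n generalizing o with
  | zero => simp [coder_one ρ hg]
  | succ n ih =>
    rw [word_succ, coder_mul, ih, ← word_succ, conv_word, Finset.sum_range_succ']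
    have e : ∀ l ∈ Finset.range (n + 1), ∑ j ∈ Finset.range (n + 1 - l),
      word K (n + 1 - l) (fun i => if i < j then ρ (o i)
        else if i = j then g (word K (l + 1) fun t => o (j + t)) else o (i + l)) =
      (∑ j ∈ Finset.range (n - l), ι K (ρ (o 0)) *
        word K (n - l) (fun i => if i < j then ρ (o (i + 1))
        else if i = j then g (word K (l + 1) fun t => o (j + t + 1)) else o (i + l + 1))) +
      ι K (g (word K (l + 1) o)) * word K (n - l) (fun i => o (l + 1 + i)) := by
      intro l hl
      have hl' : n + 1 - l = n - l + 1 := by have := Finset.mem_range.1 hl; omega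
      rw [hl', Finset.sum_range_succ']
      congr 1
      · refine Finset.sum_congr rfl fun j _ => ?_
        rw [word_succ]
        congr 1
        apply word_congr
        intro i _
        simp only [Nat.succ_lt_succ_iff, Nat.add_right_cancel_iff]
        rw [word_congr (o := fun t => o (j + 1 + t)) (o' := fun t => o (j + t + 1))
          fun i _ => by congr 1; omega, show i + 1 + l = i + l + 1 by omega]
      · rw [word_succ]
        congr 1
        · simp
        · apply word_congr
          intro i _
          simp only [Nat.not_lt_zero, if_false, Nat.succ_ne_zero]
          congr 1; omega
    rw [Finset.sum_congr rfl e, Finset.sum_add_distrib]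
    congr 1
    · rw [Finset.sum_range_succ]
      simp [Finset.mul_sum]
    · simp [hg]

/-- The product of the images of consecutive blocks of prescribed lengths. -/
noncomputable def blockProd (f : TensorAlgebra K V →ₗ[K] V) :
    List ℕ → (ℕ → V) → TensorAlgebra K V
  | [], _ => 1
  | b :: l, o => ι K (f (word K b o)) * blockProd f l (fun i => o (b + i))

theorem tprod_eq_blockProd (f : TensorAlgebra K V →ₗ[K] V) (l : List ℕ) (o : ℕ → V) :
    tprod K V l.length (fun i => f (word K (l.get i) fun t => o ((l.take i).sum + t))) =
      blockProd f l o := by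
  induction l generalizing o with
  | nil => simp [blockProd]
  | cons b l ih =>
    rw [blockProd, ← ih]
    rw [tprod_apply, tprod_apply]
    simp only [List.length_cons]
    rw [List.ofFn_succ, List.prod_cons]
    simp [add_assoc]

/-- Splits off the first block, of size `k + 1`; this matches the recursion of a coalgebra map on
the first cut. -/
theorem sum_composition_succ {M : Type*} [AddCommMonoid M] (n : ℕ) (φ : List ℕ → M) :
    ∑ c : Composition (n + 1), φ c.blocks =
      ∑ k ∈ Finset.range (n + 1), ∑ c : Composition (n - k), φ ((k + 1) :: c.blocks) := by
  rw [Finset.sum_sigma']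
  symm
  refine Finset.sum_bij (fun p hp => ⟨(p.1 + 1) :: p.2.blocks, ?_, ?_⟩) ?_ ?_ ?_ ?_
  · intro i hi
    rcases List.mem_cons.1 hi with rfl | hi
    · omega
    · exact p.2.blocks_pos hi
  · have := Finset.mem_range.1 (Finset.mem_sigma.1 hp).1
    rw [List.sum_cons, p.2.blocks_sum]
    omega
  · intros; simp
  · rintro ⟨k, c⟩ _ ⟨k', c'⟩ _ h
    have h' := congrArg Composition.blocks h
    simp only [List.cons.injEq, Nat.add_right_cancel_iff] at h'
    obtain ⟨rfl, h'⟩ := h'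
    have : c = c' := Composition.ext h'
    rw [this]
  · rintro ⟨b, hb, hs⟩ _
    cases b with
    | nil => simp at hs
    | cons a b =>
      have ha : 0 < a := hb (by simp)
      rw [List.sum_cons] at hs
      refine ⟨⟨a - 1, ⟨b, fun hi => hb (List.mem_cons_of_mem _ hi), by omega⟩⟩, ?_, ?_⟩
      · simp; omega
      · ext1
        simp; omega
  · intros; rfl

/-- A coalgebra map sends a word to the image of its first nonempty block followed by the image of
the rest; iterating this runs through all compositions. -/
theorem IsCoalgMap.word_eq_sum {F : TensorAlgebra K V →ₗ[K] TensorAlgebra K V}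
    (hF : IsCoalgMap F) (n : ℕ) (o : ℕ → V) :
    F (word K n o) = ∑ c : Composition n, blockProd (letter ∘ₗ F) c.blocks o := by
  induction n using Nat.strong_induction_on generalizing o with
  | _ n ih =>
    cases n with
    | zero =>
      rw [word_zero, hF.map_one, Fintype.sum_eq_single (Composition.ones 0)]
      · simp [blockProd]
      · intro c hc
        refine absurd (Composition.ext ?_) hc
        rw [c.blocks_eq_nil.2 rfl, (Composition.ones 0).blocks_eq_nil.2 rfl]
    | succ n =>
      rw [sum_composition_succ n fun l => blockProd (letter ∘ₗ F) l o, word_succ, hF.apply_mul,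
        ← word_succ, conv_word, Finset.sum_range_succ']
      simp only [LinearMap.comp_apply, word_zero, hF.map_one, letter_one, map_zero,
        LinearMap.zero_apply, add_zero, LinearMap.mul_apply']
      refine Finset.sum_congr rfl fun k hk => ?_
      rw [Nat.add_sub_add_right, ih (n - k) (by omega), Finset.mul_sum]
      rfl

/-- For a coalgebra map `F` with corestriction `f`, the sum over compositions. -/
theorem IsCoalgMap.word_eq_sum_tprod {F : TensorAlgebra K V →ₗ[K] TensorAlgebra K V}
    (hF : IsCoalgMap F) (n : ℕ) (o : ℕ → V) :
    F (word K n o) = ∑ c : Composition n, tprod K V c.length (fun i =>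
      letter (F (tprod K V (c.blocksFun i) fun t => o (c.embedding i t : ℕ)))) := by
  rw [hF.word_eq_sum]
  refine Finset.sum_congr rfl fun c _ => ?_
  rw [← tprod_eq_blockProd]
  rfl

end Words

/-! ### The filtration by word length. -/

section Length

open TensorAlgebra TensorProduct

variable {K : Type u} [Field K] {V : Type v} [AddCommGroup V] [Module K V]

/-- The span of the words of length at most `n`. -/
def wordsLE (K : Type u) [Field K] (V : Type v) [AddCommGroup V] [Module K V] (n : ℕ) :
    Submodule K (TensorAlgebra K V) :=
  Submodule.span K {w | ∃ k ≤ n, ∃ o : ℕ → V, w = word K k o}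

theorem word_mem_wordsLE {k n : ℕ} (h : k ≤ n) (o : ℕ → V) : word K k o ∈ wordsLE K V n :=
  Submodule.subset_span ⟨k, h, o, rfl⟩

theorem wordsLE_mono {k n : ℕ} (h : k ≤ n) : wordsLE K V k ≤ wordsLE K V n := by
  refine Submodule.span_mono ?_
  rintro _ ⟨j, hj, o, rfl⟩
  exact ⟨j, hj.trans h, o, rfl⟩

theorem tprod_mem_wordsLE {k n : ℕ} (h : k ≤ n) (x : Fin k → V) :
    tprod K V k x ∈ wordsLE K V n := by
  obtain ⟨o, ho⟩ := exists_word_of_tprod (K := K) k x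
  rw [ho]
  exact word_mem_wordsLE h o

theorem one_mem_wordsLE (n : ℕ) : (1 : TensorAlgebra K V) ∈ wordsLE K V n := by
  simpa using word_mem_wordsLE (K := K) (Nat.zero_le n) (fun _ => (0 : V))

theorem ι_mem_wordsLE {n : ℕ} (hn : 1 ≤ n) (x : V) : ι K x ∈ wordsLE K V n := by
  simpa [word_one] using word_mem_wordsLE (K := K) hn (fun _ => x)

theorem exists_mem_wordsLE (w : TensorAlgebra K V) : ∃ n, w ∈ wordsLE K V n := by
  have hw : w ∈ Submodule.span K {w | ∃ n, ∃ o : ℕ → V, (∀ i, o i ∈ Set.univ) ∧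
      w = word K n o} := by
    rw [span_words (Set.mem_univ 0) Submodule.span_univ]; trivial
  induction hw using Submodule.span_induction with
  | mem w h => obtain ⟨n, o, _, rfl⟩ := h; exact ⟨n, word_mem_wordsLE le_rfl o⟩
  | zero => exact ⟨0, Submodule.zero_mem _⟩
  | add a b _ _ ha hb =>
    obtain ⟨n, hn⟩ := ha
    obtain ⟨k, hk⟩ := hb
    exact ⟨max n k, Submodule.add_mem _ (wordsLE_mono (le_max_left _ _) hn)
      (wordsLE_mono (le_max_right _ _) hk)⟩
  | smul c a _ ha =>
    obtain ⟨n, hn⟩ := ha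
    exact ⟨n, Submodule.smul_mem _ c hn⟩

theorem eqOn_wordsLE {M : Type*} [AddCommGroup M] [Module K M]
    {A B : TensorAlgebra K V →ₗ[K] M} {n : ℕ}
    (h : ∀ k ≤ n, ∀ o : ℕ → V, A (word K k o) = B (word K k o)) :
    ∀ w ∈ wordsLE K V n, A w = B w := by
  intro w hw
  refine LinearMap.eqOn_span (s := {w | ∃ k ≤ n, ∃ o : ℕ → V, w = word K k o}) ?_ hw
  rintro _ ⟨k, hk, o, rfl⟩
  exact h k hk o

theorem map_mem_of_words {M : Type*} [AddCommGroup M] [Module K M]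
    {A : TensorAlgebra K V →ₗ[K] M} {n : ℕ} {p : Submodule K M}
    (h : ∀ k ≤ n, ∀ o : ℕ → V, A (word K k o) ∈ p) :
    ∀ w ∈ wordsLE K V n, A w ∈ p := by
  have : wordsLE K V n ≤ p.comap A := by
    refine Submodule.span_le.2 ?_
    rintro _ ⟨k, hk, o, rfl⟩
    exact h k hk o
  exact this

theorem ext_wordsLE {M : Type*} [AddCommGroup M] [Module K M]
    {A B : TensorAlgebra K V →ₗ[K] M} (h : ∀ n, ∀ w ∈ wordsLE K V n, A w = B w) : A = B := by
  ext w
  obtain ⟨n, hn⟩ := exists_mem_wordsLE w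
  exact h n w hn

theorem IsCoalgMap.mem_wordsLE {F : TensorAlgebra K V →ₗ[K] TensorAlgebra K V}
    (hF : IsCoalgMap F) {n : ℕ} : ∀ w ∈ wordsLE K V n, F w ∈ wordsLE K V n := by
  refine map_mem_of_words fun k hk o => ?_
  rw [hF.word_eq_sum_tprod]
  exact Submodule.sum_mem _ fun c _ => tprod_mem_wordsLE (c.length_le.trans hk) _

theorem coder_mem_wordsLE (ρ : V →ₗ[K] V) {g : TensorAlgebra K V →ₗ[K] V} (hg : g 1 = 0)
    {n : ℕ} : ∀ w ∈ wordsLE K V n, coder ρ g w ∈ wordsLE K V n := by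
  refine map_mem_of_words fun k hk o => ?_
  rw [coder_word ρ hg]
  exact Submodule.sum_mem _ fun l _ => Submodule.sum_mem _ fun j _ =>
    word_mem_wordsLE (by omega) _

/-- A coderivation without arity-one part shortens words. -/
theorem coder_mem_wordsLE_pred (ρ : V →ₗ[K] V) {g : TensorAlgebra K V →ₗ[K] V}
    (hg : ∀ w ∈ wordsLE K V 1, g w = 0) {n : ℕ} :
    ∀ w ∈ wordsLE K V (n + 1), coder ρ g w ∈ wordsLE K V n := by
  refine map_mem_of_words fun k hk o => ?_
  rw [coder_word ρ (hg 1 (one_mem_wordsLE 1))]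
  refine Submodule.sum_mem _ fun l _ => Submodule.sum_mem _ fun j hj => ?_
  have hj := Finset.mem_range.1 hj
  rcases Nat.eq_zero_or_pos l with rfl | hl
  -- An insertion of a single letter keeps the length, but `g` kills single letters, so the
  -- resulting word contains a zero.
  · have : word K (k - 0) (fun i => if i < j then ρ (o i) else if i = j then
        g (word K (0 + 1) fun t => o (j + t)) else o (i + 0)) = 0 := by
      rw [word, ← MultilinearMap.map_coord_zero (tprod K V (k - 0)) ⟨j, hj⟩]
      simp [hg _ (word_mem_wordsLE le_rfl _)]
    rw [this]
    exact Submodule.zero_mem _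
  · exact word_mem_wordsLE (by omega) _

/-- A coderivation whose corestriction vanishes in arities at most `n` is given by its
corestriction in arity `n + 1`. -/
theorem coder_eq_ι_of_vanish (ρ : V →ₗ[K] V) {g : TensorAlgebra K V →ₗ[K] V} {n : ℕ}
    (hg : ∀ w ∈ wordsLE K V n, g w = 0) :
    ∀ w ∈ wordsLE K V (n + 1), coder ρ g w = ι K (g w) := by
  refine eqOn_wordsLE (B := ι K ∘ₗ g) fun k hk o => ?_
  rw [coder_word ρ (hg 1 (one_mem_wordsLE n)), LinearMap.comp_apply]
  have hz : ∀ l < k, l < n → ∀ j ∈ Finset.range (k - l),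
      word K (k - l) (fun i => if i < j then ρ (o i) else if i = j then
        g (word K (l + 1) fun t => o (j + t)) else o (i + l)) = 0 := by
    intro l _ hl j hj
    rw [word, ← MultilinearMap.map_coord_zero (tprod K V (k - l)) ⟨j, Finset.mem_range.1 hj⟩]
    simp [hg _ (word_mem_wordsLE (show l + 1 ≤ n by omega) _)]
  rcases Nat.lt_or_ge n k with h | h
  · obtain rfl : k = n + 1 := by omega
    rw [Finset.sum_range_succ, Finset.sum_eq_zero]
    · simp [word_one]
    · intro l hl
      have := Finset.mem_range.1 hl
      exact Finset.sum_eq_zero (hz l (by omega) (by omega))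
  · rw [hg _ (word_mem_wordsLE h o), map_zero]
    refine Finset.sum_eq_zero fun l hl => ?_
    have := Finset.mem_range.1 hl
    exact Finset.sum_eq_zero (hz l this (by omega))

theorem coder_eq_zero_of_vanish (ρ : V →ₗ[K] V) {g : TensorAlgebra K V →ₗ[K] V} {n : ℕ}
    (hg : ∀ w ∈ wordsLE K V n, g w = 0) : ∀ w ∈ wordsLE K V n, coder ρ g w = 0 := by
  intro w hw
  rw [coder_eq_ι_of_vanish ρ hg w (wordsLE_mono (Nat.le_succ n) hw), hg w hw, map_zero]

variable {X Y Z : Type*} [AddCommGroup X] [Module K X] [AddCommGroup Y] [Module K Y]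
  [AddCommGroup Z] [Module K Z]

theorem conv_eqOn (β : X →ₗ[K] Y →ₗ[K] Z) {A A' : TensorAlgebra K V →ₗ[K] X}
    {B B' : TensorAlgebra K V →ₗ[K] Y} {n : ℕ} (hA : ∀ w ∈ wordsLE K V n, A w = A' w)
    (hB : ∀ w ∈ wordsLE K V n, B w = B' w) :
    ∀ w ∈ wordsLE K V n, conv β A B w = conv β A' B' w := by
  refine eqOn_wordsLE fun k hk o => ?_
  rw [conv_word, conv_word]
  refine Finset.sum_congr rfl fun j hj => ?_
  have := Finset.mem_range.1 hj
  rw [hA _ (word_mem_wordsLE (by omega) _), hB _ (word_mem_wordsLE (by omega) _)]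

end Length

/-! ### Exponentials of length-decreasing coderivations. -/

section Exponential

open TensorAlgebra TensorProduct

variable {K : Type u} [Field K] {V : Type v} [AddCommGroup V] [Module K V]

/-- `D` strictly shortens words. -/
def Shortens (D : Module.End K (TensorAlgebra K V)) : Prop :=
  (∀ w ∈ wordsLE K V 0, D w = 0) ∧ ∀ n, ∀ w ∈ wordsLE K V (n + 1), D w ∈ wordsLE K V n

theorem Shortens.neg {D : Module.End K (TensorAlgebra K V)} (hD : Shortens D) : Shortens (-D) :=
  ⟨fun w hw => by simp [hD.1 w hw], fun n w hw => by
    simpa using hD.2 n w hw⟩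

theorem Shortens.pow_eq_zero {D : Module.End K (TensorAlgebra K V)} (hD : Shortens D) {n i : ℕ}
    (hi : n < i) {w : TensorAlgebra K V} (hw : w ∈ wordsLE K V n) : (D ^ i) w = 0 := by
  induction n generalizing i w with
  | zero =>
    obtain ⟨i, rfl⟩ : ∃ j, i = j + 1 := ⟨i - 1, by omega⟩
    rw [pow_succ, Module.End.mul_apply, hD.1 w hw, map_zero]
  | succ n ih =>
    obtain ⟨i, rfl⟩ : ∃ j, i = j + 1 := ⟨i - 1, by omega⟩
    rw [pow_succ, Module.End.mul_apply]
    exact ih (by omega) (hD.2 n w hw)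

theorem shortens_coder (ρ : V →ₗ[K] V) {g : TensorAlgebra K V →ₗ[K] V}
    (hg : ∀ w ∈ wordsLE K V 1, g w = 0) : Shortens (coder ρ g) :=
  ⟨fun w hw => coder_eq_zero_of_vanish ρ
      (fun w hw => hg w (wordsLE_mono (Nat.zero_le 1) hw)) w hw,
    fun _ w hw => coder_mem_wordsLE_pred ρ hg w hw⟩

/-- The partial sums of the exponential series. -/
noncomputable def expSum (D : Module.End K (TensorAlgebra K V)) (n : ℕ) :
    Module.End K (TensorAlgebra K V) :=
  ∑ i ∈ Finset.range n, (i.factorial : K)⁻¹ • D ^ i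

/-- The exponential of a word-shortening endomorphism. -/
noncomputable def locExp (D : Module.End K (TensorAlgebra K V)) :
    Module.End K (TensorAlgebra K V) :=
  ofFamily fun n => (expSum D (n + 1)).compMultilinearMap (tprod K V n)

theorem expSum_apply_of_le {D : Module.End K (TensorAlgebra K V)} (hD : Shortens D) {n k l : ℕ}
    (hk : n < k) (hkl : k ≤ l) {w : TensorAlgebra K V} (hw : w ∈ wordsLE K V n) :
    expSum D l w = expSum D k w := by
  simp only [expSum, LinearMap.sum_apply, LinearMap.smul_apply]
  symm
  refine Finset.sum_subset (Finset.range_subset_range.2 hkl) fun i _ hi => ?_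
  rw [hD.pow_eq_zero (by simp at hi; omega) hw, smul_zero]

theorem locExp_apply {D : Module.End K (TensorAlgebra K V)} (hD : Shortens D) {n k : ℕ}
    (hk : n < k) : ∀ w ∈ wordsLE K V n, locExp D w = expSum D k w := by
  refine eqOn_wordsLE fun j hj o => ?_
  rw [locExp, ofFamily_word]
  exact (expSum_apply_of_le hD (Nat.lt_succ_self j) (by omega)
    (word_mem_wordsLE le_rfl o)).symm

theorem locExp_one (D : Module.End K (TensorAlgebra K V)) : locExp D 1 = 1 := by
  rw [← word_zero (K := K) (fun _ => (0 : V)), locExp, ofFamily_word]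
  simp [expSum]

/-- Only the constant term of the series survives. This yields invariance of the counit and, for
Hamiltonian vector fields, of the pairing. -/
theorem comp_locExp {M : Type*} [AddCommGroup M] [Module K M]
    {D : Module.End K (TensorAlgebra K V)} (hD : Shortens D) {φ : TensorAlgebra K V →ₗ[K] M}
    (h : φ ∘ₗ D = 0) : φ ∘ₗ locExp D = φ := by
  refine ext_wordsLE fun n w hw => ?_
  rw [LinearMap.comp_apply, locExp_apply hD (Nat.lt_succ_self n) w hw, expSum,
    Finset.sum_range_succ']
  have : ∀ i, φ ((D ^ (i + 1)) w) = 0 := fun i => by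
    rw [pow_succ', Module.End.mul_apply]
    exact LinearMap.congr_fun h _
  simp [this]

theorem locExp_comm {D Θ : Module.End K (TensorAlgebra K V)} (hD : Shortens D)
    (hΘ : ∀ n, ∀ w ∈ wordsLE K V n, Θ w ∈ wordsLE K V n) (h : Θ * D = D * Θ) :
    Θ * locExp D = locExp D * Θ := by
  refine ext_wordsLE fun n w hw => ?_
  rw [Module.End.mul_apply, Module.End.mul_apply, locExp_apply hD (Nat.lt_succ_self n) w hw,
    locExp_apply hD (Nat.lt_succ_self n) _ (hΘ n w hw), expSum]
  have : ∀ i, Θ ((D ^ i) w) = (D ^ i) (Θ w) := fun i => by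
    have := (show Commute Θ D from h).pow_right i
    exact LinearMap.congr_fun this.eq w
  simp [this]

/-- Reorganizing a finitely supported double sum along antidiagonals. -/
theorem sum_antidiagonal_eq {M : Type*} [AddCommMonoid M] (f : ℕ × ℕ → M) (n : ℕ)
    (hf : ∀ p : ℕ × ℕ, n < p.1 ∨ n < p.2 → f p = 0) :
    ∑ i ∈ Finset.range (2 * n + 1), ∑ p ∈ Finset.HasAntidiagonal.antidiagonal i, f p =
      ∑ j ∈ Finset.range (n + 1), ∑ k ∈ Finset.range (n + 1), f (j, k) := by
  rw [← Finset.sum_product', ← Finset.sum_fiberwise_of_maps_to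
    (s := Finset.range (n + 1) ×ˢ Finset.range (n + 1)) (t := Finset.range (2 * n + 1))
    (g := fun p => p.1 + p.2) (by
      rintro ⟨a, b⟩ h
      simp at h ⊢
      omega)]
  refine Finset.sum_congr rfl fun i _ => ?_
  symm
  refine Finset.sum_subset ?_ ?_
  · rintro ⟨a, b⟩ h
    simp at h ⊢
    omega
  · rintro ⟨a, b⟩ h h'
    apply hf
    simp at h h' ⊢
    omega

theorem inv_factorial_mul_choose [CharZero K] {p : ℕ × ℕ} {i : ℕ}
    (hp : p ∈ Finset.HasAntidiagonal.antidiagonal i) :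
    ((i.factorial : K)⁻¹) * (i.choose p.1 : K) =
      (p.1.factorial : K)⁻¹ * (p.2.factorial : K)⁻¹ := by
  obtain ⟨a, b⟩ := p
  have hp : a + b = i := by simpa using hp
  subst hp
  have h := Nat.choose_mul_factorial_mul_factorial (Nat.le_add_right a b)
  rw [Nat.add_sub_cancel_left] at h
  have h' : ((a + b).choose a : K) * (a.factorial : K) * (b.factorial : K) =
      ((a + b).factorial : K) := by exact_mod_cast h
  have ha : (a.factorial : K) ≠ 0 := by exact_mod_cast a.factorial_ne_zero
  have hb : (b.factorial : K) ≠ 0 := by exact_mod_cast b.factorial_ne_zero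
  have hab : ((a + b).factorial : K) ≠ 0 := by exact_mod_cast (a + b).factorial_ne_zero
  simp only
  field_simp
  linear_combination h'

theorem locExp_neg_mul [CharZero K] {D : Module.End K (TensorAlgebra K V)} (hD : Shortens D) :
    locExp (-D) * locExp D = 1 := by
  refine ext_wordsLE fun n w hw => ?_
  have hmem : expSum D (n + 1) w ∈ wordsLE K V n := by
    rw [expSum, LinearMap.sum_apply]
    refine Submodule.sum_mem _ fun i hi => Submodule.smul_mem _ _ ?_
    clear hi
    induction i with
    | zero => simpa using hw
    | succ i ih =>
      rw [pow_succ', Module.End.mul_apply]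
      cases n with
      | zero => rw [hD.1 _ ih]; exact Submodule.zero_mem _
      | succ n => exact wordsLE_mono (Nat.le_succ n) (hD.2 n _ ih)
  rw [Module.End.mul_apply, locExp_apply hD (Nat.lt_succ_self n) w hw,
    locExp_apply hD.neg (Nat.lt_succ_self n) _ hmem]
  -- Terms with an exponent above `n` vanish on `w`, so the square of exponents up to `n` may be
  -- summed along antidiagonals up to `2 * n`.
  have key := sum_antidiagonal_eq (fun p => ((p.1.factorial : K)⁻¹ * (p.2.factorial : K)⁻¹) •
    ((-D) ^ p.1 * D ^ p.2) w) n (by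
      rintro ⟨a, b⟩ h
      have hc : (-D) ^ a * D ^ b = D ^ b * (-D) ^ a :=
        ((Commute.refl D).neg_left.pow_pow a b).eq
      rcases h with h | h
      · simp only [hc, Module.End.mul_apply, hD.neg.pow_eq_zero h hw, map_zero, smul_zero]
      · simp only [Module.End.mul_apply, hD.pow_eq_zero h hw, map_zero, smul_zero])
  -- By the binomial theorem an antidiagonal contributes `(-D + D) ^ i / i!`, which is zero unless
  -- `i = 0`.
  have lhs : ∀ i, ∑ p ∈ Finset.HasAntidiagonal.antidiagonal i, ((p.1.factorial : K)⁻¹ * (p.2.factorial : K)⁻¹) •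
      ((-D) ^ p.1 * D ^ p.2) w = (i.factorial : K)⁻¹ • (((-D) + D) ^ i) w := by
    intro i
    rw [((Commute.refl D).neg_left).add_pow', LinearMap.sum_apply, Finset.smul_sum]
    refine Finset.sum_congr rfl fun p hp => ?_
    rw [← inv_factorial_mul_choose hp, LinearMap.smul_apply, mul_smul, Nat.cast_smul_eq_nsmul]
  simp only [lhs] at key
  rw [Finset.sum_range_succ'] at key
  simp only [neg_add_cancel, pow_succ, mul_zero, LinearMap.zero_apply, smul_zero,
    Finset.sum_const_zero, pow_zero, Nat.factorial_zero, Nat.cast_one, inv_one, one_smul,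
    zero_add] at key
  rw [key, expSum, expSum]
  simp only [LinearMap.sum_apply, map_sum, LinearMap.smul_apply, map_smul, Finset.smul_sum,
    mul_smul, Module.End.mul_apply]
  rw [Finset.sum_comm]
  exact Finset.sum_congr rfl fun i _ => Finset.sum_congr rfl fun j _ => smul_comm _ _ _

theorem locExp_mul_neg [CharZero K] {D : Module.End K (TensorAlgebra K V)} (hD : Shortens D) :
    locExp D * locExp (-D) = 1 := by
  simpa using locExp_neg_mul hD.neg

variable {X Y Z : Type*} [AddCommGroup X] [Module K X] [AddCommGroup Y] [Module K Y]
  [AddCommGroup Z] [Module K Z]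

theorem conv_sum_left {σ : Type*} (s : Finset σ) (β : X →ₗ[K] Y →ₗ[K] Z)
    (A : σ → (TensorAlgebra K V →ₗ[K] X)) (B : TensorAlgebra K V →ₗ[K] Y) :
    conv β (∑ i ∈ s, A i) B = ∑ i ∈ s, conv β (A i) B := by
  classical
  induction s using Finset.induction_on with
  | empty => simp [conv_zero_left]
  | insert a s ha ih => rw [Finset.sum_insert ha, Finset.sum_insert ha, conv_add_left, ih]

theorem conv_sum_right {σ : Type*} (s : Finset σ) (β : X →ₗ[K] Y →ₗ[K] Z)
    (A : TensorAlgebra K V →ₗ[K] X) (B : σ → (TensorAlgebra K V →ₗ[K] Y)) :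
    conv β A (∑ i ∈ s, B i) = ∑ i ∈ s, conv β A (B i) := by
  classical
  induction s using Finset.induction_on with
  | empty => simp [conv_zero_right]
  | insert a s ha ih => rw [Finset.sum_insert ha, Finset.sum_insert ha, conv_add_right, ih]

/-- `D ⊗ 1` and `1 ⊗ D` commute, so their sum obeys the binomial theorem. -/
theorem comul_comp_pow {D : Module.End K (TensorAlgebra K V)}
    (hD : comul ∘ₗ D = (TensorProduct.map D LinearMap.id + TensorProduct.map LinearMap.id D) ∘ₗ
      comul) (i : ℕ) (w : TensorAlgebra K V) :
    comul ((D ^ i) w) = ∑ p ∈ Finset.HasAntidiagonal.antidiagonal i,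
      (i.choose p.1 : K) • conv (TensorProduct.mk K _ _) (D ^ p.1) (D ^ p.2) w := by
  set A : Module.End K (TensorAlgebra K V ⊗[K] TensorAlgebra K V) :=
    TensorProduct.map D LinearMap.id with hA
  set B : Module.End K (TensorAlgebra K V ⊗[K] TensorAlgebra K V) :=
    TensorProduct.map LinearMap.id D with hB
  have hAB : Commute A B := by
    change A ∘ₗ B = B ∘ₗ A
    rw [hA, hB, ← TensorProduct.map_comp, ← TensorProduct.map_comp]
    simp
  have h1 : ∀ i, comul ((D ^ i) w) = ((A + B) ^ i) (comul w) := by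
    intro i
    induction i with
    | zero => simp
    | succ i ih =>
      rw [pow_succ', Module.End.mul_apply, pow_succ', Module.End.mul_apply, ← ih]
      exact LinearMap.congr_fun hD _
  rw [h1, hAB.add_pow', LinearMap.sum_apply]
  refine Finset.sum_congr rfl fun p _ => ?_
  rw [LinearMap.smul_apply, ← Nat.cast_smul_eq_nsmul K]
  congr 1
  rw [← map_comp_comul, LinearMap.comp_apply]
  congr 1
  have hApow : ∀ j, A ^ j = TensorProduct.map (D ^ j) LinearMap.id := by
    intro j
    induction j with
    | zero => simp [Module.End.one_eq_id]
    | succ j ih =>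
      rw [pow_succ, ih, hA, pow_succ, Module.End.mul_eq_comp, Module.End.mul_eq_comp,
        ← TensorProduct.map_comp, LinearMap.comp_id]
  have hBpow : ∀ j, B ^ j = TensorProduct.map LinearMap.id (D ^ j) := by
    intro j
    induction j with
    | zero => simp [Module.End.one_eq_id]
    | succ j ih =>
      rw [pow_succ, ih, hB, pow_succ, Module.End.mul_eq_comp, Module.End.mul_eq_comp,
        ← TensorProduct.map_comp, LinearMap.comp_id]
  rw [hApow, hBpow, Module.End.mul_eq_comp, ← TensorProduct.map_comp]
  simp

/-- The exponential of a coderivation is a coalgebra map. -/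
theorem isCoalgMap_locExp [CharZero K] {D : Module.End K (TensorAlgebra K V)} (hS : Shortens D)
    (hD : IsCoder LinearMap.id D) : IsCoalgMap (locExp D) := by
  refine isCoalgMap_of_conv (locExp_one D) (comp_locExp hS hD.counit_comp) ?_
  refine ext_wordsLE fun n w hw => ?_
  -- Every truncation beyond `n` computes the exponential on `w`; `2 * n + 1` is chosen so that the
  -- antidiagonals fill the square of exponents up to `n`.
  rw [LinearMap.comp_apply, locExp_apply hS (show n < 2 * n + 1 by omega) w hw,
    conv_eqOn (TensorProduct.mk K _ _) (locExp_apply hS (Nat.lt_succ_self n))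
      (locExp_apply hS (Nat.lt_succ_self n)) w hw]
  have key := sum_antidiagonal_eq (fun p => ((p.1.factorial : K)⁻¹ * (p.2.factorial : K)⁻¹) •
    conv (TensorProduct.mk K (TensorAlgebra K V) (TensorAlgebra K V)) (D ^ p.1) (D ^ p.2) w) n (by
      rintro ⟨a, b⟩ h
      rcases h with h | h
      · rw [conv_eqOn (A' := 0) (B' := D ^ b) (TensorProduct.mk K _ _)
          (fun w hw => hS.pow_eq_zero h hw) (fun _ _ => rfl) w hw, conv_zero_left]
        simp
      · rw [conv_eqOn (A' := D ^ a) (B' := 0) (TensorProduct.mk K _ _)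
          (fun _ _ => rfl) (fun w hw => hS.pow_eq_zero h hw) w hw, conv_zero_right]
        simp)
  simp only [expSum, conv_sum_left, conv_sum_right, conv_smul_left, conv_smul_right,
    LinearMap.sum_apply, LinearMap.smul_apply, map_sum, map_smul]
  simp only [comul_comp_pow hD.comul_comp, Finset.smul_sum, smul_smul]
  rw [Finset.sum_comm (s := Finset.range n.succ)]
  refine Eq.trans ?_ (key.trans ?_)
  · exact Finset.sum_congr rfl fun i _ => Finset.sum_congr rfl fun p hp => by
      rw [inv_factorial_mul_choose hp]
  · exact Finset.sum_congr rfl fun i _ => Finset.sum_congr rfl fun p hp => by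
      rw [mul_comm]

theorem locExp_eq_self {g : TensorAlgebra K V →ₗ[K] V} {n : ℕ} (hn : 1 ≤ n)
    (hg : ∀ w ∈ wordsLE K V n, g w = 0) (ρ : V →ₗ[K] V) :
    ∀ w ∈ wordsLE K V n, locExp (coder ρ g) w = w := by
  intro w hw
  have hS := shortens_coder ρ fun w hw => hg w (wordsLE_mono hn hw)
  rw [locExp_apply hS (Nat.lt_succ_self n) w hw, expSum, Finset.sum_range_succ']
  have : ∀ i, (coder ρ g ^ (i + 1)) w = 0 := fun i => by
    rw [pow_succ, Module.End.mul_apply, coder_eq_zero_of_vanish ρ hg w hw, map_zero]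
  simp [this]

/-- On words of length `n + 1` the coderivation produces the single letter `g w`, which it kills
when applied again because `1 ≤ n`. Hence the series stops after the linear term. -/
theorem locExp_eq_add {g : TensorAlgebra K V →ₗ[K] V} {n : ℕ} (hn : 1 ≤ n)
    (hg : ∀ w ∈ wordsLE K V n, g w = 0) (ρ : V →ₗ[K] V) :
    ∀ w ∈ wordsLE K V (n + 1), locExp (coder ρ g) w = w + ι K (g w) := by
  intro w hw
  have hS := shortens_coder ρ fun w hw => hg w (wordsLE_mono hn hw)
  rw [locExp_apply hS (Nat.lt_succ_self (n + 1)) w hw, expSum, Finset.sum_range_succ',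
    Finset.sum_range_succ']
  have : ∀ i, (coder ρ g ^ (i + 1 + 1)) w = 0 := fun i => by
    rw [pow_succ, pow_succ, Module.End.mul_apply, Module.End.mul_apply,
      coder_eq_ι_of_vanish ρ hg w hw,
      coder_eq_zero_of_vanish ρ hg _ (ι_mem_wordsLE hn _), map_zero]
  simp only [LinearMap.add_apply, LinearMap.sum_apply, LinearMap.smul_apply, this, smul_zero,
    Finset.sum_const_zero, zero_add, pow_one, pow_zero, Module.End.one_apply,
    coder_eq_ι_of_vanish ρ hg w hw]
  simp [add_comm]

theorem coder_neg (ρ : V →ₗ[K] V) (g : TensorAlgebra K V →ₗ[K] V) :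
    coder ρ (-g) = -coder ρ g := by
  rw [coder, coder, LinearMap.comp_neg, conv_neg_left, conv_neg_right]

end Exponential

/-! ### Degrees as weights for scaling operators. -/

section Grading

open TensorAlgebra

variable {K : Type u} [Field K] {V : Type v} [AddCommGroup V] [Module K V]
  {𝒱 : ℤ → Submodule K V}

/-- A linear map assembled from its restrictions to the homogeneous components. -/
noncomputable def assemble {W : Type*} [AddCommGroup W] [Module K W]
    (h𝒱 : DirectSum.IsInternal 𝒱) (φ : ∀ i, 𝒱 i →ₗ[K] W) : V →ₗ[K] W :=
  DirectSum.toModule K ℤ W φ ∘ₗ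
    (LinearEquiv.ofBijective (DirectSum.coeLinearMap 𝒱)
      (show Function.Bijective (DirectSum.coeLinearMap 𝒱) from h𝒱)).symm.toLinearMap

theorem assemble_apply {W : Type*} [AddCommGroup W] [Module K W]
    (h𝒱 : DirectSum.IsInternal 𝒱) (φ : ∀ i, 𝒱 i →ₗ[K] W) {i : ℤ} {x : V} (hx : x ∈ 𝒱 i) :
    assemble h𝒱 φ x = φ i ⟨x, hx⟩ := by
  have : (LinearEquiv.ofBijective (DirectSum.coeLinearMap 𝒱)
      (show Function.Bijective (DirectSum.coeLinearMap 𝒱) from h𝒱)).symm x =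
      DirectSum.lof K ℤ (fun i => 𝒱 i) i ⟨x, hx⟩ := by
    rw [LinearEquiv.symm_apply_eq]
    simp
  simp only [assemble, LinearMap.comp_apply, LinearEquiv.coe_coe, this, DirectSum.toModule_lof]

theorem span_homogeneous (h𝒱 : DirectSum.IsInternal 𝒱) :
    Submodule.span K {x | ∃ i, x ∈ 𝒱 i} = ⊤ := by
  rw [eq_top_iff, ← h𝒱.submodule_iSup_eq_top]
  exact iSup_le fun i x hx => Submodule.subset_span ⟨i, hx⟩

theorem ext_homogeneous {W : Type*} [AddCommGroup W] [Module K W]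
    (h𝒱 : DirectSum.IsInternal 𝒱) {A B : V →ₗ[K] W}
    (h : ∀ i, ∀ x ∈ 𝒱 i, A x = B x) : A = B := by
  apply LinearMap.ext_on (span_homogeneous h𝒱)
  rintro x ⟨i, hx⟩
  exact h i x hx

theorem ext_homogeneous_words {W : Type*} [AddCommGroup W] [Module K W]
    (h𝒱 : DirectSum.IsInternal 𝒱) {A B : TensorAlgebra K V →ₗ[K] W}
    (h : ∀ n (d : ℕ → ℤ) (o : ℕ → V), (∀ i, o i ∈ 𝒱 (d i)) → A (word K n o) = B (word K n o)) :
    A = B := by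
  refine ext_words_of_span (s := {x | ∃ i, x ∈ 𝒱 i}) ⟨0, Submodule.zero_mem _⟩
    (span_homogeneous h𝒱) fun n o ho => ?_
  choose d hd using ho
  exact h n d o hd

/-- The scaling operator acting on the component of degree `i` as `c ^ i`. -/
noncomputable def scaling (h𝒱 : DirectSum.IsInternal 𝒱) (c : K) : Module.End K V :=
  assemble h𝒱 fun i => c ^ i • (𝒱 i).subtype

theorem scaling_apply (h𝒱 : DirectSum.IsInternal 𝒱) (c : K) {i : ℤ} {x : V} (hx : x ∈ 𝒱 i) :
    scaling h𝒱 c x = c ^ i • x := by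
  simp [scaling, assemble_apply h𝒱 _ hx]

theorem scaling_comm (h𝒱 : DirectSum.IsInternal 𝒱) (c d : K) :
    scaling h𝒱 c * scaling h𝒱 d = scaling h𝒱 d * scaling h𝒱 c := by
  refine ext_homogeneous h𝒱 fun i x hx => ?_
  simp only [Module.End.mul_apply, scaling_apply h𝒱 _ hx, map_smul]
  exact smul_comm _ _ _

theorem scaling_neg_one_mul_self (h𝒱 : DirectSum.IsInternal 𝒱) :
    scaling h𝒱 (-1) * scaling h𝒱 (-1) = 1 := by
  refine ext_homogeneous h𝒱 fun i x hx => ?_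
  simp [scaling_apply h𝒱 _ hx, smul_smul, ← mul_zpow]

theorem two_zpow_injective [CharZero K] : Function.Injective fun i : ℤ => (2 : K) ^ i := by
  intro i j h
  have h' : (2 : ℚ) ^ i = (2 : ℚ) ^ j := by
    have : (((2 : ℚ) ^ i : ℚ) : K) = (((2 : ℚ) ^ j : ℚ) : K) := by push_cast; exact h
    exact_mod_cast this
  exact zpow_right_injective₀ (by norm_num) (by norm_num) h'

/-- In characteristic zero the powers `2 ^ i` are distinct, so each homogeneous component is a full
eigenspace of the scaling by `2`. This converts weight identities back into degree statements. -/
theorem mem_of_scaling_two [CharZero K] (h𝒱 : DirectSum.IsInternal 𝒱) {i : ℤ} {x : V}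
    (hx : scaling h𝒱 2 x = (2 : K) ^ i • x) : x ∈ 𝒱 i := by
  classical
  obtain ⟨y, rfl⟩ := h𝒱.2 x
  have hsc : ∀ y : DirectSum ℤ (fun i => 𝒱 i), scaling h𝒱 (2 : K) (DirectSum.coeLinearMap 𝒱 y) =
      DirectSum.coeLinearMap 𝒱 (DFinsupp.mapRange.linearMap
        (fun i => ((2 : K) ^ i) • (LinearMap.id : 𝒱 i →ₗ[K] 𝒱 i)) y) := by
    intro y
    induction y using DirectSum.induction_on with
    | zero => simp
    | of j z =>
      rw [← DirectSum.lof_eq_of K, DirectSum.coeLinearMap_lof, scaling_apply h𝒱 _ z.2]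
      have : (DFinsupp.mapRange.linearMap fun i => ((2 : K) ^ i) • (LinearMap.id : 𝒱 i →ₗ[K] 𝒱 i))
          (DirectSum.lof K ℤ (fun i => 𝒱 i) j z) =
          DirectSum.lof K ℤ (fun i => 𝒱 i) j ((2 : K) ^ j • z) := by
        exact DFinsupp.mapRange_single (f := fun i (x : 𝒱 i) => (2 : K) ^ i • x)
          (hf := fun i => smul_zero _)
      rw [this, DirectSum.coeLinearMap_lof]
      rfl
    | add a b ha hb => simp only [map_add, ha, hb]
  have h1 : DirectSum.coeLinearMap 𝒱 (DFinsupp.mapRange.linearMap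
        (fun i => ((2 : K) ^ i) • (LinearMap.id : 𝒱 i →ₗ[K] 𝒱 i)) y) =
      DirectSum.coeLinearMap 𝒱 ((2 : K) ^ i • y) := by
    rw [← hsc, map_smul]; exact hx
  have h2 := h𝒱.1 h1
  have h3 : y = DirectSum.of (fun i => 𝒱 i) i (y i) := by
    ext j
    by_cases hj : j = i
    · subst hj; simp
    · have h4 := congrArg (fun z : DirectSum ℤ (fun i => 𝒱 i) => z j) h2
      change (2 : K) ^ j • y j = (2 : K) ^ i • y j at h4
      have h5 : ((2 : K) ^ j - (2 : K) ^ i) • y j = 0 := by rw [sub_smul, h4, sub_self]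
      rcases smul_eq_zero.1 h5 with h5 | h5
      · exact absurd (two_zpow_injective (sub_eq_zero.1 h5)) hj
      · rw [h5, DirectSum.of_eq_of_ne _ _ _ hj]
  rw [h3]
  rw [DirectSum.coeAddMonoidHom_of]
  exact (y i).2

/-- A linear map of weight `e` for two families of scaling operators. -/
def HasWeight {X Y : Type*} [AddCommGroup X] [Module K X] [AddCommGroup Y] [Module K Y]
    (a : K → Module.End K X) (b : K → Module.End K Y) (e : ℤ) (φ : X →ₗ[K] Y) : Prop :=
  ∀ c : K, c ≠ 0 → b c ∘ₗ φ = c ^ e • (φ ∘ₗ a c)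

section Weight

variable {X Y Z : Type*} [AddCommGroup X] [Module K X] [AddCommGroup Y] [Module K Y]
  [AddCommGroup Z] [Module K Z] {a : K → Module.End K X} {b : K → Module.End K Y}
  {c : K → Module.End K Z} {e e' : ℤ}

theorem HasWeight.comp {φ : X →ₗ[K] Y} {ψ : Y →ₗ[K] Z} (hψ : HasWeight b c e' ψ)
    (hφ : HasWeight a b e φ) : HasWeight a c (e' + e) (ψ ∘ₗ φ) := by
  intro r hr
  rw [← LinearMap.comp_assoc, hψ r hr, LinearMap.smul_comp, LinearMap.comp_assoc, hφ r hr,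
    LinearMap.comp_smul, smul_smul, ← zpow_add₀ hr, LinearMap.comp_assoc]

theorem HasWeight.comp_eq {φ : X →ₗ[K] Y} {ψ : Y →ₗ[K] Z} {d : ℤ} (hψ : HasWeight b c e' ψ)
    (hφ : HasWeight a b e φ) (hd : e' + e = d) : HasWeight a c d (ψ ∘ₗ φ) :=
  hd ▸ hψ.comp hφ

theorem HasWeight.add {φ ψ : X →ₗ[K] Y} (hφ : HasWeight a b e φ) (hψ : HasWeight a b e ψ) :
    HasWeight a b e (φ + ψ) := by
  intro r hr
  rw [LinearMap.comp_add, hφ r hr, hψ r hr, LinearMap.add_comp, smul_add]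

theorem HasWeight.smul {φ : X →ₗ[K] Y} (hφ : HasWeight a b e φ) (s : K) :
    HasWeight a b e (s • φ) := by
  intro r hr
  rw [LinearMap.comp_smul, hφ r hr, LinearMap.smul_comp, smul_comm]

theorem HasWeight.neg {φ : X →ₗ[K] Y} (hφ : HasWeight a b e φ) : HasWeight a b e (-φ) := by
  simpa using hφ.smul (-1)

theorem HasWeight.sub {φ ψ : X →ₗ[K] Y} (hφ : HasWeight a b e φ) (hψ : HasWeight a b e ψ) :
    HasWeight a b e (φ - ψ) := by
  rw [sub_eq_add_neg]; exact hφ.add hψ.neg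

theorem hasWeight_id : HasWeight a a 0 (LinearMap.id : X →ₗ[K] X) := by
  intro r hr
  simp

end Weight

/-- The scaling operators on the tensor algebra. -/
noncomputable def tscaling (h𝒱 : DirectSum.IsInternal 𝒱) (c : K) :
    Module.End K (TensorAlgebra K V) :=
  (tmap (scaling h𝒱 c)).toLinearMap

theorem word_smul (n : ℕ) (c : ℕ → K) (o : ℕ → V) :
    word K n (fun i => c i • o i) = (∏ i ∈ Finset.range n, c i) • word K n o := by
  rw [word, MultilinearMap.map_smul_univ, Finset.prod_range]
  rfl

theorem scaling_letters (h𝒱 : DirectSum.IsInternal 𝒱) {c : K} (hc : c ≠ 0) (n : ℕ) {d : ℕ → ℤ}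
    {o : ℕ → V} (ho : ∀ i, o i ∈ 𝒱 (d i)) :
    word K n (fun i => scaling h𝒱 c (o i)) = c ^ (∑ i ∈ Finset.range n, d i) • word K n o := by
  simp only [scaling_apply h𝒱 c (ho _)]
  rw [word_smul]
  congr 1
  induction n with
  | zero => simp
  | succ n ih => rw [Finset.prod_range_succ, Finset.sum_range_succ, zpow_add₀ hc, ih]

theorem tscaling_word (h𝒱 : DirectSum.IsInternal 𝒱) {c : K} (hc : c ≠ 0) (n : ℕ) {d : ℕ → ℤ}
    {o : ℕ → V} (ho : ∀ i, o i ∈ 𝒱 (d i)) :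
    tscaling h𝒱 c (word K n o) = c ^ (∑ i ∈ Finset.range n, d i) • word K n o := by
  rw [tscaling, AlgHom.toLinearMap_apply, tmap_word, scaling_letters h𝒱 hc n ho]

theorem hasWeight_of_words (h𝒱 : DirectSum.IsInternal 𝒱) {g : TensorAlgebra K V →ₗ[K] V} {e : ℤ}
    (h : ∀ n (d : ℕ → ℤ) (o : ℕ → V), (∀ i, o i ∈ 𝒱 (d i)) →
      g (word K n o) ∈ 𝒱 ((∑ i ∈ Finset.range n, d i) + e)) :
    HasWeight (tscaling h𝒱) (scaling h𝒱) e g := by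
  intro c hc
  refine ext_homogeneous_words h𝒱 fun n d o ho => ?_
  rw [LinearMap.comp_apply, LinearMap.smul_apply, LinearMap.comp_apply,
    tscaling_word h𝒱 hc n ho, scaling_apply h𝒱 c (h n d o ho), map_smul, smul_smul,
    zpow_add₀ hc, mul_comm]

theorem HasWeight.mem [CharZero K] {h𝒱 : DirectSum.IsInternal 𝒱} {g : TensorAlgebra K V →ₗ[K] V}
    {e : ℤ} (hg : HasWeight (tscaling h𝒱) (scaling h𝒱) e g) (n : ℕ) {d : ℕ → ℤ} {o : ℕ → V}
    (ho : ∀ i, o i ∈ 𝒱 (d i)) : g (word K n o) ∈ 𝒱 ((∑ i ∈ Finset.range n, d i) + e) := by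
  apply mem_of_scaling_two h𝒱
  have h := LinearMap.congr_fun (hg 2 two_ne_zero) (word K n o)
  rw [LinearMap.comp_apply, LinearMap.smul_apply, LinearMap.comp_apply,
    tscaling_word h𝒱 two_ne_zero n ho, map_smul, smul_smul, mul_comm,
    ← zpow_add₀ two_ne_zero] at h
  exact h

theorem HasWeight.mem_linear [CharZero K] {h𝒱 : DirectSum.IsInternal 𝒱} {φ : V →ₗ[K] V}
    {e : ℤ} (hφ : HasWeight (scaling h𝒱) (scaling h𝒱) e φ) {i : ℤ} {x : V} (hx : x ∈ 𝒱 i) :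
    φ x ∈ 𝒱 (i + e) := by
  apply mem_of_scaling_two h𝒱
  have h := LinearMap.congr_fun (hφ 2 two_ne_zero) x
  rw [LinearMap.comp_apply, LinearMap.smul_apply, LinearMap.comp_apply,
    scaling_apply h𝒱 _ hx, map_smul, smul_smul, mul_comm, ← zpow_add₀ two_ne_zero] at h
  exact h

theorem hasWeight_linear (h𝒱 : DirectSum.IsInternal 𝒱) {φ : V →ₗ[K] V} {e : ℤ}
    (h : ∀ i, ∀ x ∈ 𝒱 i, φ x ∈ 𝒱 (i + e)) : HasWeight (scaling h𝒱) (scaling h𝒱) e φ := by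
  intro c hc
  refine ext_homogeneous h𝒱 fun i x hx => ?_
  rw [LinearMap.comp_apply, LinearMap.smul_apply, LinearMap.comp_apply,
    scaling_apply h𝒱 _ hx, scaling_apply h𝒱 _ (h i x hx), map_smul, smul_smul, zpow_add₀ hc,
    mul_comm]

theorem hasWeight_ι (h𝒱 : DirectSum.IsInternal 𝒱) :
    HasWeight (scaling h𝒱) (tscaling h𝒱) 0 (ι K) := by
  intro c hc
  ext x
  simp [tscaling]

theorem letter_comp_tmap (ρ : V →ₗ[K] V) : letter ∘ₗ (tmap ρ).toLinearMap = ρ ∘ₗ letter := by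
  apply linearMap_ext_left
  · simp
  · intro x w _
    have := LinearMap.congr_fun (isCoalgMap_tmap ρ).counit_comp w
    simp at this
    simp [this]

theorem hasWeight_letter (h𝒱 : DirectSum.IsInternal 𝒱) :
    HasWeight (tscaling h𝒱) (scaling h𝒱) 0 (letter (K := K)) := by
  intro c hc
  rw [tscaling, letter_comp_tmap, zpow_zero, one_smul]

theorem tmap_comp_conv (ρ : V →ₗ[K] V) (A B : TensorAlgebra K V →ₗ[K] TensorAlgebra K V) :
    (tmap ρ).toLinearMap ∘ₗ conv mulT A B =
      conv mulT ((tmap ρ).toLinearMap ∘ₗ A) ((tmap ρ).toLinearMap ∘ₗ B) := by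
  rw [comp_conv]
  exact conv_congr fun u v => by simp

/-- Scaling is a coalgebra and an algebra map, so it passes through the convolution defining `coder`
and meets only `ρ` and `g`. -/
theorem hasWeight_coder (h𝒱 : DirectSum.IsInternal 𝒱) {ρ : V →ₗ[K] V}
    (hρ : HasWeight (scaling h𝒱) (scaling h𝒱) 0 ρ) {g : TensorAlgebra K V →ₗ[K] V} {e : ℤ}
    (hg : HasWeight (tscaling h𝒱) (scaling h𝒱) e g) :
    HasWeight (tscaling h𝒱) (tscaling h𝒱) e (coder ρ g) := by
  intro c hc
  have h1 := hg c hc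
  have h2 := hρ c hc
  rw [zpow_zero, one_smul] at h2
  have hΘ := isCoalgMap_tmap (scaling h𝒱 c)
  rw [tscaling, coder, hΘ.conv_comp, hΘ.conv_comp, tmap_comp_conv, tmap_comp_conv]
  have h3 : (tmap (scaling h𝒱 c)).toLinearMap ∘ₗ (tmap ρ).toLinearMap =
      (tmap ρ).toLinearMap ∘ₗ (tmap (scaling h𝒱 c)).toLinearMap := by
    rw [← AlgHom.comp_toLinearMap, ← AlgHom.comp_toLinearMap, ← tmap_comp, ← tmap_comp, h2]
  have h4 : (tmap (scaling h𝒱 c)).toLinearMap ∘ₗ ι K ∘ₗ g =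
      c ^ e • ((ι K ∘ₗ g) ∘ₗ (tmap (scaling h𝒱 c)).toLinearMap) := by
    have : (tmap (scaling h𝒱 c)).toLinearMap ∘ₗ ι K = ι K ∘ₗ scaling h𝒱 c := by ext x; simp
    rw [← LinearMap.comp_assoc, this, LinearMap.comp_assoc, h1, LinearMap.comp_smul]
    rfl
  rw [h3, h4, conv_smul_left, conv_smul_right, LinearMap.comp_id, LinearMap.id_comp]

theorem tmap_mem_wordsLE (ρ : V →ₗ[K] V) {n : ℕ} :
    ∀ w ∈ wordsLE K V n, (tmap ρ).toLinearMap w ∈ wordsLE K V n :=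
  (isCoalgMap_tmap ρ).mem_wordsLE

theorem hasWeight_locExp (h𝒱 : DirectSum.IsInternal 𝒱) {D : Module.End K (TensorAlgebra K V)}
    (hS : Shortens D) (hD : HasWeight (tscaling h𝒱) (tscaling h𝒱) 0 D) :
    HasWeight (tscaling h𝒱) (tscaling h𝒱) 0 (locExp D) := by
  intro c hc
  have h := hD c hc
  rw [zpow_zero, one_smul] at h ⊢
  exact locExp_comm hS (fun n => tmap_mem_wordsLE _) h

end Grading

/-! ### Coderivations extending linear maps, projections to fixed length, polynomials in an
operator. -/

section LinearCoder

open TensorAlgebra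

variable {K : Type u} [Field K] {V : Type v} [AddCommGroup V] [Module K V]
variable {X Y Z : Type*} [AddCommGroup X] [Module K X] [AddCommGroup Y] [Module K Y]
  [AddCommGroup Z] [Module K Z]

theorem conv_counit (A : TensorAlgebra K V →ₗ[K] X) :
    conv (LinearMap.lsmul K X).flip A counit = A := by
  ext w
  induction w using induction_left generalizing A with
  | one => simp [conv_one]
  | mul x w ih => rw [conv_mul, ih]; simp
  | add a b ha hb => simp only [map_add, ha, hb]
  | smul c a ha => simp only [map_smul, ha]

theorem letter_comp_coder (ρ : V →ₗ[K] V) {g : TensorAlgebra K V →ₗ[K] V} (hg : g 1 = 0) :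
    letter ∘ₗ coder ρ g = g := by
  apply linearMap_ext_left
  · simp [coder_one ρ hg, hg]
  · intro x w _
    have h1 : counit (coder ρ g w) = 0 :=
      LinearMap.congr_fun (isCoder_coder ρ hg).counit_comp w
    have h2 := LinearMap.congr_fun (letter_conv_ι g LinearMap.id) (ι K x * w)
    rw [LinearMap.comp_id, conv_counit, LinearMap.comp_apply] at h2
    rw [LinearMap.comp_apply, coder_mul, map_add, letter_mul, h1, zero_smul, zero_add, h2]

theorem coder_add (ρ : V →ₗ[K] V) (g g' : TensorAlgebra K V →ₗ[K] V) :
    coder ρ (g + g') = coder ρ g + coder ρ g' := by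
  rw [coder, coder, coder, LinearMap.comp_add, conv_add_left, conv_add_right]

/-- The coderivation extending a linear map. -/
theorem coder_letter_mul (ρ φ : V →ₗ[K] V) (x : V) (w : TensorAlgebra K V) :
    coder ρ (φ ∘ₗ letter) (ι K x * w) =
      ι K (ρ x) * coder ρ (φ ∘ₗ letter) w + ι K (φ x) * w := by
  rw [coder_mul, ← LinearMap.comp_assoc, conv_letter_mul]
  simp

theorem coder_letter_one (ρ φ : V →ₗ[K] V) : coder ρ (φ ∘ₗ letter) 1 = 0 :=
  coder_one ρ (by simp)

theorem proj_mul (n : ℕ) (x : V) (w : TensorAlgebra K V) :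
    proj (n + 1) (ι K x * w) = ι K x * proj n w := by
  have h : proj (n + 1) ∘ₗ lmul x = lmul x ∘ₗ proj (K := K) n := by
    refine ext_words fun k o => ?_
    have e : ι K x * word K k o = word K (k + 1) (fun i => Nat.casesOn i x o) := by
      rw [word_succ]; rfl
    simp only [LinearMap.comp_apply, lmul_apply, proj_word]
    rw [e, proj_word, ← e]
    simp [mul_ite]
  exact LinearMap.congr_fun h w

theorem proj_zero_mul (x : V) (w : TensorAlgebra K V) : proj 0 (ι K x * w) = 0 := by
  have h : proj 0 ∘ₗ lmul x = (0 : TensorAlgebra K V →ₗ[K] TensorAlgebra K V) := by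
    refine ext_words fun k o => ?_
    have e : ι K x * word K k o = word K (k + 1) (fun i => Nat.casesOn i x o) := by
      rw [word_succ]; rfl
    rw [LinearMap.comp_apply, lmul_apply, e, proj_word]
    simp
  exact LinearMap.congr_fun h w

theorem proj_one (n : ℕ) : proj n (1 : TensorAlgebra K V) = if n = 0 then 1 else 0 := by
  rw [← word_zero (K := K) (fun _ => (0 : V)), proj_word]
  simp [eq_comm]

theorem proj_comp_tmap (n : ℕ) (ρ : V →ₗ[K] V) :
    proj n ∘ₗ (tmap ρ).toLinearMap = (tmap ρ).toLinearMap ∘ₗ proj n := by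
  refine ext_words fun k o => ?_
  simp only [LinearMap.comp_apply, AlgHom.toLinearMap_apply, tmap_word, proj_word]
  split_ifs <;> simp [tmap_word]

theorem proj_comp_coder_letter (n : ℕ) (ρ φ : V →ₗ[K] V) :
    proj n ∘ₗ coder ρ (φ ∘ₗ letter) = coder ρ (φ ∘ₗ letter) ∘ₗ proj n := by
  ext w
  simp only [LinearMap.comp_apply]
  induction w using induction_left generalizing n with
  | one =>
    rw [coder_letter_one, map_zero, proj_one]
    split_ifs
    · rw [coder_letter_one]
    · simp
  | mul x w ih =>
    cases n with
    | zero => simp [coder_letter_mul, proj_zero_mul]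
    | succ n => rw [coder_letter_mul, map_add, proj_mul, proj_mul, proj_mul, ih, coder_letter_mul]
  | add a b ha hb => simp only [map_add, ha, hb]
  | smul c a ha => simp only [map_smul, ha]

theorem proj_apply_of_mem {n k : ℕ} (hk : n < k) :
    ∀ w ∈ wordsLE K V n, proj k w = 0 := by
  refine eqOn_wordsLE (B := 0) fun j hj o => ?_
  rw [proj_word, if_neg (by omega)]
  rfl

theorem sum_proj_apply_of_mem (n : ℕ) :
    ∀ w ∈ wordsLE K V n, ∑ k ∈ Finset.range (n + 1), proj k w = w := by
  intro w hw
  have := eqOn_wordsLE (K := K) (V := V) (A := ∑ k ∈ Finset.range (n + 1), proj k)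
    (B := LinearMap.id) (n := n) (fun j hj o => by
      simp only [LinearMap.sum_apply, proj_word, LinearMap.id_apply]
      rw [Finset.sum_ite_eq, if_pos (by simp; omega)]) w hw
  simpa using this

theorem letter_word (n : ℕ) (o : ℕ → V) :
    letter (word K n o) = if n = 1 then o 0 else 0 := by
  rcases n with _ | _ | n
  · simp
  · simp [word_succ]
  · simp [word_succ]

theorem conv_letter_right_word (β : X →ₗ[K] Y →ₗ[K] Z) (A : TensorAlgebra K V →ₗ[K] X)
    (φ : V →ₗ[K] Y) (n : ℕ) (o : ℕ → V) :
    conv β A (φ ∘ₗ letter) (word K (n + 1) o) = β (A (word K n o)) (φ (o n)) := by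
  rw [conv_word, Finset.sum_eq_single n]
  · simp [letter_word]
  · intro k hk hne
    have : n + 1 - k ≠ 1 := by omega
    simp [letter_word, this]
  · intro h; simp at h

theorem conv_letter_left_word (β : X →ₗ[K] Y →ₗ[K] Z) (φ : V →ₗ[K] X)
    (B : TensorAlgebra K V →ₗ[K] Y) (n : ℕ) (o : ℕ → V) :
    conv β (φ ∘ₗ letter) B (word K (n + 1) o) =
      β (φ (o 0)) (B (word K n fun i => o (i + 1))) := by
  rw [word_succ, conv_letter_mul]

/-- The trailing letter accounts for the shift from `n` to `n + 1`. With its mirror image below, it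
isolates one arity in the cyclicity identity. -/
theorem conv_proj_letter (β : X →ₗ[K] Y →ₗ[K] Z) (A : TensorAlgebra K V →ₗ[K] X)
    (φ : V →ₗ[K] Y) (n : ℕ) :
    conv β (A ∘ₗ proj n) (φ ∘ₗ letter) = conv β A (φ ∘ₗ letter) ∘ₗ proj (n + 1) := by
  refine ext_words fun k o => ?_
  rw [LinearMap.comp_apply, proj_word]
  cases k with
  | zero => simp [conv_one]
  | succ k =>
    rw [conv_letter_right_word, LinearMap.comp_apply, proj_word]
    split_ifs with h1 h2 h2
    · rw [conv_letter_right_word]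
    · omega
    · omega
    · simp

theorem conv_letter_proj (β : X →ₗ[K] Y →ₗ[K] Z) (φ : V →ₗ[K] X)
    (B : TensorAlgebra K V →ₗ[K] Y) (n : ℕ) :
    conv β (φ ∘ₗ letter) (B ∘ₗ proj n) = conv β (φ ∘ₗ letter) B ∘ₗ proj (n + 1) := by
  refine ext_words fun k o => ?_
  rw [LinearMap.comp_apply, proj_word]
  cases k with
  | zero => simp [conv_one]
  | succ k =>
    rw [conv_letter_left_word, LinearMap.comp_apply, proj_word]
    split_ifs with h1 h2 h2
    · rw [conv_letter_left_word]
    · omega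
    · omega
    · simp

/-- Used to transport degree, arity and the Hamiltonian property from an element to any polynomial
in `N` applied to it. -/
theorem aeval_induction {M : Type*} [AddCommGroup M] [Module K M] (N : Module.End K M)
    {C : M → Prop} (add : ∀ x y, C x → C y → C (x + y))
    (smul : ∀ (c : K) x, C x → C (c • x)) (step : ∀ x, C x → C (N x)) (r : Polynomial K) {x : M}
    (hx : C x) : C (Polynomial.aeval N r x) := by
  induction r using Polynomial.induction_on' with
  | add p q hp hq => rw [map_add]; exact add _ _ hp hq
  | monomial n c =>
    rw [Polynomial.aeval_monomial, Module.End.mul_apply, Module.algebraMap_end_apply]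
    refine smul c _ ?_
    induction n with
    | zero => simpa using hx
    | succ n ih => rw [pow_succ', Module.End.mul_apply]; exact step _ ih

theorem apply_aeval_of_eigen {M M' : Type*} [AddCommGroup M] [Module K M] [AddCommGroup M']
    [Module K M'] {N : Module.End K M} {φ : M →ₗ[K] M'} {j : K} (h : ∀ x, φ (N x) = j • φ x)
    (r : Polynomial K) (x : M) : φ (Polynomial.aeval N r x) = r.eval j • φ x := by
  induction r using Polynomial.induction_on' with
  | add p q hp hq => simp [hp, hq, add_smul]
  | monomial n c =>
    rw [Polynomial.aeval_monomial, Module.End.mul_apply, Module.algebraMap_end_apply, map_smul,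
      Polynomial.eval_monomial, mul_smul]
    congr 1
    induction n with
    | zero => simp
    | succ n ih => rw [pow_succ', Module.End.mul_apply, h, ih, smul_smul, pow_succ']

theorem comm_aeval {M : Type*} [AddCommGroup M] [Module K M] {N d : Module.End K M}
    (h : Commute d N) (r : Polynomial K) (x : M) :
    d (Polynomial.aeval N r x) = Polynomial.aeval N r (d x) := by
  induction r using Polynomial.induction_on' with
  | add p q hp hq => simp [hp, hq]
  | monomial n c =>
    simp only [Polynomial.aeval_monomial, Module.End.mul_apply, Module.algebraMap_end_apply,
      map_smul]
    congr 1
    exact LinearMap.congr_fun (h.pow_right n).eq x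

/-- The polynomial `∏ (1 - X / l)` over `1 ≤ l ≤ n`. -/
noncomputable def rootPoly (K : Type u) [Field K] (n : ℕ) : Polynomial K :=
  ∏ l ∈ Finset.range n, (1 - Polynomial.C ((l + 1 : K)⁻¹) * Polynomial.X)

theorem rootPoly_eval_zero (n : ℕ) : (rootPoly K n).eval 0 = 1 := by
  simp [rootPoly, Polynomial.eval_prod]

theorem rootPoly_eval_nat [CharZero K] {n j : ℕ} (hj : 1 ≤ j) (hjn : j ≤ n) :
    (rootPoly K n).eval (j : K) = 0 := by
  rw [rootPoly, Polynomial.eval_prod]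
  refine Finset.prod_eq_zero (i := j - 1) (by simp; omega) ?_
  have : ((j - 1 : ℕ) : K) + 1 = j := by
    have : j - 1 + 1 = j := by omega
    exact_mod_cast congrArg (Nat.cast (R := K)) this
  rw [this]
  have hj0 : (j : K) ≠ 0 := by exact_mod_cast (by omega : j ≠ 0)
  simp [hj0]

/-- The constant term of `rootPoly` is one. Evaluated at an operator with eigenvalues in `0, …, n`,
the quotient `r` inverts it off its kernel, while `rootPoly` itself projects onto the kernel. -/
theorem exists_rootPoly_eq (n : ℕ) :
    ∃ r : Polynomial K, 1 - rootPoly K n = Polynomial.X * r := by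
  have : Polynomial.X ∣ 1 - rootPoly K n := by
    rw [Polynomial.X_dvd_iff, Polynomial.coeff_zero_eq_eval_zero]
    simp [rootPoly_eval_zero]
  exact this

end LinearCoder

/-! ### Hodge data and the operators built from them. -/

section Hodge

open TensorAlgebra

variable {K : Type u} [Field K] {V : Type v} [AddCommGroup V] [Module K V]
  {𝒱 : ℤ → Submodule K V}

/-- The parity operator. -/
noncomputable abbrev parity (h𝒱 : DirectSum.IsInternal 𝒱) : Module.End K V := scaling h𝒱 (-1)

/-- A differential `Q` and a homotopy `h` satisfying the side conditions, both compatible with the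
bilinear form `ω`. -/
structure IsHodge (h𝒱 : DirectSum.IsInternal 𝒱) (ω : V →ₗ[K] V →ₗ[K] K)
    (Q h : Module.End K V) : Prop where
  Q_weight : HasWeight (scaling h𝒱) (scaling h𝒱) 1 Q
  h_weight : HasWeight (scaling h𝒱) (scaling h𝒱) (-1) h
  Q_sq : Q * Q = 0
  h_sq : h * h = 0
  QhQ : Q * h * Q = Q
  hQh : h * Q * h = h
  ω_Q : ∀ x y, ω (Q x) y = -ω (parity h𝒱 x) (Q y)
  ω_h : ∀ x y, ω (h x) y = ω (parity h𝒱 x) (h y)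

theorem HasWeight.parity_odd {X Y : Type*} [AddCommGroup X] [Module K X] [AddCommGroup Y]
    [Module K Y] {a : K → Module.End K X} {b : K → Module.End K Y} {e : ℤ} {φ : X →ₗ[K] Y}
    (hφ : HasWeight a b e φ) (he : Odd e) : b (-1) ∘ₗ φ = -(φ ∘ₗ a (-1)) := by
  rw [hφ (-1) (by simp), he.neg_one_zpow, neg_one_smul]

theorem HasWeight.parity_even {X Y : Type*} [AddCommGroup X] [Module K X] [AddCommGroup Y]
    [Module K Y] {a : K → Module.End K X} {b : K → Module.End K Y} {φ : X →ₗ[K] Y}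
    (hφ : HasWeight a b 0 φ) (c : K) (hc : c ≠ 0) : b c ∘ₗ φ = φ ∘ₗ a c := by
  rw [hφ c hc, zpow_zero, one_smul]

/-- The number operator `Q h + h Q`. -/
def numOp (Q h : Module.End K V) : Module.End K V := Q * h + h * Q

/-- The projection complementary to the number operator. -/
def harm (Q h : Module.End K V) : Module.End K V := 1 - numOp Q h

/-- The odd coderivation extending a linear map. -/
noncomputable def oddCoder (h𝒱 : DirectSum.IsInternal 𝒱) (φ : Module.End K V) :
    Module.End K (TensorAlgebra K V) :=
  coder (parity h𝒱) (φ ∘ₗ letter)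

/-- The coderivation extending the number operator. -/
noncomputable def numCoder (h𝒱 : DirectSum.IsInternal 𝒱) (Q h : Module.End K V) :
    Module.End K (TensorAlgebra K V) :=
  oddCoder h𝒱 Q * oddCoder h𝒱 h + oddCoder h𝒱 h * oddCoder h𝒱 Q

theorem oddCoder_mul (h𝒱 : DirectSum.IsInternal 𝒱) (φ : Module.End K V) (x : V)
    (w : TensorAlgebra K V) : oddCoder h𝒱 φ (ι K x * w) =
      ι K (parity h𝒱 x) * oddCoder h𝒱 φ w + ι K (φ x) * w :=
  coder_letter_mul _ φ x w

theorem oddCoder_one (h𝒱 : DirectSum.IsInternal 𝒱) (φ : Module.End K V) :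
    oddCoder h𝒱 φ 1 = 0 := coder_letter_one _ φ

theorem letter_comp_oddCoder (h𝒱 : DirectSum.IsInternal 𝒱) (φ : Module.End K V) :
    letter ∘ₗ oddCoder h𝒱 φ = φ ∘ₗ letter :=
  letter_comp_coder _ (by simp)

theorem isCoder_oddCoder (h𝒱 : DirectSum.IsInternal 𝒱) (φ : Module.End K V) :
    IsCoder (tscaling h𝒱 (-1)) (oddCoder h𝒱 φ) :=
  isCoder_coder _ (by simp)

theorem hasWeight_parity (h𝒱 : DirectSum.IsInternal 𝒱) :
    HasWeight (scaling h𝒱) (scaling h𝒱) 0 (parity h𝒱) := by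
  intro c _
  rw [zpow_zero, one_smul]
  exact scaling_comm h𝒱 c (-1)

theorem hasWeight_oddCoder (h𝒱 : DirectSum.IsInternal 𝒱) {φ : Module.End K V} {e : ℤ}
    (hφ : HasWeight (scaling h𝒱) (scaling h𝒱) e φ) :
    HasWeight (tscaling h𝒱) (tscaling h𝒱) e (oddCoder h𝒱 φ) :=
  hasWeight_coder h𝒱 (hasWeight_parity h𝒱) (hφ.comp_eq (hasWeight_letter h𝒱) (add_zero e))

theorem parity_parity (h𝒱 : DirectSum.IsInternal 𝒱) (x : V) :
    parity h𝒱 (parity h𝒱 x) = x :=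
  LinearMap.congr_fun (scaling_neg_one_mul_self h𝒱) x

theorem tscaling_neg_one_sq (h𝒱 : DirectSum.IsInternal 𝒱) :
    tscaling h𝒱 (-1) ∘ₗ tscaling h𝒱 (-1) = LinearMap.id := by
  rw [tscaling, ← AlgHom.comp_toLinearMap, ← tmap_comp]
  have : (scaling h𝒱 (-1) ∘ₗ scaling h𝒱 (-1) : V →ₗ[K] V) = LinearMap.id :=
    scaling_neg_one_mul_self h𝒱
  rw [this, tmap_id]
  rfl

namespace IsHodge

variable {h𝒱 : DirectSum.IsInternal 𝒱} {ω : V →ₗ[K] V →ₗ[K] K} {Q h : Module.End K V}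

theorem parity_Q (H : IsHodge h𝒱 ω Q h) (x : V) : parity h𝒱 (Q x) = -Q (parity h𝒱 x) :=
  LinearMap.congr_fun (H.Q_weight.parity_odd odd_one) x

theorem parity_h (H : IsHodge h𝒱 ω Q h) (x : V) : parity h𝒱 (h x) = -h (parity h𝒱 x) :=
  LinearMap.congr_fun (H.h_weight.parity_odd (by decide)) x

theorem Q_numOp (H : IsHodge h𝒱 ω Q h) : Q * numOp Q h = Q := by
  rw [numOp, mul_add, ← mul_assoc, H.Q_sq, zero_mul, zero_add, ← mul_assoc, H.QhQ]

theorem numOp_Q (H : IsHodge h𝒱 ω Q h) : numOp Q h * Q = Q := by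
  rw [numOp, add_mul, H.QhQ, mul_assoc, H.Q_sq, mul_zero, add_zero]

theorem h_numOp (H : IsHodge h𝒱 ω Q h) : h * numOp Q h = h := by
  rw [numOp, mul_add, ← mul_assoc, ← mul_assoc, H.h_sq, zero_mul, add_zero, H.hQh]

theorem numOp_h (H : IsHodge h𝒱 ω Q h) : numOp Q h * h = h := by
  rw [numOp, add_mul, mul_assoc, H.h_sq, mul_zero, zero_add, H.hQh]

/-- Both `Q` and `h` absorb `N = Qh + hQ` on the right, hence so does `N`. -/
theorem numOp_sq (H : IsHodge h𝒱 ω Q h) : numOp Q h * numOp Q h = numOp Q h := by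
  conv_lhs => rw [numOp.eq_1 Q h, add_mul, mul_assoc, ← numOp, H.h_numOp, mul_assoc, H.Q_numOp]
  rfl

theorem harm_h (H : IsHodge h𝒱 ω Q h) : harm Q h * h = 0 := by
  rw [harm, sub_mul, H.numOp_h, one_mul, sub_self]

theorem h_harm (H : IsHodge h𝒱 ω Q h) : h * harm Q h = 0 := by
  rw [harm, mul_sub, H.h_numOp, mul_one, sub_self]

theorem Q_harm (H : IsHodge h𝒱 ω Q h) : Q * harm Q h = 0 := by
  rw [harm, mul_sub, H.Q_numOp, mul_one, sub_self]

theorem harm_Q (H : IsHodge h𝒱 ω Q h) : harm Q h * Q = 0 := by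
  rw [harm, sub_mul, H.numOp_Q, one_mul, sub_self]

theorem harm_numOp (H : IsHodge h𝒱 ω Q h) : harm Q h * numOp Q h = 0 := by
  rw [harm, sub_mul, H.numOp_sq, one_mul, sub_self]

theorem numOp_harm (H : IsHodge h𝒱 ω Q h) : numOp Q h * harm Q h = 0 := by
  rw [harm, mul_sub, H.numOp_sq, mul_one, sub_self]

theorem harm_sq (H : IsHodge h𝒱 ω Q h) : harm Q h * harm Q h = harm Q h := by
  conv_lhs => rw [harm.eq_1 Q h, sub_mul, ← harm.eq_1, H.numOp_harm]
  simp

theorem numOp_weight (H : IsHodge h𝒱 ω Q h) :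
    HasWeight (scaling h𝒱) (scaling h𝒱) 0 (numOp Q h) :=
  (H.Q_weight.comp_eq H.h_weight (by norm_num)).add (H.h_weight.comp_eq H.Q_weight (by norm_num))

theorem harm_weight (H : IsHodge h𝒱 ω Q h) :
    HasWeight (scaling h𝒱) (scaling h𝒱) 0 (harm Q h) :=
  hasWeight_id.sub H.numOp_weight

theorem ω_Q_right (H : IsHodge h𝒱 ω Q h) (x y : V) : ω x (Q y) = -ω (Q (parity h𝒱 x)) y := by
  rw [H.ω_Q, parity_parity, neg_neg]

theorem ω_h_right (H : IsHodge h𝒱 ω Q h) (x y : V) : ω x (h y) = ω (h (parity h𝒱 x)) y := by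
  rw [H.ω_h, parity_parity]

/-- Taking adjoints exchanges `Qh` and `hQ`. The sign from the skewness of `Q` cancels the sign from
moving the parity operator past an odd map. -/
theorem ω_numOp (H : IsHodge h𝒱 ω Q h) (x y : V) :
    ω (numOp Q h x) y = ω x (numOp Q h y) := by
  simp only [numOp, LinearMap.add_apply, Module.End.mul_apply, map_add]
  rw [H.ω_Q_right x (h y), H.ω_h_right x (Q y), H.ω_Q (h x), H.ω_h (Q x), H.parity_h, H.parity_Q]
  simp [add_comm]

theorem ω_harm (H : IsHodge h𝒱 ω Q h) (x y : V) :
    ω (harm Q h x) y = ω x (harm Q h y) := by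
  simp [harm, H.ω_numOp]

theorem oddCoder_Q_sq (H : IsHodge h𝒱 ω Q h) : oddCoder h𝒱 Q * oddCoder h𝒱 Q = 0 := by
  apply linearMap_ext_left
  · simp [oddCoder_one]
  · intro x w hw
    simp only [Module.End.mul_apply, LinearMap.zero_apply] at hw ⊢
    rw [oddCoder_mul, map_add, oddCoder_mul, oddCoder_mul, hw, H.parity_Q]
    have : Q (Q x) = 0 := LinearMap.congr_fun H.Q_sq x
    simp [this]

/-- In the anticommutator of two odd coderivations the mixed terms cancel in pairs and the parity
operators square to one, leaving an ordinary derivation. -/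
theorem numCoder_mul (H : IsHodge h𝒱 ω Q h) (x : V) (w : TensorAlgebra K V) :
    numCoder h𝒱 Q h (ι K x * w) =
      ι K x * numCoder h𝒱 Q h w + ι K (numOp Q h x) * w := by
  simp only [numCoder, numOp, LinearMap.add_apply, Module.End.mul_apply, oddCoder_mul, map_add,
    parity_parity, H.parity_Q, H.parity_h, map_neg, neg_mul, mul_add, add_mul]
  abel

theorem numCoder_one : numCoder h𝒱 Q h 1 = 0 := by
  simp [numCoder, oddCoder_one]

theorem numCoder_Q (H : IsHodge h𝒱 ω Q h) :
    numCoder h𝒱 Q h * oddCoder h𝒱 Q = oddCoder h𝒱 Q * numCoder h𝒱 Q h := by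
  rw [numCoder, add_mul, mul_add, mul_assoc (oddCoder h𝒱 h), H.oddCoder_Q_sq,
    ← mul_assoc _ (oddCoder h𝒱 Q) (oddCoder h𝒱 h), H.oddCoder_Q_sq, mul_assoc]
  simp

theorem letter_comp_numCoder : letter ∘ₗ numCoder h𝒱 Q h = numOp Q h ∘ₗ letter := by
  have hQ := LinearMap.congr_fun (letter_comp_oddCoder h𝒱 Q)
  have hh := LinearMap.congr_fun (letter_comp_oddCoder h𝒱 h)
  refine LinearMap.ext fun w => ?_
  simp only [LinearMap.comp_apply] at hQ hh
  simp [numCoder, numOp, hQ, hh]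

/-- The four mixed terms cancel because the extensions of `Q` and `h` are odd and so anticommute
with parity. -/
theorem conv_comp_numCoder (H : IsHodge h𝒱 ω Q h) {X Y Z : Type*} [AddCommGroup X] [Module K X]
    [AddCommGroup Y] [Module K Y] [AddCommGroup Z] [Module K Z] (β : X →ₗ[K] Y →ₗ[K] Z)
    (A : TensorAlgebra K V →ₗ[K] X) (B : TensorAlgebra K V →ₗ[K] Y) :
    conv β A B ∘ₗ numCoder h𝒱 Q h =
      conv β (A ∘ₗ numCoder h𝒱 Q h) B + conv β A (B ∘ₗ numCoder h𝒱 Q h) := by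
  have hQ := (isCoder_oddCoder h𝒱 Q).conv_comp β
  have hh := (isCoder_oddCoder h𝒱 h).conv_comp β
  have hQτ : tscaling h𝒱 (-1) ∘ₗ oddCoder h𝒱 Q = -(oddCoder h𝒱 Q ∘ₗ tscaling h𝒱 (-1)) :=
    (hasWeight_oddCoder h𝒱 H.Q_weight).parity_odd odd_one
  have hhτ : tscaling h𝒱 (-1) ∘ₗ oddCoder h𝒱 h = -(oddCoder h𝒱 h ∘ₗ tscaling h𝒱 (-1)) :=
    (hasWeight_oddCoder h𝒱 H.h_weight).parity_odd (by decide)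
  rw [numCoder]
  simp only [Module.End.mul_eq_comp, LinearMap.comp_add]
  rw [← LinearMap.comp_assoc, ← LinearMap.comp_assoc, hQ, hh, LinearMap.add_comp,
    LinearMap.add_comp, hh, hh, hQ, hQ, conv_add_left, conv_add_right]
  simp only [LinearMap.comp_assoc, tscaling_neg_one_sq, LinearMap.comp_id, hQτ, hhτ,
    LinearMap.comp_neg, conv_neg_left]
  abel

theorem numCoder_weight (H : IsHodge h𝒱 ω Q h) :
    HasWeight (tscaling h𝒱) (tscaling h𝒱) 0 (numCoder h𝒱 Q h) := by
  have hQ := hasWeight_oddCoder h𝒱 H.Q_weight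
  have hh := hasWeight_oddCoder h𝒱 H.h_weight
  exact (hQ.comp_eq hh (by norm_num)).add (hh.comp_eq hQ (by norm_num))

theorem proj_comp_numCoder (n : ℕ) :
    proj n ∘ₗ numCoder h𝒱 Q h = numCoder h𝒱 Q h ∘ₗ proj n := by
  have hQ : proj n ∘ₗ oddCoder h𝒱 Q = oddCoder h𝒱 Q ∘ₗ proj n := proj_comp_coder_letter n _ _
  have hh : proj n ∘ₗ oddCoder h𝒱 h = oddCoder h𝒱 h ∘ₗ proj n := proj_comp_coder_letter n _ _
  have hQ := LinearMap.congr_fun hQ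
  have hh := LinearMap.congr_fun hh
  refine LinearMap.ext fun w => ?_
  simp only [LinearMap.comp_apply] at hQ hh
  simp [numCoder, hQ, hh]

/-- Every word produced by the extension of `h` contains a letter in the image of `h`, and `P h =
0`. -/
theorem tmap_harm_comp_oddCoder (H : IsHodge h𝒱 ω Q h) :
    (tmap (harm Q h)).toLinearMap ∘ₗ oddCoder h𝒱 h = 0 := by
  apply linearMap_ext_left
  · simp [oddCoder_one]
  · intro x w hw
    simp only [LinearMap.comp_apply, AlgHom.toLinearMap_apply, LinearMap.zero_apply] at hw ⊢
    have : harm Q h (h x) = 0 := LinearMap.congr_fun H.harm_h x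
    simp [oddCoder_mul, hw, this]

end IsHodge

end Hodge

/-! ### Cyclic bar differentials, Hamiltonian vector fields, and the number operator on
corestrictions. -/

section Gauge

open TensorAlgebra

variable {K : Type u} [Field K] {V : Type v} [AddCommGroup V] [Module K V]
  {𝒱 : ℤ → Submodule K V}

/-- The bilinear form as a functional on words of length two. -/
noncomputable def pairing (ω : V →ₗ[K] V →ₗ[K] K) : TensorAlgebra K V →ₗ[K] K :=
  conv ω letter letter

/-- The bar differential of a cyclic `A_∞`-structure with linear part `Q`. -/
structure IsCyclicCoder (h𝒱 : DirectSum.IsInternal 𝒱) (ω : V →ₗ[K] V →ₗ[K] K)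
    (Q : Module.End K V) (D : Module.End K (TensorAlgebra K V)) : Prop where
  isCoder : IsCoder (tscaling h𝒱 (-1)) D
  weight : HasWeight (tscaling h𝒱) (tscaling h𝒱) 1 D
  sq : D * D = 0
  form : pairing ω ∘ₗ D = 0
  linear : ∀ x, letter (D (ι K x)) = Q x

/-- The operations of arity between `2` and `n` live on the image of the projection `P`. -/
def IsSplitUpTo (P : Module.End K V) (D : Module.End K (TensorAlgebra K V)) (n : ℕ) : Prop :=
  ∀ k, 2 ≤ k → k ≤ n → ∀ o : ℕ → V,
    letter (D (word K k o)) = P (letter (D (tmap P (word K k o))))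

/-- The infinitesimal invariance of `ω` under an even vector field. -/
def IsHamiltonian (ω : V →ₗ[K] V →ₗ[K] K) (g : TensorAlgebra K V →ₗ[K] V) : Prop :=
  conv ω g letter + conv ω letter g = 0

/-- The action of the number operator on corestrictions. -/
noncomputable def numEnd (h𝒱 : DirectSum.IsInternal 𝒱) (Q h : Module.End K V) :
    Module.End K (TensorAlgebra K V →ₗ[K] V) :=
  LinearMap.llcomp K (TensorAlgebra K V) V V (numOp Q h) +
    LinearMap.lcomp K V (numCoder h𝒱 Q h)

theorem numEnd_apply (h𝒱 : DirectSum.IsInternal 𝒱) (Q h : Module.End K V)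
    (g : TensorAlgebra K V →ₗ[K] V) :
    numEnd h𝒱 Q h g = numOp Q h ∘ₗ g + g ∘ₗ numCoder h𝒱 Q h := rfl

/-- The differential on even corestrictions. -/
noncomputable def dEnd (h𝒱 : DirectSum.IsInternal 𝒱) (Q : Module.End K V) :
    Module.End K (TensorAlgebra K V →ₗ[K] V) :=
  LinearMap.llcomp K (TensorAlgebra K V) V V Q - LinearMap.lcomp K V (oddCoder h𝒱 Q)

theorem dEnd_apply (h𝒱 : DirectSum.IsInternal 𝒱) (Q : Module.End K V)
    (g : TensorAlgebra K V →ₗ[K] V) :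
    dEnd h𝒱 Q g = Q ∘ₗ g - g ∘ₗ oddCoder h𝒱 Q := rfl

/-- The homotopy on odd corestrictions, before inverting the number operator. -/
noncomputable def hEnd (h𝒱 : DirectSum.IsInternal 𝒱) (h : Module.End K V)
    (g : TensorAlgebra K V →ₗ[K] V) : TensorAlgebra K V →ₗ[K] V :=
  h ∘ₗ g - g ∘ₗ oddCoder h𝒱 h

variable {h𝒱 : DirectSum.IsInternal 𝒱} {ω : V →ₗ[K] V →ₗ[K] K} {Q h : Module.End K V}

theorem IsHodge.commute_dEnd_numEnd (H : IsHodge h𝒱 ω Q h) :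
    Commute (dEnd h𝒱 Q) (numEnd h𝒱 Q h) := by
  refine LinearMap.ext fun g => LinearMap.ext fun w => ?_
  have h1 : ∀ x, Q (numOp Q h x) = numOp Q h (Q x) := fun x =>
    LinearMap.congr_fun (H.Q_numOp.trans H.numOp_Q.symm) x
  have h2 : ∀ x, numCoder h𝒱 Q h (oddCoder h𝒱 Q x) = oddCoder h𝒱 Q (numCoder h𝒱 Q h x) :=
    fun x => LinearMap.congr_fun H.numCoder_Q x
  simp only [Module.End.mul_apply, dEnd_apply, numEnd_apply, LinearMap.comp_apply,
    LinearMap.add_apply, LinearMap.sub_apply, map_add, map_sub, h1, h2]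
  abel

/-- The homotopy identity, when the obstruction `c` is harmonic. -/
theorem dEnd_hEnd {g c : TensorAlgebra K V →ₗ[K] V}
    (hc : Q ∘ₗ g + g ∘ₗ oddCoder h𝒱 Q = c) (hc1 : h ∘ₗ c = 0) (hc2 : c ∘ₗ oddCoder h𝒱 h = 0) :
    dEnd h𝒱 Q (hEnd h𝒱 h g) = numEnd h𝒱 Q h g := by
  refine LinearMap.ext fun w => ?_
  have e1 := LinearMap.congr_fun hc1 w
  have e2 := LinearMap.congr_fun hc2 w
  rw [← hc] at e1 e2
  simp only [LinearMap.comp_apply, LinearMap.add_apply, LinearMap.zero_apply, map_add] at e1 e2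
  simp only [dEnd_apply, numEnd_apply, hEnd, numOp, numCoder, LinearMap.comp_apply,
    LinearMap.add_apply, LinearMap.sub_apply, map_add, map_sub, Module.End.mul_apply]
  rw [eq_neg_of_add_eq_zero_left e2, eq_neg_of_add_eq_zero_right e1]
  abel

/-- Compose the cyclicity identity of `g` with the extension of `h`, and move `h` across `ω` by
self-adjointness. The signs turn the odd identity into the even one. -/
theorem IsHodge.isHamiltonian_hEnd (H : IsHodge h𝒱 ω Q h) {g : TensorAlgebra K V →ₗ[K] V}
    (hw : HasWeight (tscaling h𝒱) (scaling h𝒱) 1 g)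
    (hg : conv ω g letter + conv ω (parity h𝒱 ∘ₗ letter) g = 0) :
    IsHamiltonian ω (hEnd h𝒱 h g) := by
  have h1 : conv ω (h ∘ₗ g) letter = conv ω (parity h𝒱 ∘ₗ g) (h ∘ₗ letter) :=
    conv_congr fun u v => H.ω_h _ _
  have h2 : conv ω letter (h ∘ₗ g) = conv ω (h ∘ₗ parity h𝒱 ∘ₗ letter) g :=
    conv_congr fun u v => H.ω_h_right _ _
  have h3 : parity h𝒱 ∘ₗ g = -(g ∘ₗ tscaling h𝒱 (-1)) := hw.parity_odd odd_one
  have h4 : parity h𝒱 ∘ₗ h = -(h ∘ₗ parity h𝒱) := LinearMap.ext H.parity_h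
  have h5 := congrArg (fun φ => φ ∘ₗ oddCoder h𝒱 h) hg
  have hh := (isCoder_oddCoder h𝒱 h).conv_comp ω
  have hl : letter ∘ₗ tscaling h𝒱 (-1) = parity h𝒱 ∘ₗ letter := letter_comp_tmap _
  have hp : parity h𝒱 ∘ₗ parity h𝒱 = LinearMap.id := scaling_neg_one_mul_self h𝒱
  simp only [LinearMap.add_comp, LinearMap.zero_comp, hh, letter_comp_oddCoder,
    LinearMap.comp_assoc, hl] at h5
  rw [← LinearMap.comp_assoc letter (parity h𝒱) (parity h𝒱), hp, LinearMap.id_comp,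
    ← LinearMap.comp_assoc letter h (parity h𝒱), h4] at h5
  rw [IsHamiltonian, hEnd, sub_eq_add_neg, conv_add_left, conv_add_right, h1, h2, h3,
    conv_neg_left, conv_neg_left, conv_neg_right]
  rw [LinearMap.neg_comp, conv_neg_left, LinearMap.comp_assoc] at h5
  rw [← neg_eq_zero, ← h5]
  abel

/-- Self-adjointness of `N` trades its action on outputs for an action on the paired letter. The sum
is then the Hamiltonian identity composed with the even coderivation extending `N`. -/
theorem IsHodge.isHamiltonian_numEnd (H : IsHodge h𝒱 ω Q h) {g : TensorAlgebra K V →ₗ[K] V}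
    (hg : IsHamiltonian ω g) : IsHamiltonian ω (numEnd h𝒱 Q h g) := by
  have h1 : conv ω (numOp Q h ∘ₗ g) letter = conv ω g (numOp Q h ∘ₗ letter) :=
    conv_congr fun u v => H.ω_numOp _ _
  have h2 : conv ω letter (numOp Q h ∘ₗ g) = conv ω (numOp Q h ∘ₗ letter) g :=
    conv_congr fun u v => (H.ω_numOp _ _).symm
  have h5 := congrArg (fun φ => φ ∘ₗ numCoder h𝒱 Q h) hg
  simp only [LinearMap.add_comp, LinearMap.zero_comp, H.conv_comp_numCoder,
    letter_comp_numCoder] at h5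
  rw [IsHamiltonian, numEnd_apply, conv_add_left, conv_add_right, h1, h2, ← h5]
  abel

theorem IsHamiltonian.add {g g' : TensorAlgebra K V →ₗ[K] V} (hg : IsHamiltonian ω g)
    (hg' : IsHamiltonian ω g') : IsHamiltonian ω (g + g') := by
  rw [IsHamiltonian] at *
  rw [conv_add_left, conv_add_right, add_add_add_comm, hg, hg', add_zero]

theorem IsHamiltonian.smul {g : TensorAlgebra K V →ₗ[K] V} (hg : IsHamiltonian ω g) (c : K) :
    IsHamiltonian ω (c • g) := by
  rw [IsHamiltonian] at *
  rw [conv_smul_left, conv_smul_right, ← smul_add, hg, smul_zero]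

theorem exists_harm_letters (H : IsHodge h𝒱 ω Q h) :
    Submodule.span K {x | numOp Q h x = 0 ∨ numOp Q h x = x} = ⊤ := by
  rw [eq_top_iff]
  rintro x -
  have hx : x = harm Q h x + numOp Q h x := by simp [harm]
  rw [hx]
  refine Submodule.add_mem _ (Submodule.subset_span (Or.inl ?_))
    (Submodule.subset_span (Or.inr ?_))
  · exact LinearMap.congr_fun H.numOp_harm x
  · exact LinearMap.congr_fun H.numOp_sq x

/-- Words in eigenletters are eigenvectors of the number operator. -/
theorem IsHodge.numCoder_word (H : IsHodge h𝒱 ω Q h) (n : ℕ) (o : ℕ → V)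
    (ho : ∀ i, numOp Q h (o i) = 0 ∨ numOp Q h (o i) = o i) :
    ∃ j ≤ n, numCoder h𝒱 Q h (word K n o) = (j : K) • word K n o ∧
      tmap (harm Q h) (word K n o) = if j = 0 then word K n o else 0 := by
  induction n generalizing o with
  | zero => exact ⟨0, le_rfl, by simp [IsHodge.numCoder_one], by simp⟩
  | succ n ih =>
    obtain ⟨j, hj, h1, h2⟩ := ih (fun i => o (i + 1)) fun i => ho (i + 1)
    rcases ho 0 with h0 | h0
    · refine ⟨j, by omega, ?_, ?_⟩
      · rw [word_succ, H.numCoder_mul, h1, h0]; simp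
      · rw [word_succ, map_mul, h2, tmap_ι]
        have : harm Q h (o 0) = o 0 := by simp [harm, h0]
        rw [this]
        split_ifs <;> simp
    · refine ⟨j + 1, by omega, ?_, ?_⟩
      · rw [word_succ, H.numCoder_mul, h1, h0]
        simp [add_smul]
      · rw [word_succ, map_mul, tmap_ι]
        have : harm Q h (o 0) = 0 := by simp [harm, h0]
        rw [this]
        simp

/-- On a word with `j` letters in the image of `N` and all others harmonic, the harmonic part of the
output has eigenvalue `j` and the complementary part `j + 1`. These lie in `0, …, n + 1`, and the
polynomial is one at `0` and zero at the other values, so only harmonic inputs with harmonic output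
survive. -/
theorem IsHodge.aeval_rootPoly [CharZero K] (H : IsHodge h𝒱 ω Q h)
    {g : TensorAlgebra K V →ₗ[K] V} {n : ℕ} (hg : g ∘ₗ proj n = g) :
    Polynomial.aeval (numEnd h𝒱 Q h) (rootPoly K (n + 1)) g =
      harm Q h ∘ₗ g ∘ₗ (tmap (harm Q h)).toLinearMap := by
  refine ext_words_of_span (Or.inl (map_zero _)) (exists_harm_letters H) fun k o ho => ?_
  obtain ⟨j, hj, h1, h2⟩ := H.numCoder_word k o ho
  set w := word K k o with hw
  have hP : ∀ f : TensorAlgebra K V →ₗ[K] V,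
      harm Q h (numEnd h𝒱 Q h f w) = (j : K) • harm Q h (f w) := by
    intro f
    have : harm Q h (numOp Q h (f w)) = 0 := LinearMap.congr_fun H.harm_numOp _
    simp [numEnd_apply, h1, this]
  have hS : ∀ f : TensorAlgebra K V →ₗ[K] V,
      numOp Q h (numEnd h𝒱 Q h f w) = ((j + 1 : ℕ) : K) • numOp Q h (f w) := by
    intro f
    have : numOp Q h (numOp Q h (f w)) = numOp Q h (f w) := LinearMap.congr_fun H.numOp_sq _
    simp [numEnd_apply, h1, this, add_smul, add_comm]
  have eP := apply_aeval_of_eigen (N := numEnd h𝒱 Q h)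
    (φ := harm Q h ∘ₗ LinearMap.applyₗ w) hP (rootPoly K (n + 1)) g
  have eS := apply_aeval_of_eigen (N := numEnd h𝒱 Q h)
    (φ := numOp Q h ∘ₗ LinearMap.applyₗ w) hS (rootPoly K (n + 1)) g
  simp only [LinearMap.comp_apply, LinearMap.applyₗ_apply_apply] at eP eS
  have hsum : ∀ x : V, x = harm Q h x + numOp Q h x := fun x => by simp [harm]
  rw [hsum (Polynomial.aeval (numEnd h𝒱 Q h) (rootPoly K (n + 1)) g w), eP, eS]
  simp only [LinearMap.comp_apply, AlgHom.toLinearMap_apply, h2]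
  have hgw : k ≠ n → g w = 0 := by
    intro hk
    rw [← hg, LinearMap.comp_apply, hw, proj_word, if_neg hk, map_zero]
  by_cases hk : k = n
  · subst hk
    rw [rootPoly_eval_nat (j := j + 1) (by omega) (by omega), zero_smul, add_zero]
    split_ifs with h0
    · subst h0; simp [rootPoly_eval_zero]
    · rw [rootPoly_eval_nat (by omega) (by omega)]; simp
  · rw [hgw hk]
    split_ifs <;> simp [hgw hk]

end Gauge

/-! ### Removing the nonharmonic part of one operation. -/

section Step

open TensorAlgebra

variable {K : Type u} [Field K] {V : Type v} [AddCommGroup V] [Module K V]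
  {𝒱 : ℤ → Submodule K V} {h𝒱 : DirectSum.IsInternal 𝒱} {ω : V →ₗ[K] V →ₗ[K] K}
  {Q h : Module.End K V}

theorem IsCyclicCoder.letter_one {D : Module.End K (TensorAlgebra K V)}
    (hD : IsCyclicCoder h𝒱 ω Q D) : (letter ∘ₗ D) 1 = 0 := by
  simp [hD.isCoder.map_one]

/-- The nonlinear part of the corestriction of a bar differential. -/
noncomputable def nonlin (Q : Module.End K V) (D : Module.End K (TensorAlgebra K V)) :
    TensorAlgebra K V →ₗ[K] V :=
  letter ∘ₗ D - Q ∘ₗ letter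

theorem IsCyclicCoder.nonlin_vanish {D : Module.End K (TensorAlgebra K V)}
    (hD : IsCyclicCoder h𝒱 ω Q D) : ∀ w ∈ wordsLE K V 1, nonlin Q D w = 0 := by
  refine eqOn_wordsLE (B := 0) fun k hk o => ?_
  rcases k with _ | _ | k
  · simp [nonlin, hD.isCoder.map_one]
  · simp [nonlin, word_one, hD.linear]
  · omega

theorem IsCyclicCoder.eq_add {D : Module.End K (TensorAlgebra K V)}
    (hD : IsCyclicCoder h𝒱 ω Q D) :
    D = oddCoder h𝒱 Q + coder (parity h𝒱) (nonlin Q D) := by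
  rw [oddCoder, ← coder_add, nonlin, add_sub_cancel]
  exact hD.isCoder.eq_coder

/-- The Maurer–Cartan equation. -/
theorem IsCyclicCoder.maurerCartan {D : Module.End K (TensorAlgebra K V)}
    (hD : IsCyclicCoder h𝒱 ω Q D) (hQ : Q * Q = 0) :
    Q ∘ₗ nonlin Q D + nonlin Q D ∘ₗ oddCoder h𝒱 Q =
      -(nonlin Q D ∘ₗ coder (parity h𝒱) (nonlin Q D)) := by
  refine LinearMap.ext fun w => ?_
  have h1 := congrArg letter (LinearMap.congr_fun hD.sq w)
  have hm : ∀ u, letter (D u) = Q (letter u) + nonlin Q D u := by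
    intro u; simp [nonlin]
  have h2 : letter (oddCoder h𝒱 Q w) = Q (letter w) :=
    LinearMap.congr_fun (letter_comp_oddCoder h𝒱 Q) w
  have h3 : letter (coder (parity h𝒱) (nonlin Q D) w) = nonlin Q D w :=
    LinearMap.congr_fun (letter_comp_coder _
      (hD.nonlin_vanish 1 (one_mem_wordsLE 1))) w
  have h4 : Q (Q (letter w)) = 0 := LinearMap.congr_fun hQ _
  have h5 := LinearMap.congr_fun hD.eq_add w
  rw [Module.End.mul_apply, hm, h5, LinearMap.add_apply, map_add, map_add, map_add, h2, h3, h4,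
    LinearMap.zero_apply, map_zero] at h1
  simp only [LinearMap.add_apply, LinearMap.comp_apply, LinearMap.neg_apply]
  rw [← sub_eq_zero, sub_neg_eq_add, ← h1]
  abel

/-- Truncation of a corestriction to arities less than `n`. -/
noncomputable def truncate (n : ℕ) (μ : TensorAlgebra K V →ₗ[K] V) :
    TensorAlgebra K V →ₗ[K] V :=
  μ ∘ₗ ∑ k ∈ Finset.range n, proj k

theorem truncate_apply {n : ℕ} (μ : TensorAlgebra K V →ₗ[K] V) {w : TensorAlgebra K V}
    (hw : w ∈ wordsLE K V n) : truncate (n + 1) μ w = μ w := by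
  rw [truncate, LinearMap.comp_apply, LinearMap.sum_apply, sum_proj_apply_of_mem n w hw]

theorem truncate_vanish {n : ℕ} {μ : TensorAlgebra K V →ₗ[K] V}
    (hμ : ∀ w ∈ wordsLE K V 1, μ w = 0) : ∀ w ∈ wordsLE K V 1, truncate n μ w = 0 := by
  refine eqOn_wordsLE (B := 0) fun k hk o => ?_
  rw [truncate, LinearMap.comp_apply, LinearMap.sum_apply, map_sum, Finset.sum_eq_zero]
  · rfl
  · intro j _
    rw [proj_word]
    split_ifs
    · exact hμ _ (word_mem_wordsLE hk o)
    · exact map_zero _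

/-- No unary part means the inner insertion shortens the word, so the outer operation has arity at
most `n`. An inner operation of arity `n + 1` would leave one letter, which the outer one kills. -/
theorem comp_coder_truncate {n : ℕ} (ρ : V →ₗ[K] V) {μ : TensorAlgebra K V →ₗ[K] V}
    (hμ : ∀ w ∈ wordsLE K V 1, μ w = 0) : ∀ w ∈ wordsLE K V (n + 1),
      μ (coder ρ μ w) = truncate (n + 1) μ (coder ρ (truncate (n + 1) μ) w) := by
  intro w hw
  have h1 : coder ρ μ w = coder ρ (truncate (n + 1) μ) w +
      coder ρ (μ - truncate (n + 1) μ) w := by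
    rw [← LinearMap.add_apply, ← coder_add, add_sub_cancel]
  have h2 : coder ρ (μ - truncate (n + 1) μ) w = ι K ((μ - truncate (n + 1) μ) w) :=
    coder_eq_ι_of_vanish ρ (n := n) (fun w hw => by
      rw [LinearMap.sub_apply, truncate_apply μ hw, sub_self]) w hw
  rw [← truncate_apply μ (coder_mem_wordsLE_pred ρ hμ w hw), h1, map_add, h2,
    truncate_vanish hμ _ (ι_mem_wordsLE le_rfl _), add_zero]

theorem IsSplitUpTo.truncate_eq {D : Module.End K (TensorAlgebra K V)}
    (hD : IsCyclicCoder h𝒱 ω Q D) {P : Module.End K V} {n : ℕ} (hs : IsSplitUpTo P D n) :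
    truncate (n + 1) (nonlin Q D) =
      P ∘ₗ truncate (n + 1) (nonlin Q D) ∘ₗ (tmap P).toLinearMap := by
  refine ext_words fun k o => ?_
  have hp : ∀ o' : ℕ → V, truncate (n + 1) (nonlin Q D) (word K k o') =
      if k ≤ n then nonlin Q D (word K k o') else 0 := by
    intro o'
    split_ifs with hk
    · exact truncate_apply _ (word_mem_wordsLE hk _)
    · rw [truncate, LinearMap.comp_apply, LinearMap.sum_apply, Finset.sum_eq_zero,
        map_zero]
      intro j hj
      have := Finset.mem_range.1 hj
      rw [proj_word, if_neg (by omega)]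
  simp only [LinearMap.comp_apply, AlgHom.toLinearMap_apply, tmap_word, hp]
  split_ifs with hk
  · by_cases h2 : 2 ≤ k
    · have h := hs k h2 hk o
      have hk1 : k ≠ 1 := by omega
      rw [tmap_word] at h
      simpa [nonlin, letter_word, hk1] using h
    · rw [hD.nonlin_vanish _ (word_mem_wordsLE (by omega) _),
        hD.nonlin_vanish _ (word_mem_wordsLE (by omega) _), map_zero]
  · simp

/-- If `κ` factors through the harmonic projection, then `κ ∘ κ̂` is annihilated by the
coderivation extending the homotopy. -/
theorem IsHodge.comp_coder_comp_oddCoder (H : IsHodge h𝒱 ω Q h)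
    {κ : TensorAlgebra K V →ₗ[K] V}
    (hκ : κ = harm Q h ∘ₗ κ ∘ₗ (tmap (harm Q h)).toLinearMap) :
    κ ∘ₗ coder (parity h𝒱) κ ∘ₗ oddCoder h𝒱 h = 0 := by
  set Pt := (tmap (harm Q h)).toLinearMap with hPt
  have hPh : Pt ∘ₗ oddCoder h𝒱 h = 0 := H.tmap_harm_comp_oddCoder
  have hκh : κ ∘ₗ oddCoder h𝒱 h = 0 := by
    rw [hκ, LinearMap.comp_assoc, LinearMap.comp_assoc, hPh, LinearMap.comp_zero,
      LinearMap.comp_zero]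
  have hc := (isCoder_oddCoder h𝒱 h).conv_comp (mulT (K := K) (V := V))
  -- The homotopy hits either a letter outside the inserted block, which is then killed by `P`, or
  -- an input of `κ`, which is killed because `κ` absorbs `P`.
  have key : Pt ∘ₗ coder (parity h𝒱) κ ∘ₗ oddCoder h𝒱 h = 0 := by
    rw [← LinearMap.comp_assoc, coder, tmap_comp_conv, tmap_comp_conv, hc, hc, ← hPt]
    have e1 : (Pt ∘ₗ (tmap (parity h𝒱)).toLinearMap) ∘ₗ oddCoder h𝒱 h = 0 := by
      have : (tmap (parity h𝒱)).toLinearMap ∘ₗ oddCoder h𝒱 h =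
          -(oddCoder h𝒱 h ∘ₗ (tmap (parity h𝒱)).toLinearMap) :=
        (hasWeight_oddCoder h𝒱 H.h_weight).parity_odd (by decide)
      rw [LinearMap.comp_assoc, this, LinearMap.comp_neg, ← LinearMap.comp_assoc, hPh,
        LinearMap.zero_comp, neg_zero]
    have e2 : (Pt ∘ₗ ι K ∘ₗ κ) ∘ₗ oddCoder h𝒱 h = 0 := by
      rw [LinearMap.comp_assoc, LinearMap.comp_assoc, hκh, LinearMap.comp_zero,
        LinearMap.comp_zero]
    rw [e1, e2, LinearMap.comp_id, hPh, conv_zero_left, conv_zero_left, conv_zero_right, add_zero,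
      conv_zero_right, add_zero]
  refine LinearMap.ext fun w => ?_
  have h1 := LinearMap.congr_fun hκ (coder (parity h𝒱) κ (oddCoder h𝒱 h w))
  have h2 := LinearMap.congr_fun key w
  simp only [LinearMap.comp_apply, LinearMap.zero_apply] at h1 h2 ⊢
  rw [h1, h2, map_zero, map_zero]

/-- The infinitesimal gauge transformation splitting off the operation of arity `n + 1`. -/
theorem IsHodge.exists_gauge [CharZero K] (H : IsHodge h𝒱 ω Q h)
    {D : Module.End K (TensorAlgebra K V)} (hD : IsCyclicCoder h𝒱 ω Q D) {n : ℕ} (hn : 1 ≤ n)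
    (hs : IsSplitUpTo (harm Q h) D n) :
    ∃ g : TensorAlgebra K V →ₗ[K] V, HasWeight (tscaling h𝒱) (scaling h𝒱) 0 g ∧
      g ∘ₗ proj (n + 1) = g ∧ IsHamiltonian ω g ∧
      ∀ o, Q (g (word K (n + 1) o)) - g (oddCoder h𝒱 Q (word K (n + 1) o)) =
        letter (D (word K (n + 1) o)) -
          harm Q h (letter (D (tmap (harm Q h) (word K (n + 1) o)))) := by
  -- `g₀` is the operation of arity `n + 1`, and `c` is the quadratic Maurer–Cartan term, in which
  -- only the already split operations occur.
  set g₀ : TensorAlgebra K V →ₗ[K] V := (letter ∘ₗ D) ∘ₗ proj (n + 1) with hg₀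
  set c : TensorAlgebra K V →ₗ[K] V := -(truncate (n + 1) (nonlin Q D) ∘ₗ
    coder (parity h𝒱) (truncate (n + 1) (nonlin Q D)) ∘ₗ proj (n + 1)) with hc
  have hproj : proj (K := K) (V := V) (n + 1) ∘ₗ proj (n + 1) = proj (n + 1) := by
    refine ext_words fun k o => ?_
    rw [LinearMap.comp_apply, proj_word]
    split_ifs with hk
    · rw [proj_word, if_pos hk]
    · simp
  have hg₀p : g₀ ∘ₗ proj (n + 1) = g₀ := by rw [hg₀, LinearMap.comp_assoc, hproj]
  have hprojw : HasWeight (tscaling h𝒱) (tscaling h𝒱) 0 (proj (K := K) (V := V) (n + 1)) := by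
    intro r _
    rw [zpow_zero, one_smul, tscaling, proj_comp_tmap]
  have hg₀w : HasWeight (tscaling h𝒱) (scaling h𝒱) 1 g₀ :=
    ((hasWeight_letter h𝒱).comp_eq hD.weight (zero_add 1)).comp_eq hprojw (add_zero 1)
  have hcyc : conv ω g₀ letter + conv ω (parity h𝒱 ∘ₗ letter) g₀ = 0 := by
    have h1 := hD.form
    rw [pairing, hD.isCoder.conv_comp, tscaling, letter_comp_tmap] at h1
    have h2 := conv_proj_letter ω (letter ∘ₗ D) LinearMap.id (n + 1)
    rw [LinearMap.id_comp] at h2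
    rw [hg₀, h2, conv_letter_proj, ← LinearMap.add_comp, h1, LinearMap.zero_comp]
  have hQp : proj (n + 1) ∘ₗ oddCoder h𝒱 Q = oddCoder h𝒱 Q ∘ₗ proj (n + 1) :=
    proj_comp_coder_letter _ _ _
  have hhp : proj (n + 1) ∘ₗ oddCoder h𝒱 h = oddCoder h𝒱 h ∘ₗ proj (n + 1) :=
    proj_comp_coder_letter _ _ _
  have hlp : letter ∘ₗ proj (n + 1) = (0 : TensorAlgebra K V →ₗ[K] V) := by
    refine ext_words fun k o => ?_
    rw [LinearMap.comp_apply, proj_word]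
    split_ifs with hk
    · rw [letter_word, if_neg (by omega)]; rfl
    · simp
  have hg₀n : g₀ = nonlin Q D ∘ₗ proj (n + 1) := by
    rw [nonlin, LinearMap.sub_comp, LinearMap.comp_assoc (proj (n + 1)) letter Q, hlp,
      LinearMap.comp_zero, sub_zero]
  have hmc : Q ∘ₗ g₀ + g₀ ∘ₗ oddCoder h𝒱 Q = c := by
    have h1 := congrArg (fun φ => φ ∘ₗ proj (n + 1)) (hD.maurerCartan H.Q_sq)
    simp only [LinearMap.add_comp, LinearMap.comp_assoc, LinearMap.neg_comp] at h1
    rw [hg₀n, LinearMap.comp_assoc, hQp, h1, hc]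
    congr 1
    refine ext_words fun k o => ?_
    simp only [LinearMap.comp_apply, proj_word]
    split_ifs with hk
    · exact comp_coder_truncate _ hD.nonlin_vanish _ (word_mem_wordsLE hk.le o)
    · simp
  have hsplit := hs.truncate_eq hD
  have hc1 : h ∘ₗ c = 0 := by
    have h1 : h ∘ₗ harm Q h = 0 := H.h_harm
    have h2 : h ∘ₗ truncate (n + 1) (nonlin Q D) = 0 := by
      rw [hsplit, ← LinearMap.comp_assoc, h1, LinearMap.zero_comp]
    rw [hc, LinearMap.comp_neg, ← LinearMap.comp_assoc, h2, LinearMap.zero_comp, neg_zero]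
  have hc2 : c ∘ₗ oddCoder h𝒱 h = 0 := by
    have h1 := congrArg (fun φ => φ ∘ₗ proj (n + 1)) (H.comp_coder_comp_oddCoder hsplit)
    simp only [LinearMap.zero_comp, LinearMap.comp_assoc] at h1
    rw [hc, LinearMap.neg_comp, LinearMap.comp_assoc, LinearMap.comp_assoc, hhp, h1, neg_zero]
  -- In arity `n + 1` the number operator has eigenvalues up to `n + 2`: one for each input and one
  -- for the output.
  obtain ⟨r, hr⟩ := exists_rootPoly_eq (K := K) (n + 1 + 1)
  set E := hEnd h𝒱 h g₀ with hE
  refine ⟨Polynomial.aeval (numEnd h𝒱 Q h) r E, ?_, ?_, ?_, ?_⟩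
  · refine aeval_induction (numEnd h𝒱 Q h) (C := HasWeight (tscaling h𝒱) (scaling h𝒱) 0)
      (fun _ _ => HasWeight.add) (fun c _ hx => hx.smul c) (fun x hx => ?_) r ?_
    · exact (H.numOp_weight.comp_eq hx (add_zero 0)).add
        (hx.comp_eq H.numCoder_weight (add_zero 0))
    · exact (H.h_weight.comp_eq hg₀w (by norm_num)).sub
        (hg₀w.comp_eq (hasWeight_oddCoder h𝒱 H.h_weight) (by norm_num))
  · refine aeval_induction (numEnd h𝒱 Q h) (C := fun g => g ∘ₗ proj (n + 1) = g)
      (fun x y hx hy => ?_) (fun c x hx => ?_) (fun x hx => ?_) r ?_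
    · rw [LinearMap.add_comp, hx, hy]
    · rw [LinearMap.smul_comp, hx]
    · rw [numEnd_apply, LinearMap.add_comp, LinearMap.comp_assoc, hx, LinearMap.comp_assoc,
        ← IsHodge.proj_comp_numCoder, ← LinearMap.comp_assoc, hx]
    · rw [hE, hEnd, LinearMap.sub_comp, LinearMap.comp_assoc (proj (n + 1)) g₀ h, hg₀p,
        LinearMap.comp_assoc (proj (n + 1)) (oddCoder h𝒱 h) g₀, ← hhp,
        ← LinearMap.comp_assoc (oddCoder h𝒱 h) (proj (n + 1)) g₀, hg₀p]
  · exact aeval_induction (numEnd h𝒱 Q h) (C := IsHamiltonian ω) (fun _ _ => IsHamiltonian.add)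
      (fun c _ hx => hx.smul c) (fun _ => H.isHamiltonian_numEnd) r
      (H.isHamiltonian_hEnd hg₀w hcyc)
  · intro o
    -- The differential commutes with `r(𝒩)`, so `d (r(𝒩) E) = r(𝒩) 𝒩 g₀ = g₀ - rootPoly(𝒩) g₀`, and
    -- the last term is the harmonic part of `g₀`.
    have h1 := comm_aeval H.commute_dEnd_numEnd r E
    rw [hE, dEnd_hEnd hmc hc1 hc2] at h1
    have h2 : Polynomial.aeval (numEnd h𝒱 Q h) r (numEnd h𝒱 Q h g₀) =
        Polynomial.aeval (numEnd h𝒱 Q h) (Polynomial.X * r) g₀ := by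
      rw [mul_comm, map_mul, Polynomial.aeval_X, Module.End.mul_apply]
    rw [h2, ← hr, map_sub, map_one, LinearMap.sub_apply, H.aeval_rootPoly hg₀p,
      Module.End.one_apply] at h1
    have h3 := LinearMap.congr_fun h1 (word K (n + 1) o)
    rw [dEnd_apply] at h3
    simp only [LinearMap.sub_apply, LinearMap.comp_apply, AlgHom.toLinearMap_apply, hg₀,
      proj_word_self, tmap_word] at h3
    rw [tmap_word]
    exact h3

end Step

/-! ### Iterating the gauge transformations and passing to the limit. -/

section Decomposition

open TensorAlgebra TensorProduct

variable {K : Type u} [Field K] {V : Type v} [AddCommGroup V] [Module K V]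
  {𝒱 : ℤ → Submodule K V} {h𝒱 : DirectSum.IsInternal 𝒱} {ω : V →ₗ[K] V →ₗ[K] K}
  {Q h : Module.End K V}

/-- A pair of mutually inverse coalgebra automorphisms of degree zero preserving `ω`, with
identity linear part. -/
structure IsGauge (h𝒱 : DirectSum.IsInternal 𝒱) (ω : V →ₗ[K] V →ₗ[K] K)
    (F G : Module.End K (TensorAlgebra K V)) : Prop where
  coalg : IsCoalgMap F
  coalg' : IsCoalgMap G
  mul_eq : F * G = 1
  mul_eq' : G * F = 1
  weight : HasWeight (tscaling h𝒱) (tscaling h𝒱) 0 F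
  weight' : HasWeight (tscaling h𝒱) (tscaling h𝒱) 0 G
  form : pairing ω ∘ₗ F = pairing ω
  linear : ∀ x, F (ι K x) = ι K x

theorem isGauge_id : IsGauge h𝒱 ω (LinearMap.id) (LinearMap.id) :=
  ⟨isCoalgMap_id, isCoalgMap_id, rfl, rfl, hasWeight_id, hasWeight_id, rfl, fun _ => rfl⟩

theorem IsGauge.linear' {F G : Module.End K (TensorAlgebra K V)} (hF : IsGauge h𝒱 ω F G) (x : V) :
    G (ι K x) = ι K x := by
  conv_lhs => rw [← hF.linear x]
  exact LinearMap.congr_fun hF.mul_eq' _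

theorem IsGauge.comp {F G F' G' : Module.End K (TensorAlgebra K V)} (hF : IsGauge h𝒱 ω F G)
    (hF' : IsGauge h𝒱 ω F' G') : IsGauge h𝒱 ω (F' * F) (G * G') where
  coalg := hF'.coalg.comp hF.coalg
  coalg' := hF.coalg'.comp hF'.coalg'
  mul_eq := by rw [mul_assoc, ← mul_assoc F, hF.mul_eq, one_mul, hF'.mul_eq]
  mul_eq' := by rw [mul_assoc, ← mul_assoc G', hF'.mul_eq', one_mul, hF.mul_eq']
  weight := hF'.weight.comp_eq hF.weight (add_zero 0)
  weight' := hF.weight'.comp_eq hF'.weight' (add_zero 0)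
  form := by rw [Module.End.mul_eq_comp, ← LinearMap.comp_assoc, hF'.form, hF.form]
  linear x := by rw [Module.End.mul_apply, hF.linear, hF'.linear]

theorem IsCyclicCoder.apply_ι {D : Module.End K (TensorAlgebra K V)}
    (hD : IsCyclicCoder h𝒱 ω Q D) (x : V) : D (ι K x) = ι K (Q x) := by
  have h0 : ∀ w ∈ wordsLE K V 0, (letter ∘ₗ D) w = 0 := by
    refine eqOn_wordsLE (B := 0) fun k hk o => ?_
    obtain rfl : k = 0 := by omega
    simp [hD.isCoder.map_one]
  have e := LinearMap.congr_fun hD.isCoder.eq_coder (ι K x)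
  rw [e, coder_eq_ι_of_vanish _ h0 _ (ι_mem_wordsLE le_rfl x), LinearMap.comp_apply, hD.linear]

theorem IsCyclicCoder.mem_wordsLE {D : Module.End K (TensorAlgebra K V)}
    (hD : IsCyclicCoder h𝒱 ω Q D) {n : ℕ} : ∀ w ∈ wordsLE K V n, D w ∈ wordsLE K V n := by
  rw [hD.isCoder.eq_coder]
  exact coder_mem_wordsLE _ hD.letter_one

theorem IsCyclicCoder.conj {D F G : Module.End K (TensorAlgebra K V)}
    (hD : IsCyclicCoder h𝒱 ω Q D) (hF : IsGauge h𝒱 ω F G) :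
    IsCyclicCoder h𝒱 ω Q (F * D * G) where
  isCoder := hD.isCoder.conj hF.coalg hF.coalg' hF.mul_eq
    (hF.weight.parity_even (-1) (by simp)).symm
  weight := (hF.weight.comp_eq hD.weight (zero_add 1)).comp_eq hF.weight' (add_zero 1)
  sq := by
    rw [mul_assoc, mul_assoc, ← mul_assoc G, ← mul_assoc G, hF.mul_eq', one_mul, ← mul_assoc D,
      hD.sq, zero_mul, mul_zero]
  form := by
    rw [mul_assoc, Module.End.mul_eq_comp, ← LinearMap.comp_assoc, hF.form,
      Module.End.mul_eq_comp, ← LinearMap.comp_assoc, hD.form, LinearMap.zero_comp]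
  linear x := by
    rw [Module.End.mul_apply, Module.End.mul_apply, hF.linear', hD.apply_ι, hF.linear, letter_ι]

/-- For an even coderivation the Hamiltonian condition says precisely that the pairing is
annihilated, so every term of the exponential beyond the first disappears under the pairing. -/
theorem isGauge_locExp [CharZero K] {g : TensorAlgebra K V →ₗ[K] V}
    (hw : HasWeight (tscaling h𝒱) (scaling h𝒱) 0 g) (hg : ∀ w ∈ wordsLE K V 1, g w = 0)
    (hg' : IsHamiltonian ω g) :
    IsGauge h𝒱 ω (locExp (coder LinearMap.id g)) (locExp (-coder LinearMap.id g)) := by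
  have hS := shortens_coder LinearMap.id hg
  have hid : (tmap (LinearMap.id : V →ₗ[K] V)).toLinearMap = LinearMap.id := by
    rw [tmap_id]; rfl
  have hg1 : g 1 = 0 := hg 1 (one_mem_wordsLE 1)
  have hC : IsCoder LinearMap.id (coder LinearMap.id g) := by
    have := isCoder_coder LinearMap.id hg1
    rwa [hid] at this
  have hC' : IsCoder LinearMap.id (-coder LinearMap.id g) := by
    have := isCoder_coder LinearMap.id (g := -g) (by simp [hg1])
    rwa [hid, coder_neg] at this
  have hW := hasWeight_coder h𝒱 (ρ := LinearMap.id) hasWeight_id hw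
  refine ⟨isCoalgMap_locExp hS hC, isCoalgMap_locExp hS.neg hC', locExp_mul_neg hS,
    locExp_neg_mul hS, hasWeight_locExp h𝒱 hS hW, hasWeight_locExp h𝒱 hS.neg hW.neg,
    comp_locExp hS ?_, fun x => locExp_eq_self le_rfl hg _ _ (ι_mem_wordsLE le_rfl x)⟩
  rw [pairing, hC.conv_comp, letter_comp_coder _ hg1, LinearMap.comp_id]
  exact hg'

theorem IsHodge.exists_gauge_step [CharZero K] (H : IsHodge h𝒱 ω Q h)
    {D F G : Module.End K (TensorAlgebra K V)} (hD : IsCyclicCoder h𝒱 ω Q D)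
    (hF : IsGauge h𝒱 ω F G) {n : ℕ} (hn : 1 ≤ n)
    (hs : IsSplitUpTo (harm Q h) (F * D * G) n) :
    ∃ F' G', IsGauge h𝒱 ω F' G' ∧ IsSplitUpTo (harm Q h) (F' * D * G') (n + 1) ∧
      ∀ w ∈ wordsLE K V n, F' w = F w ∧ G' w = G w := by
  have hD₁ := hD.conj hF
  obtain ⟨g, hgw, hgp, hgH, hgd⟩ := H.exists_gauge hD₁ hn hs
  have hg0 : ∀ w ∈ wordsLE K V n, g w = 0 := fun w hw => by
    rw [← hgp, LinearMap.comp_apply, proj_apply_of_mem (Nat.lt_succ_self n) w hw, map_zero]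
  have hg0' : ∀ w ∈ wordsLE K V n, (-g) w = 0 := fun w hw => by simp [hg0 w hw]
  have hE := isGauge_locExp hgw (fun w hw => hg0 w (wordsLE_mono hn hw)) hgH
  set E := locExp (coder LinearMap.id g) with hEdef
  set E' := locExp (-coder LinearMap.id g) with hEdef'
  have hE1 : ∀ w ∈ wordsLE K V n, E w = w := locExp_eq_self hn hg0 _
  have hE1' : ∀ w ∈ wordsLE K V n, E' w = w := by
    rw [hEdef', ← coder_neg]
    exact locExp_eq_self hn hg0' _
  have hE2 : ∀ w ∈ wordsLE K V (n + 1), E w = w + ι K (g w) := locExp_eq_add hn hg0 _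
  have hE2' : ∀ w ∈ wordsLE K V (n + 1), E' w = w - ι K (g w) := by
    intro w hw
    rw [hEdef', ← coder_neg, locExp_eq_add hn hg0' _ w hw]
    simp [sub_eq_add_neg]
  refine ⟨E * F, G * E', hF.comp hE, ?_, fun w hw => ⟨?_, ?_⟩⟩
  · have hconj : E * F * D * (G * E') = E * (F * D * G) * E' := by simp only [mul_assoc]
    rw [hconj]
    set D₁ := F * D * G with hD₁def
    have hlow : ∀ w ∈ wordsLE K V n, (E * D₁ * E') w = D₁ w := by
      intro w hw
      rw [Module.End.mul_apply, Module.End.mul_apply, hE1' w hw, hE1 _ (hD₁.mem_wordsLE w hw)]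
    -- In length `n + 1` conjugation changes the corestriction by `g (D₁ w) - Q (g w)`, which is
    -- `-(d g) w` and so removes the nonharmonic part.
    have htop : ∀ o : ℕ → V, letter ((E * D₁ * E') (word K (n + 1) o)) =
        harm Q h (letter (D₁ (tmap (harm Q h) (word K (n + 1) o)))) := by
      intro o
      set w := word K (n + 1) o with hwdef
      have hw : w ∈ wordsLE K V (n + 1) := word_mem_wordsLE le_rfl o
      -- The nonlinear part of `D₁` shortens `w` to length at most `n`, where `g` vanishes.
      have hgD : g (D₁ w) = g (oddCoder h𝒱 Q w) := by
        have h1 := LinearMap.congr_fun hD₁.eq_add w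
        rw [h1, LinearMap.add_apply, map_add,
          hg0 _ (coder_mem_wordsLE_pred _ hD₁.nonlin_vanish w hw), add_zero]
      have hd := hgd o
      rw [Module.End.mul_apply, Module.End.mul_apply, hE2' w hw, map_sub, hD₁.apply_ι, map_sub,
        hE2 _ (hD₁.mem_wordsLE w hw), hE.linear, map_sub, map_add, letter_ι, letter_ι, hgD]
      rw [← hwdef] at hd
      rw [add_sub_assoc, ← neg_sub (Q (g w)), hd]
      abel
    intro k hk2 hk o
    rcases Nat.lt_or_ge n k with hnk | hnk
    · obtain rfl : k = n + 1 := by omega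
      rw [htop, tmap_word, htop, tmap_word]
      have hPP : ∀ x, harm Q h (harm Q h x) = harm Q h x := LinearMap.congr_fun H.harm_sq
      simp only [hPP]
    · rw [hlow _ (word_mem_wordsLE hnk o), tmap_word, hlow _ (word_mem_wordsLE hnk _),
        hs k hk2 hnk o, tmap_word]
  · rw [Module.End.mul_apply, hE1 _ (hF.coalg.mem_wordsLE w hw)]
  · rw [Module.End.mul_apply, hE1' w hw]

/-- The limit of a sequence of endomorphisms stabilizing on short words. -/
noncomputable def wordLimit (F : ℕ → Module.End K (TensorAlgebra K V)) :
    Module.End K (TensorAlgebra K V) :=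
  ofFamily fun n => (F n).compMultilinearMap (tprod K V n)

theorem wordLimit_apply {F : ℕ → Module.End K (TensorAlgebra K V)}
    (hF : ∀ n, ∀ w ∈ wordsLE K V n, F (n + 1) w = F n w) (n : ℕ) :
    ∀ w ∈ wordsLE K V n, wordLimit F w = F n w := by
  refine eqOn_wordsLE fun k hk o => ?_
  rw [wordLimit, ofFamily_word]
  change F k (word K k o) = _
  induction n, hk using Nat.le_induction with
  | base => rfl
  | succ n hkn ih => rw [ih, hF n _ (word_mem_wordsLE hkn o)]

/-- Each condition can be tested on words of bounded length. There the limit agrees with a single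
stage, and all maps involved preserve the bound. -/
theorem isGauge_wordLimit {F G : ℕ → Module.End K (TensorAlgebra K V)}
    (hFG : ∀ n, IsGauge h𝒱 ω (F n) (G n))
    (hF : ∀ n, ∀ w ∈ wordsLE K V n, F (n + 1) w = F n w)
    (hG : ∀ n, ∀ w ∈ wordsLE K V n, G (n + 1) w = G n w) :
    IsGauge h𝒱 ω (wordLimit F) (wordLimit G) := by
  have coalg : ∀ A : ℕ → Module.End K (TensorAlgebra K V), (∀ n, IsCoalgMap (A n)) →
      (∀ n, ∀ w ∈ wordsLE K V n, A (n + 1) w = A n w) → IsCoalgMap (wordLimit A) := by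
    intro A hA hs
    have hl := wordLimit_apply hs
    refine isCoalgMap_of_conv ?_ (ext_wordsLE fun n w hw => ?_) (ext_wordsLE fun n w hw => ?_)
    · rw [hl 0 1 (one_mem_wordsLE 0), (hA 0).map_one]
    · rw [LinearMap.comp_apply, hl n w hw]
      exact LinearMap.congr_fun (hA n).counit_comp w
    · rw [LinearMap.comp_apply, hl n w hw, conv_eqOn _ (hl n) (hl n) w hw, ← map_comp_comul]
      exact LinearMap.congr_fun (hA n).comul_comp w
  have weight : ∀ A : ℕ → Module.End K (TensorAlgebra K V),
      (∀ n, HasWeight (tscaling h𝒱) (tscaling h𝒱) 0 (A n)) →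
      (∀ n, ∀ w ∈ wordsLE K V n, A (n + 1) w = A n w) →
      HasWeight (tscaling h𝒱) (tscaling h𝒱) 0 (wordLimit A) := by
    intro A hA hs c hc
    have hl := wordLimit_apply hs
    refine ext_wordsLE fun n w hw => ?_
    rw [LinearMap.comp_apply, LinearMap.smul_apply, LinearMap.comp_apply, hl n w hw,
      hl n (tscaling h𝒱 c w) (tmap_mem_wordsLE _ w hw)]
    exact LinearMap.congr_fun (hA n c hc) w
  have hlF := wordLimit_apply hF
  have hlG := wordLimit_apply hG
  refine ⟨coalg F (fun n => (hFG n).coalg) hF, coalg G (fun n => (hFG n).coalg') hG,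
    ext_wordsLE fun n w hw => ?_, ext_wordsLE fun n w hw => ?_,
    weight F (fun n => (hFG n).weight) hF, weight G (fun n => (hFG n).weight') hG,
    ext_wordsLE fun n w hw => ?_, fun x => ?_⟩
  · rw [Module.End.mul_apply, hlG n w hw, hlF n _ ((hFG n).coalg'.mem_wordsLE w hw)]
    exact LinearMap.congr_fun (hFG n).mul_eq w
  · rw [Module.End.mul_apply, hlF n w hw, hlG n _ ((hFG n).coalg.mem_wordsLE w hw)]
    exact LinearMap.congr_fun (hFG n).mul_eq' w
  · rw [LinearMap.comp_apply, hlF n w hw]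
    exact LinearMap.congr_fun (hFG n).form w
  · rw [hlF 1 _ (ι_mem_wordsLE le_rfl x), (hFG 1).linear]

/-- Every cyclic bar differential admitting a compatible Hodge decomposition is conjugate to a
split one. -/
theorem IsHodge.exists_gauge_split [CharZero K] (H : IsHodge h𝒱 ω Q h)
    {D : Module.End K (TensorAlgebra K V)} (hD : IsCyclicCoder h𝒱 ω Q D) :
    ∃ F G, IsGauge h𝒱 ω F G ∧ ∀ n, IsSplitUpTo (harm Q h) (F * D * G) n := by
  -- Stage `n` is split up to arity `n + 1`; being split up to arity `1` is vacuous, so the identity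
  -- starts the recursion.
  let C : ℕ → Type _ := fun n => {p : Module.End K (TensorAlgebra K V) ×
    Module.End K (TensorAlgebra K V) //
      IsGauge h𝒱 ω p.1 p.2 ∧ IsSplitUpTo (harm Q h) (p.1 * D * p.2) (n + 1)}
  have step : ∀ n (p : C n), ∃ q : C (n + 1), ∀ w ∈ wordsLE K V (n + 1),
      q.1.1 w = p.1.1 w ∧ q.1.2 w = p.1.2 w := by
    rintro n ⟨⟨F, G⟩, hFG, hs⟩
    obtain ⟨F', G', h1, h2, h3⟩ := H.exists_gauge_step hD hFG (by omega) hs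
    exact ⟨⟨(F', G'), h1, h2⟩, h3⟩
  choose next hnext using step
  let s : ∀ n, C n := fun n => Nat.rec ⟨(LinearMap.id, LinearMap.id), isGauge_id, by
    intro k hk hk' o; change k ≤ 0 + 1 at hk'; omega⟩ next n
  have hF : ∀ n, ∀ w ∈ wordsLE K V n, (s (n + 1)).1.1 w = (s n).1.1 w := fun n w hw =>
    (hnext n (s n) w (wordsLE_mono (Nat.le_succ n) hw)).1
  have hG : ∀ n, ∀ w ∈ wordsLE K V n, (s (n + 1)).1.2 w = (s n).1.2 w := fun n w hw =>
    (hnext n (s n) w (wordsLE_mono (Nat.le_succ n) hw)).2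
  refine ⟨wordLimit fun n => (s n).1.1, wordLimit fun n => (s n).1.2,
    isGauge_wordLimit (fun n => (s n).2.1) hF hG, fun n k hk hkn o => ?_⟩
  have key : ∀ w ∈ wordsLE K V n, ((wordLimit fun n => (s n).1.1) * D *
      (wordLimit fun n => (s n).1.2)) w = ((s n).1.1 * D * (s n).1.2) w := by
    intro w hw
    simp only [Module.End.mul_apply]
    rw [wordLimit_apply hG n w hw, wordLimit_apply hF n]
    exact hD.mem_wordsLE _ ((s n).2.1.coalg'.mem_wordsLE w hw)
  rw [tmap_word, key _ (word_mem_wordsLE hkn _), key _ (word_mem_wordsLE hkn _), ← tmap_word]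
  exact (s n).2.2 k hk (by omega) o

end Decomposition

/-! ### Existence of Hodge data, from a compatible homotopy or from finite dimensionality. -/

section ExistsHodge

variable {K : Type u} [Field K] {V : Type v} [AddCommGroup V] [Module K V]
  {𝒱 : ℤ → Submodule K V}

/-- A differential compatible with an odd symplectic form. -/
structure IsSymplecticDifferential (h𝒱 : DirectSum.IsInternal 𝒱) (ω : V →ₗ[K] V →ₗ[K] K)
    (Q : Module.End K V) : Prop where
  Q_weight : HasWeight (scaling h𝒱) (scaling h𝒱) 1 Q
  Q_sq : Q * Q = 0
  ω_Q : ∀ x y, ω (Q x) y = -ω (parity h𝒱 x) (Q y)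
  ω_degree : ∀ a b x y, x ∈ 𝒱 a → y ∈ 𝒱 b → a + b ≠ 1 → ω x y = 0
  ω_skew : ∀ x y, ω y x = -ω x y
  ω_nondegenerate : ∀ x, x ≠ 0 → ∃ y, ω x y ≠ 0

/-- `B` is the graded adjoint of the odd operator `A`. -/
def IsOddAdjoint (h𝒱 : DirectSum.IsInternal 𝒱) (ω : V →ₗ[K] V →ₗ[K] K) (A B : Module.End K V) :
    Prop := ∀ x y, ω (A x) y = ω (parity h𝒱 x) (B y)

namespace IsOddAdjoint

variable {h𝒱 : DirectSum.IsInternal 𝒱} {ω : V →ₗ[K] V →ₗ[K] K} {A B A' B' C C' : Module.End K V}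

theorem add (h : IsOddAdjoint h𝒱 ω A B) (h' : IsOddAdjoint h𝒱 ω A' B') :
    IsOddAdjoint h𝒱 ω (A + A') (B + B') := by
  intro x y
  simp [h x y, h' x y]

theorem smul (h : IsOddAdjoint h𝒱 ω A B) (c : K) : IsOddAdjoint h𝒱 ω (c • A) (c • B) := by
  intro x y
  simp [h x y]

theorem triple (hA : IsOddAdjoint h𝒱 ω A A') (hB : IsOddAdjoint h𝒱 ω B B')
    (hC : IsOddAdjoint h𝒱 ω C C') (hτ : ∀ x, parity h𝒱 (B x) = -B (parity h𝒱 x)) :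
    IsOddAdjoint h𝒱 ω (A * B * C) (-(C' * B' * A')) := by
  intro x y
  simp only [Module.End.mul_apply, LinearMap.neg_apply, map_neg]
  rw [hA, hτ, map_neg, LinearMap.neg_apply, hB, parity_parity, hC]

end IsOddAdjoint

theorem hasWeight_comp_end {h𝒱 : DirectSum.IsInternal 𝒱} {A B : Module.End K V} {a b c : ℤ}
    (hA : HasWeight (scaling h𝒱) (scaling h𝒱) a A) (hB : HasWeight (scaling h𝒱) (scaling h𝒱) b B)
    (h : a + b = c) : HasWeight (scaling h𝒱) (scaling h𝒱) c (A * B) :=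
  hA.comp_eq hB h

namespace IsSymplecticDifferential

variable {h𝒱 : DirectSum.IsInternal 𝒱} {ω : V →ₗ[K] V →ₗ[K] K} {Q : Module.End K V}

theorem parity_Q (S : IsSymplecticDifferential h𝒱 ω Q) (x : V) :
    parity h𝒱 (Q x) = -Q (parity h𝒱 x) :=
  LinearMap.congr_fun (S.Q_weight.parity_odd odd_one) x

/-- Homogeneous elements pair nontrivially only when their degrees add up to one, so exactly one of
them is odd. -/
theorem ω_parity (S : IsSymplecticDifferential h𝒱 ω Q) (x y : V) :
    ω (parity h𝒱 x) (parity h𝒱 y) = -ω x y := by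
  have h : ω.compl₁₂ (parity h𝒱) (parity h𝒱) = -ω := by
    refine ext_homogeneous h𝒱 fun i x hx => ext_homogeneous h𝒱 fun j y hy => ?_
    rw [LinearMap.compl₁₂_apply, scaling_apply h𝒱 _ hx, scaling_apply h𝒱 _ hy]
    by_cases hij : i + j = 1
    · simp only [map_smul, LinearMap.smul_apply, smul_eq_mul, LinearMap.neg_apply]
      rw [← mul_assoc, mul_comm ((-1 : K) ^ j), ← zpow_add₀ (by simp), hij]
      simp
    · simp [S.ω_degree i j x y hx hy hij]
  exact LinearMap.congr_fun₂ h x y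

theorem ext_ω (S : IsSymplecticDifferential h𝒱 ω Q) {x y : V} (h : ∀ z, ω x z = ω y z) : x = y := by
  by_contra hxy
  obtain ⟨z, hz⟩ := S.ω_nondegenerate (x - y) (sub_ne_zero.2 hxy)
  exact hz (by simp [h z])

/-- The given `R` need not satisfy the side conditions, but `RQR` does. Its self-adjointness follows
because isotropy of the image of `RQ` and its orthogonality to the image of `P` leave only the image
of `Q` to pair with. -/
theorem isHodge_of_homotopy (S : IsSymplecticDifferential h𝒱 ω Q) {R P : Module.End K V}
    (hR : HasWeight (scaling h𝒱) (scaling h𝒱) (-1) R) (hsum : Q * R + R * Q + P = 1)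
    (hPP : P * P = P) (hQP : Q * P = 0) (hpu : ∀ x y, ω (P x) (R (Q y)) = 0)
    (huu : ∀ x y, ω (R (Q x)) (R (Q y)) = 0) : IsHodge h𝒱 ω Q (R * Q * R) := by
  have QQ : ∀ x, Q (Q x) = 0 := LinearMap.congr_fun S.Q_sq
  have hs : ∀ x, Q (R x) + R (Q x) + P x = x := LinearMap.congr_fun hsum
  have hqp : ∀ x, Q (P x) = 0 := LinearMap.congr_fun hQP
  have QRQ : ∀ x, Q (R (Q x)) = Q x := fun x => by
    have := congrArg Q (hs x)
    simpa [QQ, hqp] using this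
  have PQ : ∀ x, P (Q x) = 0 := fun x => by
    have := hs (Q x)
    simpa [QQ, QRQ] using this
  have TP : ∀ x, Q (R (P x)) = 0 := fun x => by
    have := hs (P x)
    simpa [hqp, show P (P x) = P x from LinearMap.congr_fun hPP x] using this
  -- This gives `(RQR)² = R (Q R R Q) R = 0`.
  have TU : ∀ x, Q (R (R (Q x))) = 0 := fun x => by
    have := congrArg (fun z => Q (R z)) (hs x)
    simpa [QRQ, TP] using this
  have hPw : HasWeight (scaling h𝒱) (scaling h𝒱) 0 P := by
    have : P = LinearMap.id - (Q * R + R * Q) := by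
      rw [← Module.End.one_eq_id, ← hsum]; abel
    rw [this]
    exact hasWeight_id.sub ((hasWeight_comp_end S.Q_weight hR (by norm_num)).add
      (hasWeight_comp_end hR S.Q_weight (by norm_num)))
  have τP : ∀ x, parity h𝒱 (P x) = P (parity h𝒱 x) :=
    LinearMap.congr_fun (hPw.parity_even (-1) (by simp))
  have τR : ∀ x, parity h𝒱 (R x) = -R (parity h𝒱 x) :=
    LinearMap.congr_fun (hR.parity_odd (by decide))
  refine ⟨S.Q_weight, hasWeight_comp_end (hasWeight_comp_end hR S.Q_weight (c := 0) (by norm_num))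
    hR (by norm_num), S.Q_sq, ?_, ?_, ?_, S.ω_Q, fun x y => ?_⟩
  · ext x; simp [TU]
  · ext x; simp [QRQ]
  · ext x; simp [QRQ]
  · simp only [Module.End.mul_apply]
    have h1 : ω (R (Q (R x))) y = ω (R (Q (R x))) (Q (R y)) := by
      conv_lhs => rw [← hs y]
      rw [map_add, map_add, huu, S.ω_skew (P y), hpu]
      simp
    have τU : parity h𝒱 (R (Q x)) = R (Q (parity h𝒱 x)) := by
      rw [τR, S.parity_Q, map_neg, neg_neg]
    have h2 : ω (parity h𝒱 x) (R (Q (R y))) = ω (parity h𝒱 (Q (R x))) (R (Q (R y))) := by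
      conv_lhs => rw [← hs x]
      rw [map_add, map_add, map_add, map_add, LinearMap.add_apply, LinearMap.add_apply, τP, hpu,
        τU, huu]
      simp
    have h3 := S.ω_Q (parity h𝒱 (R (Q (R x)))) (R (Q (R y)))
    rw [parity_parity, QRQ] at h3
    rw [h1, h2, ← neg_neg (ω (R (Q (R x))) (Q (R y))), ← h3, S.parity_Q,
      τR (Q (R x)), S.parity_Q]
    simp [QRQ]

/-- Passing from `k` to `kQk` yields `hQh = h`. Replacing `h` by `(1 - ½ Qh) h (1 - ½ hQ)` then
makes the square vanish; the symmetric placement of the two corrections preserves self-adjointness.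
-/
theorem isHodge_of_selfAdjoint [CharZero K] (S : IsSymplecticDifferential h𝒱 ω Q)
    {k : Module.End K V} (hk : HasWeight (scaling h𝒱) (scaling h𝒱) (-1) k)
    (hQ : Q * k * Q = Q) (ha : IsOddAdjoint h𝒱 ω k k) : ∃ h, IsHodge h𝒱 ω Q h := by
  have aQ : IsOddAdjoint h𝒱 ω Q (-Q) := fun x y => by rw [S.ω_Q]; simp
  have τk : ∀ x, parity h𝒱 (k x) = -k (parity h𝒱 x) :=
    LinearMap.congr_fun (hk.parity_odd (by decide))
  have hw1 : HasWeight (scaling h𝒱) (scaling h𝒱) (-1) (k * Q * k) :=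
    hasWeight_comp_end (hasWeight_comp_end hk S.Q_weight (c := 0) (by norm_num)) hk (by norm_num)
  have ha1 : IsOddAdjoint h𝒱 ω (k * Q * k) (k * Q * k) := by
    have := ha.triple aQ ha S.parity_Q
    simpa using this
  obtain ⟨h, hhw, hha, QhQ, hQh⟩ : ∃ h, HasWeight (scaling h𝒱) (scaling h𝒱) (-1) h ∧
      IsOddAdjoint h𝒱 ω h h ∧ Q * h * Q = Q ∧ h * Q * h = h := by
    refine ⟨k * Q * k, hw1, ha1, ?_, ?_⟩
    · rw [show Q * (k * Q * k) * Q = (Q * k * Q) * k * Q by noncomm_ring, hQ, hQ]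
    · rw [show k * Q * k * Q * (k * Q * k) = k * (Q * k * Q) * (k * Q * k) by noncomm_ring, hQ,
        show k * Q * (k * Q * k) = k * (Q * k * Q) * k by noncomm_ring, hQ]
  have τh : ∀ x, parity h𝒱 (h x) = -h (parity h𝒱 x) :=
    LinearMap.congr_fun (hhw.parity_odd (by decide))
  have τhhh : ∀ x, parity h𝒱 ((h * h * h) x) = -(h * h * h) (parity h𝒱 x) := fun x => by
    simp [τh]
  have b1 := aQ.triple hha hha τh
  have b2 := hha.triple hha aQ τh
  have b3 := aQ.triple (hha.triple hha hha τh) aQ τhhh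
  set s : K := 2⁻¹
  have hs : s + s = 1 := by rw [← two_mul]; exact mul_inv_cancel₀ two_ne_zero
  have w2 : HasWeight (scaling h𝒱) (scaling h𝒱) (-2) (h * h) :=
    hasWeight_comp_end hhw hhw (by norm_num)
  refine ⟨h + (-s) • (Q * h * h) + (-s) • (h * h * Q) + (s * s) • (Q * (h * h * h) * Q), ?_⟩
  have e : h + (-s) • (Q * h * h) + (-s) • (h * h * Q) + (s * s) • (Q * (h * h * h) * Q) =
      (1 - s • (Q * h)) * h * (1 - s • (h * Q)) := by
    simp only [sub_mul, mul_sub, one_mul, mul_one, smul_mul_assoc, mul_smul_comm, smul_smul,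
      neg_smul, smul_sub, mul_assoc]
    abel
  have Q1 : Q * (1 - s • (Q * h)) = Q := by
    rw [mul_sub, mul_smul_comm, ← mul_assoc, S.Q_sq]; simp
  have Q2 : (1 - s • (h * Q)) * Q = Q := by
    rw [sub_mul, smul_mul_assoc, mul_assoc, S.Q_sq]; simp
  -- The linear corrections each contribute `-½ h²` and the quadratic one contains `Q²`, so the
  -- value one half makes the total vanish.
  have mid : h * (1 - s • (h * Q)) * ((1 - s • (Q * h)) * h) = 0 := by
    have t : h * (1 - s • (h * Q)) * ((1 - s • (Q * h)) * h) =
        h * h - s • (h * (h * Q * h)) - s • ((h * Q * h) * h) +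
          (s * s) • (h * h * (Q * Q) * h * h) := by
      simp only [sub_mul, mul_sub, one_mul, mul_one, smul_mul_assoc, mul_smul_comm, smul_smul,
        smul_sub, mul_assoc]
      abel
    rw [t, hQh, S.Q_sq, sub_sub, ← add_smul, hs]; simp
  refine ⟨S.Q_weight, ?_, S.Q_sq, ?_, ?_, ?_, S.ω_Q, ?_⟩
  · refine ((hhw.add (HasWeight.smul ?_ _)).add (HasWeight.smul ?_ _)).add (HasWeight.smul ?_ _)
    · exact hasWeight_comp_end (hasWeight_comp_end S.Q_weight hhw (c := 0) (by norm_num)) hhw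
        (by norm_num)
    · exact hasWeight_comp_end w2 S.Q_weight (by norm_num)
    · exact hasWeight_comp_end (hasWeight_comp_end S.Q_weight (hasWeight_comp_end w2 hhw
        (c := -3) (by norm_num)) (c := -2) (by norm_num)) S.Q_weight (by norm_num)
  · rw [e]
    calc _ = (1 - s • (Q * h)) * (h * (1 - s • (h * Q)) * ((1 - s • (Q * h)) * h)) *
          (1 - s • (h * Q)) := by simp only [mul_assoc]
      _ = 0 := by rw [mid]; simp
  · rw [e]
    calc _ = (Q * (1 - s • (Q * h))) * h * ((1 - s • (h * Q)) * Q) := by simp only [mul_assoc]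
      _ = Q := by rw [Q1, Q2, QhQ]
  · rw [e]
    calc _ = (1 - s • (Q * h)) * h * (((1 - s • (h * Q)) * Q) * (1 - s • (Q * h))) * h *
          (1 - s • (h * Q)) := by simp only [mul_assoc]
      _ = _ := by
        rw [Q2, Q1, show (1 - s • (Q * h)) * h * Q * h = (1 - s • (Q * h)) * (h * Q * h) by
          simp only [mul_assoc], hQh]
  · have := ((hha.add (b1.smul (-s))).add (b2.smul (-s))).add (b3.smul (s * s))
    have e' : h + (-s) • (-(h * h * -Q)) + (-s) • (-(-Q * h * h)) +
        (s * s) • (-(-Q * -(h * h * h) * -Q)) = h + (-s) • (Q * h * h) + (-s) • (h * h * Q) +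
          (s * s) • (Q * (h * h * h) * Q) := by
      simp only [mul_neg, neg_mul, neg_neg]
      abel
    rw [e'] at this
    exact this

/-- Degree by degree, choose a linear section of `Q` onto its image and extend it to the whole
component. -/
theorem exists_graded_inverse (h𝒱 : DirectSum.IsInternal 𝒱) {Q : Module.End K V}
    (hQ : ∀ i, ∀ x ∈ 𝒱 i, Q x ∈ 𝒱 (i + 1)) :
    ∃ k : Module.End K V, (∀ i, ∀ x ∈ 𝒱 i, k x ∈ 𝒱 (i - 1)) ∧ Q * k * Q = Q := by
  have key : ∀ i : ℤ, ∃ φ : 𝒱 i →ₗ[K] 𝒱 (i - 1), ∀ (x : V) (_ : x ∈ 𝒱 (i - 1)) (hq : Q x ∈ 𝒱 i),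
      Q (φ ⟨Q x, hq⟩) = Q x := by
    intro i
    have hq : ∀ x ∈ 𝒱 (i - 1), Q x ∈ 𝒱 i := fun x hx => by simpa using hQ _ x hx
    set q : 𝒱 (i - 1) →ₗ[K] 𝒱 i := Q.restrict hq
    obtain ⟨r, hr⟩ := q.rangeRestrict.exists_rightInverse_of_surjective q.range_rangeRestrict
    obtain ⟨φ, hφ⟩ := LinearMap.exists_extend r
    refine ⟨φ, fun x hx hq' => ?_⟩
    have h1 : φ (q ⟨x, hx⟩) = r (q.rangeRestrict ⟨x, hx⟩) :=
      LinearMap.congr_fun hφ (q.rangeRestrict ⟨x, hx⟩)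
    have h2 := congrArg (fun z : LinearMap.range q => ((z : 𝒱 i) : V))
      (LinearMap.congr_fun hr (q.rangeRestrict ⟨x, hx⟩))
    change Q (r (q.rangeRestrict ⟨x, hx⟩)) = Q x at h2
    rw [← h1] at h2
    exact h2
  choose φ hφ using key
  have hk : ∀ i x (hx : x ∈ 𝒱 i), assemble h𝒱 (fun i => (𝒱 (i - 1)).subtype ∘ₗ φ i) x =
      φ i ⟨x, hx⟩ := fun i x hx => assemble_apply h𝒱 _ hx
  refine ⟨assemble h𝒱 fun i => (𝒱 (i - 1)).subtype ∘ₗ φ i, fun i x hx => ?_, ?_⟩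
  · rw [hk i x hx]; exact (φ i _).2
  · refine ext_homogeneous h𝒱 fun i x hx => ?_
    rw [Module.End.mul_apply, Module.End.mul_apply, hk (i + 1) _ (hQ i x hx)]
    exact hφ (i + 1) x (by simpa using hx) _

/-- The form pairs degree `i - 1` with degree `2 - i`. By finite dimensionality this pairing is
perfect, so the functional `y ↦ ω (parity x) (k y)` is represented by an element of degree `i - 1`.
-/
theorem exists_adjoint (S : IsSymplecticDifferential h𝒱 ω Q)
    (hfin : ∀ i, FiniteDimensional K (𝒱 i)) {k : Module.End K V}
    (hk : ∀ i, ∀ x ∈ 𝒱 i, k x ∈ 𝒱 (i - 1)) :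
    ∃ k' : Module.End K V, (∀ i, ∀ x ∈ 𝒱 i, k' x ∈ 𝒱 (i - 1)) ∧ IsOddAdjoint h𝒱 ω k' k := by
  have inj : ∀ i j : ℤ, i + j = 1 →
      Function.Injective (ω.compl₁₂ (𝒱 i).subtype (𝒱 j).subtype) := by
    intro i j hij
    refine (injective_iff_map_eq_zero _).2 fun x hx => ?_
    by_contra hne
    refine hne (Subtype.ext (S.ext_ω (y := 0) fun z => ?_))
    have : ω (x : V) = 0 := by
      refine ext_homogeneous h𝒱 fun l y hy => ?_
      by_cases hl : l = j
      · subst hl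
        exact LinearMap.congr_fun hx ⟨y, hy⟩
      · exact S.ω_degree i l _ _ x.2 hy (by omega)
    simp [this]
  have perf : ∀ i : ℤ, (ω.compl₁₂ (𝒱 (i - 1)).subtype (𝒱 (2 - i)).subtype).IsPerfPair := by
    intro i
    have := hfin (i - 1)
    refine .of_injective (inj _ _ (by ring)) ?_
    have h : (ω.compl₁₂ (𝒱 (i - 1)).subtype (𝒱 (2 - i)).subtype).flip =
        -ω.compl₁₂ (𝒱 (2 - i)).subtype (𝒱 (i - 1)).subtype := by
      ext x y
      exact S.ω_skew _ _
    rw [h]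
    intro x y hxy
    exact inj _ _ (by ring) (neg_injective hxy)
  let ψ : ∀ i : ℤ, 𝒱 i →ₗ[K] V := fun i =>
    have := perf i
    (𝒱 (i - 1)).subtype ∘ₗ
      (LinearMap.toPerfPair (ω.compl₁₂ (𝒱 (i - 1)).subtype (𝒱 (2 - i)).subtype)).symm.toLinearMap ∘ₗ
        ω.compl₁₂ (parity h𝒱 ∘ₗ (𝒱 i).subtype) (k ∘ₗ (𝒱 (2 - i)).subtype)
  have hψmem : ∀ i x, ψ i x ∈ 𝒱 (i - 1) := fun i x => Submodule.coe_mem _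
  have hψ : ∀ i (x : 𝒱 i) y, y ∈ 𝒱 (2 - i) → ω (ψ i x) y = ω (parity h𝒱 x) (k y) := by
    intro i x y hy
    have := perf i
    have e := (LinearMap.toPerfPair
      (ω.compl₁₂ (𝒱 (i - 1)).subtype (𝒱 (2 - i)).subtype)).apply_symm_apply
        (ω.compl₁₂ (parity h𝒱 ∘ₗ (𝒱 i).subtype) (k ∘ₗ (𝒱 (2 - i)).subtype) x)
    exact LinearMap.congr_fun e ⟨y, hy⟩
  have ha : ∀ i x (hx : x ∈ 𝒱 i), assemble h𝒱 ψ x = ψ i ⟨x, hx⟩ := fun i x hx =>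
    assemble_apply h𝒱 _ hx
  refine ⟨assemble h𝒱 ψ, fun i x hx => ?_, ?_⟩
  · rw [ha i x hx]; exact hψmem _ _
  · have h : ω ∘ₗ assemble h𝒱 ψ = ω.compl₁₂ (parity h𝒱) k := by
      refine ext_homogeneous h𝒱 fun i x hx => ext_homogeneous h𝒱 fun j y hy => ?_
      rw [LinearMap.comp_apply, ha i x hx, LinearMap.compl₁₂_apply]
      by_cases hij : j = 2 - i
      · subst hij
        exact hψ i ⟨x, hx⟩ y hy
      · rw [S.ω_degree _ _ _ _ (hψmem i ⟨x, hx⟩) hy (by omega), scaling_apply h𝒱 _ hx, map_smul,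
          LinearMap.smul_apply, S.ω_degree _ _ _ _ hx (hk j y hy) (by omega), smul_zero]
    exact fun x y => LinearMap.congr_fun₂ h x y

theorem exists_isHodge_of_finite [CharZero K] (S : IsSymplecticDifferential h𝒱 ω Q)
    (hfin : ∀ i, FiniteDimensional K (𝒱 i)) : ∃ h, IsHodge h𝒱 ω Q h := by
  obtain ⟨k, hk, QkQ⟩ := exists_graded_inverse h𝒱 fun i x hx => S.Q_weight.mem_linear hx
  obtain ⟨k', hk', hadj⟩ := S.exists_adjoint hfin hk
  have wk : HasWeight (scaling h𝒱) (scaling h𝒱) (-1) k := hasWeight_linear h𝒱 hk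
  have wk' : HasWeight (scaling h𝒱) (scaling h𝒱) (-1) k' := hasWeight_linear h𝒱 hk'
  have τk' : ∀ x, parity h𝒱 (k' x) = -k' (parity h𝒱 x) :=
    LinearMap.congr_fun (wk'.parity_odd (by decide))
  have hadj' : IsOddAdjoint h𝒱 ω k k' := by
    intro x y
    have h1 := hadj (parity h𝒱 y) x
    have h2 := S.ω_parity x (k' (parity h𝒱 y))
    rw [parity_parity] at h1
    rw [τk', parity_parity] at h2
    rw [S.ω_skew y, ← h1, S.ω_skew x, neg_neg, ← neg_neg (ω x _), ← h2]
    simp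
  have aQ : IsOddAdjoint h𝒱 ω Q (-Q) := fun x y => by rw [S.ω_Q]; simp
  -- The adjoint of `Q k' Q` is `-(Q k Q) = -Q`, which is also the adjoint of `Q`; nondegeneracy
  -- then identifies the two operators.
  have Qk'Q : Q * k' * Q = Q := by
    ext x
    refine S.ext_ω fun y => ?_
    have h1 := aQ.triple hadj aQ τk' x y
    rw [h1, aQ]
    simp only [neg_mul, mul_neg, neg_neg, QkQ]
  refine S.isHodge_of_selfAdjoint (k := (2⁻¹ : K) • (k + k')) ((wk.add wk').smul _) ?_ ?_
  · rw [mul_smul_comm, smul_mul_assoc, mul_add, add_mul, QkQ, Qk'Q, ← two_smul K, smul_smul,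
      inv_mul_cancel₀ two_ne_zero, one_smul]
  · have := (hadj'.add hadj).smul (2⁻¹ : K)
    rwa [add_comm k' k] at this

end IsSymplecticDifferential

end ExistsHodge

/-! ### Dictionary between families of operations and maps on the tensor algebra. -/

section Translation

open TensorAlgebra TensorProduct

variable {K : Type u} [Field K] {V : Type v} [AddCommGroup V] [Module K V]
  {𝒱 : ℤ → Submodule K V} {h𝒱 : DirectSum.IsInternal 𝒱} {ω : V →ₗ[K] V →ₗ[K] K}
  {Q : Module.End K V}

theorem word_parity_left (h𝒱 : DirectSum.IsInternal 𝒱) {n j : ℕ} (hj : j ≤ n) {d : ℕ → ℤ}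
    {o : ℕ → V} (ho : ∀ i, o i ∈ 𝒱 (d i)) (x : ℕ → V) :
    word K n (fun i => if i < j then parity h𝒱 (o i) else x i) =
      (-1 : K) ^ (∑ i ∈ Finset.range j, d i) • word K n (fun i => if i < j then o i else x i) := by
  have e : (fun i => if i < j then parity h𝒱 (o i) else x i) =
      fun i => (if i < j then (-1 : K) ^ d i else 1) • (if i < j then o i else x i) := by
    funext i
    split_ifs
    · exact scaling_apply h𝒱 _ (ho i)
    · rw [one_smul]
  rw [e, word_smul]
  congr 1
  have hf : (Finset.range n).filter (· < j) = Finset.range j := by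
    ext i; simp only [Finset.mem_filter, Finset.mem_range]; omega
  rw [Finset.prod_ite, Finset.prod_const_one, mul_one, hf]
  clear hf hj e
  induction j with
  | zero => simp
  | succ j ih => rw [Finset.prod_range_succ, Finset.sum_range_succ, zpow_add₀ (by simp), ih]

/-- On homogeneous letters the parity operator in front of the inserted block produces exactly the
sign `(-1) ^ (d_0 + ⋯ + d_{j-1})`. -/
theorem insertionSum_eq (h𝒱 : DirectSum.IsInternal 𝒱) {W : Type v} [AddCommGroup W] [Module K W]
    (g : MultFamily K V W) {m : MultFamily K V V} (hm : m 0 = 0) (n : ℕ) {d : ℕ → ℤ} {o : ℕ → V}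
    (ho : ∀ i, o i ∈ 𝒱 (d i)) :
    insertionSum g m n d o = ofFamily g (coder (parity h𝒱) (ofFamily m) (word K n o)) := by
  have h1 : ofFamily m 1 = 0 := by
    rw [← word_zero (K := K) (fun _ => (0 : V)), ofFamily_word, hm]; rfl
  rw [coder_word _ h1, map_sum, insertionSum, ← Finset.Ico_add_one_right_eq_Icc,
    Finset.sum_Ico_eq_sum_range, Nat.add_sub_cancel]
  refine Finset.sum_congr rfl fun l hl => ?_
  have hl := Finset.mem_range.1 hl
  rw [map_sum, show n + 1 - (1 + l) = n - l by omega]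
  refine Finset.sum_congr rfl fun j hj => ?_
  have hj := Finset.mem_range.1 hj
  rw [word_parity_left h𝒱 hj.le ho, map_smul, ofFamily_word]
  congr 1
  refine congrArg (g (n - l)) (funext fun i => ?_)
  rw [ofFamily_word, add_comm 1 l]
  rfl

theorem coder_zero (ρ : V →ₗ[K] V) : coder ρ (0 : TensorAlgebra K V →ₗ[K] V) = 0 := by
  rw [coder, LinearMap.comp_zero, conv_zero_left, conv_zero_right]

/-- The square of an odd coderivation is an even one, the cross terms cancelling, and by cofreeness
it vanishes with its corestriction. -/
theorem IsCoder.sq_eq_zero {D : Module.End K (TensorAlgebra K V)}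
    (hD : IsCoder (tscaling h𝒱 (-1)) D) (hw : HasWeight (tscaling h𝒱) (tscaling h𝒱) 1 D)
    (h : letter ∘ₗ D ∘ₗ D = 0) : D * D = 0 := by
  have hid : (tmap (LinearMap.id : V →ₗ[K] V)).toLinearMap = LinearMap.id := by
    rw [tmap_id]; rfl
  have hc : comul ∘ₗ D = conv (TensorProduct.mk K _ _) D LinearMap.id +
      conv (TensorProduct.mk K _ _) (tscaling h𝒱 (-1)) D := by
    rw [hD.comul_comp, LinearMap.add_comp, map_comp_comul, map_comp_comul]
  have hDD : IsCoder (tmap (LinearMap.id : V →ₗ[K] V)).toLinearMap (D ∘ₗ D) := by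
    refine isCoder_of_conv (by simp [hD.map_one]) ?_ ?_
    · rw [← LinearMap.comp_assoc, hD.counit_comp, LinearMap.zero_comp]
    · rw [← LinearMap.comp_assoc, hc, LinearMap.add_comp, hD.conv_comp, hD.conv_comp,
        hw.parity_odd odd_one, tscaling_neg_one_sq, conv_neg_left, hid, LinearMap.id_comp]
      abel
  have := hDD.eq_coder
  rw [h, coder_zero] at this
  exact this

theorem form_comp_eq {D : Module.End K (TensorAlgebra K V)}
    (hD : IsCoder (tscaling h𝒱 (-1)) D) : pairing ω ∘ₗ D =
      conv ω (letter ∘ₗ D) letter + conv ω (parity h𝒱 ∘ₗ letter) (letter ∘ₗ D) := by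
  rw [pairing, hD.conv_comp, tscaling, letter_comp_tmap]

theorem cyclic_conv_word (h𝒱 : DirectSum.IsInternal 𝒱) (g : TensorAlgebra K V →ₗ[K] V) (k : ℕ)
    (x : ℕ → V) :
    (conv ω g letter + conv ω (parity h𝒱 ∘ₗ letter) g) (word K (k + 1) x) =
      ω (g (word K k x)) (x k) + ω (parity h𝒱 (x 0)) (g (word K k fun i => x (i + 1))) := by
  have h1 := conv_letter_right_word ω g LinearMap.id k x
  rw [LinearMap.id_comp] at h1
  rw [LinearMap.add_apply, h1, word_succ, conv_letter_mul]
  rfl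

/-- Cyclic invariance of the operations as invariance of the pairing. -/
theorem cyclic_iff (h𝒱 : DirectSum.IsInternal 𝒱) (hω : ∀ x y, ω y x = -ω x y)
    {g : TensorAlgebra K V →ₗ[K] V} (hg : g 1 = 0) :
    conv ω g letter + conv ω (parity h𝒱 ∘ₗ letter) g = 0 ↔
      ∀ k : ℕ, 1 ≤ k → ∀ (d : ℕ → ℤ) (o : ℕ → V), (∀ i, o i ∈ 𝒱 (d i)) →
        ω (o 0) (g (word K k fun i => o (i + 1))) = (-1 : K) ^ d 1 *
          ω (o 1) (g (word K k fun i => if i + 1 = k then o 0 else o (i + 2))) := by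
  constructor
  · intro h k hk d o ho
    -- Evaluates the invariance on the rotated word `o_1 ⋯ o_k o_0`; the skewness of `ω` then brings
    -- `o_0` to the front.
    have h1 := cyclic_conv_word (ω := ω) h𝒱 g k (fun i => if i = k then o 0 else o (i + 1))
    rw [h, LinearMap.zero_apply, if_pos rfl, if_neg (by omega), scaling_apply h𝒱 _ (ho (0 + 1)),
      word_congr (o' := fun i => o (i + 1)) (fun i hi => if_neg hi.ne)] at h1
    rw [hω, neg_eq_of_add_eq_zero_right h1.symm, map_smul, LinearMap.smul_apply]
    rfl
  · intro h
    refine ext_homogeneous_words h𝒱 fun n d x hx => ?_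
    cases n with
    | zero => simp [conv_one, hg]
    | succ k =>
      rw [cyclic_conv_word, LinearMap.zero_apply]
      rcases Nat.eq_zero_or_pos k with rfl | hk
      · simp [hg]
      -- The opposite rotation: the last letter `x_k` plays the role of `o_0`.
      have h1 := h k hk (fun i => if i = 0 then d k else d (i - 1))
        (fun i => if i = 0 then x k else x (i - 1)) (fun i => by
          split_ifs <;> exact hx _)
      simp only [if_true, Nat.add_one_ne_zero, if_false, Nat.add_sub_cancel, one_ne_zero,
        Nat.sub_self] at h1
      rw [scaling_apply h𝒱 _ (hx 0), hω, h1, map_smul, LinearMap.smul_apply, smul_eq_mul,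
        word_congr (o := fun i => x (i + 1)) fun i hi => ?_]
      · exact neg_add_cancel _
      · split_ifs with hik
        · rw [hik]
        · rfl

theorem IsCyclicCoder.weight_Q {D : Module.End K (TensorAlgebra K V)}
    (hD : IsCyclicCoder h𝒱 ω Q D) : HasWeight (scaling h𝒱) (scaling h𝒱) 1 Q := by
  have : Q = letter ∘ₗ D ∘ₗ ι K := LinearMap.ext fun x => (hD.linear x).symm
  rw [this]
  exact (hasWeight_letter h𝒱).comp_eq (hD.weight.comp_eq (hasWeight_ι h𝒱) (add_zero 1))
    (zero_add 1)

theorem IsCyclicCoder.isSymplecticDifferential {D : Module.End K (TensorAlgebra K V)}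
    (hD : IsCyclicCoder h𝒱 ω Q D)
    (ω_degree : ∀ a b x y, x ∈ 𝒱 a → y ∈ 𝒱 b → a + b ≠ 1 → ω x y = 0)
    (ω_skew : ∀ x y, ω y x = -ω x y) (ω_nondegenerate : ∀ x, x ≠ 0 → ∃ y, ω x y ≠ 0) :
    IsSymplecticDifferential h𝒱 ω Q := by
  refine ⟨hD.weight_Q, ?_, fun x y => ?_, ω_degree, ω_skew, ω_nondegenerate⟩
  · ext x
    have := congrArg letter (LinearMap.congr_fun hD.sq (ι K x))
    simpa [hD.apply_ι] using this
  · have h1 := cyclic_conv_word (ω := ω) h𝒱 (letter ∘ₗ D) 1 (fun i => if i = 0 then x else y)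
    rw [← form_comp_eq hD.isCoder, hD.form, word_one, word_one] at h1
    simp only [LinearMap.zero_apply, LinearMap.comp_apply, hD.linear, if_true, one_ne_zero,
      if_false, zero_add] at h1
    exact eq_neg_of_add_eq_zero_left h1.symm

/-- The family of operations underlying a linear map on the tensor algebra. -/
noncomputable def toFamily {W : Type v} [AddCommGroup W] [Module K W]
    (g : TensorAlgebra K V →ₗ[K] W) : MultFamily K V W :=
  fun n => g.compMultilinearMap (tprod K V n)

theorem toFamily_apply {W : Type v} [AddCommGroup W] [Module K W]
    (g : TensorAlgebra K V →ₗ[K] W) (n : ℕ) (o : ℕ → V) :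
    toFamily g n (fun i => o i) = g (word K n o) := rfl

theorem toFamily_one {W : Type v} [AddCommGroup W] [Module K W]
    (g : TensorAlgebra K V →ₗ[K] W) (x : V) : toFamily g 1 (fun _ => x) = g (ι K x) := by
  rw [← word_one (K := K) fun _ => x]
  rfl

theorem toFamily_zero {W : Type v} [AddCommGroup W] [Module K W]
    {g : TensorAlgebra K V →ₗ[K] W} (hg : g 1 = 0) : toFamily g 0 = 0 := by
  ext o
  obtain ⟨x, hx⟩ := exists_word_of_tprod (K := K) 0 o
  change g (tprod K V 0 o) = 0
  rw [hx, word_zero, hg]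

theorem ofFamily_toFamily {W : Type v} [AddCommGroup W] [Module K W]
    (g : TensorAlgebra K V →ₗ[K] W) : ofFamily (toFamily g) = g :=
  ext_words fun n o => by rw [ofFamily_word, toFamily_apply]

theorem exists_extend_letters {n : ℕ} {d : Fin n → ℤ} {o : Fin n → V} (ho : ∀ i, o i ∈ 𝒱 (d i)) :
    ∃ (d' : ℕ → ℤ) (o' : ℕ → V), (∀ i, o' i ∈ 𝒱 (d' i)) ∧ (∀ i : Fin n, d' i = d i) ∧
      o = fun i : Fin n => o' i := by
  refine ⟨fun i => if h : i < n then d ⟨i, h⟩ else 0, fun i => if h : i < n then o ⟨i, h⟩ else 0,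
    fun i => ?_, fun i => by simp, by funext i; simp⟩
  by_cases h : i < n
  · simpa [h] using ho ⟨i, h⟩
  · simp [h]

theorem toFamily_hasDegree [CharZero K] {g : TensorAlgebra K V →ₗ[K] V} {e : ℤ}
    (hg : HasWeight (tscaling h𝒱) (scaling h𝒱) e g) : (toFamily g).HasDegree 𝒱 𝒱 e := by
  intro n d o ho
  obtain ⟨d', o', ho', hd, rfl⟩ := exists_extend_letters ho
  rw [toFamily_apply]
  have := hg.mem n ho'
  rwa [Finset.sum_range, Finset.sum_congr rfl fun i _ => hd i] at this

end Translation

/-! ### The bar differential of a cyclic algebra and its Hodge data. -/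

section Algebra

open TensorAlgebra

variable {K : Type u} [Field K]

/-- The bar differential of a cyclic `A_∞`-algebra. -/
noncomputable def barDifferential (A : CyclicAInftyAlgebra.{u, v} K) :
    Module.End K (TensorAlgebra K A.carrier) :=
  coder (parity A.isInternal) (ofFamily A.m)

theorem ofFamily_m_one (A : CyclicAInftyAlgebra.{u, v} K) :
    ofFamily A.m (1 : TensorAlgebra K A.carrier) = 0 := by
  rw [← word_zero (K := K) (fun _ => (0 : A.carrier)), ofFamily_word, A.m_zero]; rfl

theorem letter_comp_barDifferential (A : CyclicAInftyAlgebra.{u, v} K) :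
    letter ∘ₗ barDifferential A = ofFamily A.m :=
  letter_comp_coder _ (ofFamily_m_one A)

theorem hasWeight_ofFamily_m (A : CyclicAInftyAlgebra.{u, v} K) :
    HasWeight (tscaling A.isInternal) (scaling A.isInternal) 1 (ofFamily A.m) := by
  refine hasWeight_of_words A.isInternal fun n d o ho => ?_
  rw [ofFamily_word, Finset.sum_range]
  exact A.m_degree n _ _ fun i => ho i

theorem isCyclicCoder_barDifferential (A : CyclicAInftyAlgebra.{u, v} K) :
    IsCyclicCoder A.isInternal A.ω A.Q (barDifferential A) := by
  have hc : IsCoder (tscaling A.isInternal (-1)) (barDifferential A) :=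
    isCoder_coder _ (ofFamily_m_one A)
  have hw := hasWeight_coder A.isInternal (hasWeight_parity A.isInternal) (hasWeight_ofFamily_m A)
  refine ⟨hc, hw, hc.sq_eq_zero hw ?_, ?_, fun x => ?_⟩
  · rw [← LinearMap.comp_assoc, letter_comp_barDifferential]
    refine ext_homogeneous_words A.isInternal fun n d o ho => ?_
    cases n with
    | zero => simp [hc.map_one]
    | succ n =>
      rw [LinearMap.comp_apply, barDifferential, ← insertionSum_eq A.isInternal A.m A.m_zero _ ho,
        A.relation _ (by omega) d o ho]
      rfl
  · rw [form_comp_eq hc, letter_comp_barDifferential,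
      cyclic_iff A.isInternal A.ω_skew (ofFamily_m_one A)]
    intro k hk d o ho
    rw [ofFamily_word, ofFamily_word]
    exact A.cyclic k hk d o ho
  · rw [← LinearMap.comp_apply, letter_comp_barDifferential,
      ← word_one (K := K) (fun _ => x), ofFamily_word]
    rfl

theorem isSymplecticDifferential_Q (A : CyclicAInftyAlgebra.{u, v} K) :
    IsSymplecticDifferential A.isInternal A.ω A.Q :=
  (isCyclicCoder_barDifferential A).isSymplecticDifferential A.ω_degree A.ω_skew A.ω_nondegenerate

theorem exists_isHodge [CharZero K] (A : CyclicAInftyAlgebra.{u, v} K)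
    (hA : (∀ i : ℤ, FiniteDimensional K (A.grading i)) ∨
      ∃ Qp : A.carrier →ₗ[K] A.carrier, A.IsCompatibleHomotopy Qp) :
    ∃ h, IsHodge A.isInternal A.ω A.Q h := by
  rcases hA with hA | ⟨R, hR, P, h1, h2, h3, h4, h5⟩
  · exact (isSymplecticDifferential_Q A).exists_isHodge_of_finite hA
  · exact ⟨_, (isSymplecticDifferential_Q A).isHodge_of_homotopy (hasWeight_linear _ hR)
      h1 h2 h3 h4 h5⟩

end Algebra

/-! ### Algebras from bar differentials and images of strict idempotents. -/

section Split

open TensorAlgebra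

variable {K : Type u} [Field K]

/-- The cyclic `A_∞`-algebra with the same underlying symplectic space as `A` and a prescribed bar
differential. -/
noncomputable def algebraOfCoder [CharZero K] (A : CyclicAInftyAlgebra.{u, v} K)
    {D : Module.End K (TensorAlgebra K A.carrier)}
    (hD : IsCyclicCoder A.isInternal A.ω A.Q D) : CyclicAInftyAlgebra.{u, v} K where
  carrier := A.carrier
  grading := A.grading
  isInternal := A.isInternal
  m := toFamily (letter ∘ₗ D)
  m_zero := toFamily_zero (by simp [hD.isCoder.map_one])
  m_degree := toFamily_hasDegree ((hasWeight_letter A.isInternal).comp_eq hD.weight (zero_add 1))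
  relation n hn d o ho := by
    rw [insertionSum_eq A.isInternal _ (toFamily_zero (by simp [hD.isCoder.map_one])) n ho,
      ofFamily_toFamily, ← hD.isCoder.eq_coder]
    have := congrArg letter (LinearMap.congr_fun hD.sq (word K n o))
    simpa using this
  ω := A.ω
  ω_degree := A.ω_degree
  ω_skew := A.ω_skew
  ω_nondegenerate := A.ω_nondegenerate
  cyclic := (cyclic_iff (g := letter ∘ₗ D) A.isInternal A.ω_skew (by simp [hD.isCoder.map_one])).1
    (by rw [← form_comp_eq hD.isCoder, hD.form])

theorem map_insertionSum {V W U : Type v} [AddCommGroup V] [Module K V] [AddCommGroup W]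
    [Module K W] [AddCommGroup U] [Module K U] (φ : W →ₗ[K] U) (g : MultFamily K V W)
    (m : MultFamily K V V) (n : ℕ) (d : ℕ → ℤ) (o : ℕ → V) :
    φ (insertionSum g m n d o) =
      insertionSum (fun n => φ.compMultilinearMap (g n)) m n d o := by
  simp only [insertionSum, map_sum, map_smul]
  rfl

/-- A self-adjoint degree-zero idempotent commuting strictly with all operations. -/
structure IsStrictIdempotent (B : CyclicAInftyAlgebra.{u, v} K) (e : Module.End K B.carrier) :
    Prop where
  degree : ∀ i, ∀ x ∈ B.grading i, e x ∈ B.grading i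
  idem : ∀ x, e (e x) = e x
  map_m : ∀ n (o : Fin n → B.carrier), e (B.m n o) = B.m n fun i => e (o i)
  adjoint : ∀ x y, B.ω (e x) y = B.ω x (e y)

namespace IsStrictIdempotent

variable {B : CyclicAInftyAlgebra.{u, v} K} {e : Module.End K B.carrier}

theorem apply_coe (he : IsStrictIdempotent B e) (x : LinearMap.range e) :
    e (x : B.carrier) = x := by
  obtain ⟨y, hy⟩ := x.2
  rw [← hy, he.idem]

/-- The operations on the image of the idempotent. -/
def imageOps (_ : IsStrictIdempotent B e) : MultFamily K (LinearMap.range e) (LinearMap.range e) :=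
  fun n => e.rangeRestrict.compMultilinearMap
    ((B.m n).compLinearMap fun _ => (LinearMap.range e).subtype)

theorem coe_imageOps (he : IsStrictIdempotent B e) (n : ℕ) (o : Fin n → LinearMap.range e) :
    ((he.imageOps n o : LinearMap.range e) : B.carrier) = B.m n fun i => (o i : B.carrier) := by
  change e (B.m n fun i => (o i : B.carrier)) = _
  rw [he.map_m]
  exact congrArg _ (funext fun i => he.apply_coe (o i))

theorem isInternal (he : IsStrictIdempotent B e) : DirectSum.IsInternal
    fun i => (B.grading i).comap (LinearMap.range e).subtype := by
  have hB := B.isInternal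
  rw [DirectSum.isInternal_submodule_iff_iSupIndep_and_iSup_eq_top] at hB ⊢
  refine ⟨fun i => ?_, ?_⟩
  · rw [Submodule.disjoint_def]
    intro x hx h
    have hle : (⨆ j, ⨆ (_ : j ≠ i), (B.grading j).comap (LinearMap.range e).subtype) ≤
        (⨆ j, ⨆ (_ : j ≠ i), B.grading j).comap (LinearMap.range e).subtype :=
      iSup₂_le fun j hj => Submodule.comap_mono (le_iSup₂_of_le j hj le_rfl)
    exact Subtype.ext (Submodule.disjoint_def.1 (hB.1 i) x hx (hle h))
  · rw [eq_top_iff]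
    intro x _
    have hle : (⨆ i, B.grading i) ≤
        (⨆ i, (B.grading i).comap (LinearMap.range e).subtype).comap e.rangeRestrict :=
      iSup_le fun i y hy => (le_iSup (fun i => (B.grading i).comap (LinearMap.range e).subtype) i)
        (he.degree i y hy)
    have h := hle (x := (x : B.carrier)) (by rw [hB.2]; trivial)
    rw [Submodule.mem_comap] at h
    rwa [show e.rangeRestrict (x : B.carrier) = x from Subtype.ext (he.apply_coe x)] at h

/-- The image of a strict idempotent is a cyclic `A_∞`-algebra. -/
def image (he : IsStrictIdempotent B e) : CyclicAInftyAlgebra.{u, v} K where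
  carrier := LinearMap.range e
  grading i := (B.grading i).comap (LinearMap.range e).subtype
  isInternal := he.isInternal
  m := he.imageOps
  m_zero := by
    ext o
    rw [he.coe_imageOps, B.m_zero]
    rfl
  m_degree n d o ho := by
    rw [Submodule.mem_comap, Submodule.subtype_apply, he.coe_imageOps]
    exact B.m_degree n d _ ho
  relation n hn d o ho := by
    have h := B.relation n hn d (fun i => (o i : B.carrier)) ho
    apply Subtype.ext
    rw [← Submodule.subtype_apply, map_insertionSum, Submodule.coe_zero, ← h]
    simp only [insertionSum, LinearMap.compMultilinearMap_apply, Submodule.subtype_apply,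
      he.coe_imageOps, apply_ite (Subtype.val (p := (· ∈ LinearMap.range e)))]
  ω := B.ω.compl₁₂ (LinearMap.range e).subtype (LinearMap.range e).subtype
  ω_degree a b x y hx hy := B.ω_degree a b _ _ hx hy
  ω_skew x y := B.ω_skew _ _
  ω_nondegenerate x hx := by
    obtain ⟨y, hy⟩ := B.ω_nondegenerate (x : B.carrier) (fun h => hx (Subtype.ext h))
    -- Self-adjointness lets the partner `y` be projected into the image: `ω x (e y) = ω (e x) y = ω
    -- x y`.
    refine ⟨e.rangeRestrict y, ?_⟩
    change B.ω x (e y) ≠ 0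
    rwa [← he.adjoint, he.apply_coe]
  cyclic k hk d o ho := by
    simp only [LinearMap.compl₁₂_apply, Submodule.subtype_apply, he.coe_imageOps,
      apply_ite (Subtype.val (p := (· ∈ LinearMap.range e)))]
    exact B.cyclic k hk d _ ho

theorem rangeRestrict_m (he : IsStrictIdempotent B e) (n : ℕ) (o : Fin n → B.carrier) :
    e.rangeRestrict (B.m n o) = he.image.m n fun i => e.rangeRestrict (o i) := by
  apply Subtype.ext
  change e (B.m n o) = ((he.imageOps n _ : LinearMap.range e) : B.carrier)
  rw [he.coe_imageOps, he.map_m]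
  rfl

theorem coe_image_Q (he : IsStrictIdempotent B e) (z : LinearMap.range e) :
    (show LinearMap.range e from he.image.Q z : B.carrier) = B.Q (z : B.carrier) :=
  he.coe_imageOps 1 fun _ => z

theorem image_isMinimal (he : IsStrictIdempotent B e) (h : ∀ x, B.Q (e x) = 0) :
    he.image.IsMinimal := by
  refine MultilinearMap.ext fun (o : Fin 1 → LinearMap.range e) => ?_
  obtain ⟨y, hy⟩ := (o 0).2
  have ho : o = fun _ => o 0 := funext fun i => by rw [Subsingleton.elim i 0]
  rw [ho]
  refine Subtype.ext ((he.coe_image_Q (o 0)).trans ?_)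
  rw [← hy]
  exact h y

theorem image_isLinearContractible (he : IsStrictIdempotent B e)
    (hm : ∀ n, 2 ≤ n → ∀ o, e (B.m n o) = 0) {k : Module.End K B.carrier}
    (hk : ∀ x, B.Q x = 0 → e x = x → B.Q (e (k x)) = x) : he.image.IsLinearContractible := by
  refine ⟨fun n hn => MultilinearMap.ext fun (o : Fin n → LinearMap.range e) => ?_,
    fun (o : LinearMap.range e) ho => ?_⟩
  · exact Subtype.ext (hm n hn fun i => (o i : B.carrier))
  · have ho' : B.Q (o : B.carrier) = 0 := (he.coe_image_Q o).symm.trans (congrArg Subtype.val ho)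
    exact ⟨e.rangeRestrict (k o),
      Subtype.ext ((he.coe_image_Q _).trans (hk o ho' (he.apply_coe o)))⟩

end IsStrictIdempotent

end Split

/-! ### Assembling the minimal and contractible summands and the isomorphism. -/

section Main

open TensorAlgebra

variable {K : Type u} [Field K] {A : CyclicAInftyAlgebra.{u, v} K}
  {D : Module.End K (TensorAlgebra K A.carrier)} {h : Module.End K A.carrier}

theorem exists_nat_letters {V : Type*} [Zero V] {n : ℕ} (o : Fin n → V) :
    ∃ o' : ℕ → V, o = fun i : Fin n => o' i :=
  ⟨fun i => if h : i < n then o ⟨i, h⟩ else 0, by funext i; simp⟩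

theorem IsSplitUpTo.harm_apply (H : IsHodge A.isInternal A.ω A.Q h)
    (hs : ∀ n, IsSplitUpTo (harm A.Q h) D n) {n : ℕ} (hn : 2 ≤ n) (o : ℕ → A.carrier) :
    harm A.Q h (letter (D (word K n o))) = letter (D (word K n o)) := by
  rw [hs n n hn le_rfl o]
  exact LinearMap.congr_fun H.harm_sq _

theorem IsSplitUpTo.apply_harm (H : IsHodge A.isInternal A.ω A.Q h)
    (hs : ∀ n, IsSplitUpTo (harm A.Q h) D n) {n : ℕ} (hn : 2 ≤ n) (o : ℕ → A.carrier) :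
    letter (D (word K n fun i => harm A.Q h (o i))) = letter (D (word K n o)) := by
  rw [hs n n hn le_rfl o, hs n n hn le_rfl, tmap_word, tmap_word]
  simp only [show ∀ x, harm A.Q h (harm A.Q h x) = harm A.Q h x from LinearMap.congr_fun H.harm_sq]

theorem IsSplitUpTo.numOp_apply (H : IsHodge A.isInternal A.ω A.Q h)
    (hs : ∀ n, IsSplitUpTo (harm A.Q h) D n) {n : ℕ} (hn : 2 ≤ n) (o : ℕ → A.carrier) :
    numOp A.Q h (letter (D (word K n o))) = 0 := by
  rw [hs n n hn le_rfl o]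
  exact LinearMap.congr_fun H.numOp_harm _

theorem IsSplitUpTo.apply_numOp (H : IsHodge A.isInternal A.ω A.Q h)
    (hs : ∀ n, IsSplitUpTo (harm A.Q h) D n) {n : ℕ} (hn : 2 ≤ n) (o : ℕ → A.carrier) :
    letter (D (word K n fun i => numOp A.Q h (o i))) = 0 := by
  rw [← IsSplitUpTo.apply_harm H hs hn]
  simp only [show ∀ x, harm A.Q h (numOp A.Q h x) = 0 from LinearMap.congr_fun H.harm_numOp]
  obtain ⟨k, rfl⟩ : ∃ k, n = k + 1 := ⟨n - 1, by omega⟩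
  simp [word_succ]

/-- Compatibility in arity one is commutation with `Q`, since conjugation by a gauge never alters
the linear part; splitness is needed only from arity two on. -/
theorem isStrictIdempotent_of_words [CharZero K] (hD : IsCyclicCoder A.isInternal A.ω A.Q D)
    {e : Module.End K A.carrier} (hw : HasWeight (scaling A.isInternal) (scaling A.isInternal) 0 e)
    (he : e * e = e) (heQ : e * A.Q = A.Q * e)
    (hm : ∀ n, 2 ≤ n → ∀ o : ℕ → A.carrier,
      e (letter (D (word K n o))) = letter (D (word K n fun i => e (o i))))
    (hω : ∀ x y, A.ω (e x) y = A.ω x (e y)) :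
    IsStrictIdempotent (algebraOfCoder A hD) e := by
  have key : ∀ n (o : ℕ → A.carrier),
      e (letter (D (word K n o))) = letter (D (word K n fun i => e (o i))) := by
    intro n o
    rcases n with _ | _ | n
    · simp [hD.isCoder.map_one]
    · rw [zero_add, word_one, word_one, hD.linear, hD.linear]
      exact LinearMap.congr_fun heQ (o 0)
    · exact hm _ (by omega) o
  refine ⟨fun i x hx => ?_, LinearMap.congr_fun he, fun n o => ?_, hω⟩
  · have := hw.mem_linear hx
    rwa [add_zero] at this
  · obtain ⟨o, rfl⟩ := exists_nat_letters o
    exact key n o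

theorem isStrictIdempotent_harm [CharZero K] (H : IsHodge A.isInternal A.ω A.Q h)
    (hD : IsCyclicCoder A.isInternal A.ω A.Q D) (hs : ∀ n, IsSplitUpTo (harm A.Q h) D n) :
    IsStrictIdempotent (algebraOfCoder A hD) (harm A.Q h) :=
  isStrictIdempotent_of_words hD H.harm_weight H.harm_sq (H.harm_Q.trans H.Q_harm.symm)
    (fun _ hn o => (IsSplitUpTo.harm_apply H hs hn o).trans
      (IsSplitUpTo.apply_harm H hs hn o).symm) H.ω_harm

theorem isStrictIdempotent_numOp [CharZero K] (H : IsHodge A.isInternal A.ω A.Q h)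
    (hD : IsCyclicCoder A.isInternal A.ω A.Q D) (hs : ∀ n, IsSplitUpTo (harm A.Q h) D n) :
    IsStrictIdempotent (algebraOfCoder A hD) (numOp A.Q h) :=
  isStrictIdempotent_of_words hD H.numOp_weight H.numOp_sq (H.numOp_Q.trans H.Q_numOp.symm)
    (fun _ hn o => (IsSplitUpTo.numOp_apply H hs hn o).trans
      (IsSplitUpTo.apply_numOp H hs hn o).symm) H.ω_numOp

theorem algebraOfCoder_Q [CharZero K] (hD : IsCyclicCoder A.isInternal A.ω A.Q D) (x : A.carrier) :
    (algebraOfCoder A hD).Q x = A.Q x :=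
  (toFamily_one (letter ∘ₗ D) x).trans (hD.linear x)

theorem isMinimal_image_harm [CharZero K] (H : IsHodge A.isInternal A.ω A.Q h)
    (hD : IsCyclicCoder A.isInternal A.ω A.Q D) (hs : ∀ n, IsSplitUpTo (harm A.Q h) D n) :
    (isStrictIdempotent_harm H hD hs).image.IsMinimal :=
  (isStrictIdempotent_harm H hD hs).image_isMinimal fun x =>
    (algebraOfCoder_Q hD _).trans (LinearMap.congr_fun H.Q_harm x)

theorem isLinearContractible_image_numOp [CharZero K] (H : IsHodge A.isInternal A.ω A.Q h)
    (hD : IsCyclicCoder A.isInternal A.ω A.Q D) (hs : ∀ n, IsSplitUpTo (harm A.Q h) D n) :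
    (isStrictIdempotent_numOp H hD hs).image.IsLinearContractible := by
  -- On a closed vector in the image of `N` the identity `Qh x + hQ x = x` reduces to `Q (h x) = x`,
  -- so `h` supplies the primitive.
  have hcon : ∀ x : A.carrier, A.Q x = 0 → numOp A.Q h x = x → A.Q (numOp A.Q h (h x)) = x := by
    intro x hx hx'
    have h1 : A.Q (numOp A.Q h (h x)) = A.Q (h x) := LinearMap.congr_fun H.Q_numOp _
    have h2 : A.Q (h x) + h (A.Q x) = x := hx'
    rw [hx, map_zero, add_zero] at h2
    rw [h1, h2]
  refine (isStrictIdempotent_numOp H hD hs).image_isLinearContractible (fun k hk o => ?_) (k := h)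
    fun x hx hx' => (algebraOfCoder_Q hD _).trans
      (hcon x ((algebraOfCoder_Q hD x).symm.trans hx) hx')
  obtain ⟨x, rfl⟩ := exists_nat_letters o
  exact IsSplitUpTo.numOp_apply H hs hk x

theorem map_compositionSum {V W U : Type v} [AddCommGroup V] [Module K V] [AddCommGroup W]
    [Module K W] [AddCommGroup U] [Module K U] (φ : W →ₗ[K] U) {m : MultFamily K W W}
    {m' : MultFamily K U U} (hφ : ∀ n o, φ (m n o) = m' n fun i => φ (o i))
    (f : MultFamily K V W) (n : ℕ) (o : ℕ → V) :
    compositionSum m' (fun n => φ.compMultilinearMap (f n)) n o = φ (compositionSum m f n o) := by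
  simp only [compositionSum, map_sum, hφ, LinearMap.compMultilinearMap_apply]

theorem compositionSum_eq {V : Type v} [AddCommGroup V] [Module K V]
    {F : TensorAlgebra K V →ₗ[K] TensorAlgebra K V} (hF : IsCoalgMap F)
    (g : TensorAlgebra K V →ₗ[K] V) (n : ℕ) (o : ℕ → V) :
    compositionSum (toFamily g) (toFamily (letter ∘ₗ F)) n o = g (F (word K n o)) := by
  rw [hF.word_eq_sum_tprod, map_sum]
  rfl

/-- The pairing of `F w` is the full sum over cuts of `w`. The two extreme cuts vanish because `F 1
= 1` has no one-letter part, and the pairing of a word of length at least three is zero. -/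
theorem sum_pairing_eq {V : Type v} [AddCommGroup V] [Module K V] {ω : V →ₗ[K] V →ₗ[K] K}
    {F : TensorAlgebra K V →ₗ[K] TensorAlgebra K V} (hF : IsCoalgMap F)
    (hω : pairing ω ∘ₗ F = pairing ω) {n : ℕ} (hn : 3 ≤ n) (o : ℕ → V) :
    ∑ k ∈ Finset.Ico 1 n, ω (letter (F (word K k o)))
      (letter (F (word K (n - k) fun i => o (k + i)))) = 0 := by
  have h1 := LinearMap.congr_fun hω (word K n o)
  rw [pairing, hF.conv_comp, conv_word, Finset.range_eq_Ico, Finset.sum_Ico_succ_top (by omega),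
    Finset.sum_eq_sum_Ico_succ_bot (by omega)] at h1
  obtain ⟨k, rfl⟩ : ∃ k, n = k + 1 := ⟨n - 1, by omega⟩
  have h2 := conv_letter_left_word ω LinearMap.id (letter : TensorAlgebra K V →ₗ[K] V) k o
  rw [LinearMap.id_comp, letter_word, if_neg (by omega), map_zero] at h2
  rw [h2] at h1
  simpa [hF.map_one] using h1

/-- The projections onto the harmonic part and its complement. -/
noncomputable def splitting (A : CyclicAInftyAlgebra.{u, v} K) (h : Module.End K A.carrier) :
    A.carrier →ₗ[K] LinearMap.range (harm A.Q h) × LinearMap.range (numOp A.Q h) :=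
  (harm A.Q h).rangeRestrict.prod (numOp A.Q h).rangeRestrict

theorem splitting_bijective (H : IsHodge A.isInternal A.ω A.Q h) :
    Function.Bijective (splitting A h) := by
  have hadd : ∀ x, harm A.Q h x + numOp A.Q h x = x := fun x => by simp [harm]
  constructor
  · intro x y hxy
    have h1 : harm A.Q h x = harm A.Q h y := congrArg (fun p => (p.1 : A.carrier)) hxy
    have h2 : numOp A.Q h x = numOp A.Q h y := congrArg (fun p => (p.2 : A.carrier)) hxy
    rw [← hadd x, ← hadd y, h1, h2]
  · rintro ⟨⟨_, x, rfl⟩, ⟨_, y, rfl⟩⟩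
    have e1 : harm A.Q h (harm A.Q h x) = harm A.Q h x := LinearMap.congr_fun H.harm_sq x
    have e2 : harm A.Q h (numOp A.Q h y) = 0 := LinearMap.congr_fun H.harm_numOp y
    have e3 : numOp A.Q h (harm A.Q h x) = 0 := LinearMap.congr_fun H.numOp_harm x
    have e4 : numOp A.Q h (numOp A.Q h y) = numOp A.Q h y := LinearMap.congr_fun H.numOp_sq y
    refine ⟨harm A.Q h x + numOp A.Q h y, Prod.ext (Subtype.ext ?_) (Subtype.ext ?_)⟩
    · change harm A.Q h (harm A.Q h x + numOp A.Q h y) = _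
      rw [map_add, e1, e2, add_zero]
    · change numOp A.Q h (harm A.Q h x + numOp A.Q h y) = _
      rw [map_add, e3, e4, zero_add]

/-- The direct sum of the harmonic part and its complement. -/
noncomputable abbrev splitAlgebra [CharZero K] (H : IsHodge A.isInternal A.ω A.Q h)
    (hD : IsCyclicCoder A.isInternal A.ω A.Q D) (hs : ∀ n, IsSplitUpTo (harm A.Q h) D n) :
    CyclicAInftyAlgebra.{u, v} K :=
  (isStrictIdempotent_harm H hD hs).image.directSum (isStrictIdempotent_numOp H hD hs).image

/-- `P` and `N` are self-adjoint idempotents with sum one, so the two contributions become `ω x (P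
y)` and `ω x (N y)`. -/
theorem splitting_ω [CharZero K] (H : IsHodge A.isInternal A.ω A.Q h)
    (hD : IsCyclicCoder A.isInternal A.ω A.Q D) (hs : ∀ n, IsSplitUpTo (harm A.Q h) D n)
    (x y : A.carrier) :
    (splitAlgebra H hD hs).ω (splitting A h x) (splitting A h y) = A.ω x y := by
  change A.ω (harm A.Q h x) (harm A.Q h y) + A.ω (numOp A.Q h x) (numOp A.Q h y) = _
  rw [H.ω_harm, H.ω_numOp,
    show harm A.Q h (harm A.Q h y) = harm A.Q h y from LinearMap.congr_fun H.harm_sq y,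
    show numOp A.Q h (numOp A.Q h y) = numOp A.Q h y from LinearMap.congr_fun H.numOp_sq y,
    ← map_add]
  simp [harm]

theorem splitting_m [CharZero K] (H : IsHodge A.isInternal A.ω A.Q h)
    (hD : IsCyclicCoder A.isInternal A.ω A.Q D) (hs : ∀ n, IsSplitUpTo (harm A.Q h) D n)
    (n : ℕ) (o : Fin n → A.carrier) :
    splitting A h (toFamily (letter ∘ₗ D) n o) =
      (splitAlgebra H hD hs).m n fun i => splitting A h (o i) :=
  Prod.ext ((isStrictIdempotent_harm H hD hs).rangeRestrict_m n o)
    ((isStrictIdempotent_numOp H hD hs).rangeRestrict_m n o)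

/-- The cyclic `A_∞`-morphism to the split algebra given by a gauge transformation. -/
noncomputable def splitHom [CharZero K] {F G : Module.End K (TensorAlgebra K A.carrier)}
    (H : IsHodge A.isInternal A.ω A.Q h) (hF : IsGauge A.isInternal A.ω F G)
    (hs : ∀ n, IsSplitUpTo (harm A.Q h) (F * barDifferential A * G) n) :
    CyclicAInftyAlgebra.Hom A
      (splitAlgebra H ((isCyclicCoder_barDifferential A).conj hF) hs) where
  f n := (splitting A h).compMultilinearMap (toFamily (letter ∘ₗ F) n)
  f_zero := by
    rw [toFamily_zero (by simp [hF.coalg.map_one])]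
    exact MultilinearMap.ext fun _ => map_zero (splitting A h)
  f_degree n d o ho := by
    have hm := toFamily_hasDegree ((hasWeight_letter A.isInternal).comp_eq hF.weight (add_zero 0))
      n d o ho
    refine ⟨?_, ?_⟩
    · exact (isStrictIdempotent_harm H _ hs).degree _ _ hm
    · exact (isStrictIdempotent_numOp H _ hs).degree _ _ hm
  relation n hn d o ho := by
    have hD := (isCyclicCoder_barDifferential A).conj hF
    refine (map_compositionSum (splitting A h) (splitting_m H hD hs) _ n o).trans ?_
    refine Eq.trans ?_ (map_insertionSum (splitting A h) (toFamily (letter ∘ₗ F)) A.m n d o)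
    rw [compositionSum_eq hF.coalg, insertionSum_eq A.isInternal _ A.m_zero n ho,
      ofFamily_toFamily]
    -- The morphism relation is the intertwining `(F D G) F = F D`, read through the corestriction
    -- and then through the strict map `splitting`.
    have e : F * barDifferential A * G * F = F * barDifferential A := by
      rw [mul_assoc, hF.mul_eq', mul_one]
    exact congrArg (fun z => splitting A h (letter z)) (LinearMap.congr_fun e (word K n o))
  map_ω x y := by
    have e : ∀ x, toFamily (letter ∘ₗ F) 1 (fun _ => x) = x := fun x => by
      rw [toFamily_one, LinearMap.comp_apply, hF.linear, letter_ι]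
    refine (splitting_ω H _ hs _ _).trans ?_
    rw [e, e]
  map_ω_higher n hn o := by
    refine (Finset.sum_congr rfl fun k _ => splitting_ω H _ hs _ _).trans ?_
    exact sum_pairing_eq hF.coalg hF.form hn o

theorem splitHom_isIso [CharZero K] {F G : Module.End K (TensorAlgebra K A.carrier)}
    (H : IsHodge A.isInternal A.ω A.Q h) (hF : IsGauge A.isInternal A.ω F G)
    (hs : ∀ n, IsSplitUpTo (harm A.Q h) (F * barDifferential A * G) n) :
    (splitHom H hF hs).IsIso := by
  have e : (fun o : A.carrier => (splitHom H hF hs).f 1 (fun _ => o)) = splitting A h := by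
    funext x
    change splitting A h (toFamily (letter ∘ₗ F) 1 fun _ => x) = _
    rw [toFamily_one, LinearMap.comp_apply, hF.linear, letter_ι]
  unfold AInftyAlgebra.Hom.IsIso
  rw [e]
  exact splitting_bijective H

end Main

end BarCoalgebra

/-- Decomposition theorem for cyclic `A_∞`-algebras. The hypothesis is needed only to exclude
infinite-dimensional pathologies: it holds if every homogeneous component is finite-dimensional, and
also, with no bound on dimensions, if `m_1` has a homotopy operator compatible with `ω`. -/
theorem theorem4p9 {K : Type u} [Field K] [CharZero K] (A : CyclicAInftyAlgebra.{u, v} K)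
    (hA : (∀ i : ℤ, FiniteDimensional K (A.grading i)) ∨
      ∃ Qp : A.carrier →ₗ[K] A.carrier, A.IsCompatibleHomotopy Qp) :
    ∃ M C : CyclicAInftyAlgebra.{u, v} K,
      M.IsMinimal ∧ C.IsLinearContractible ∧
      ∃ F : CyclicAInftyAlgebra.Hom A (M.directSum C), F.IsIso := by
  obtain ⟨h, H⟩ := BarCoalgebra.exists_isHodge A hA
  obtain ⟨F, G, hF, hs⟩ := H.exists_gauge_split (BarCoalgebra.isCyclicCoder_barDifferential A)
  exact ⟨_, _, BarCoalgebra.isMinimal_image_harm H _ hs,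
    BarCoalgebra.isLinearContractible_image_numOp H _ hs, BarCoalgebra.splitHom H hF hs,
    BarCoalgebra.splitHom_isIso H hF hs⟩
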